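/- Graphs are finite multigraphs without loops. An edge is \emph{multiple} if another edge has the same endpoints, and \emph{simple} otherwise; a \emph{bundle} is a maximal set of at least two edges with the same pair of endpoints; a graph is \emph{simple} if it has no bundle. For a graph $H$ let $\mathcal C_H$ be the set of all vertices and all multiple edges of $H$. A subgraph $I$ of $H$ is \emph{semi-induced} if any two vertices of $I$ that are adjacent in $H$ are joined by at least one edge of $I$. A \emph{PI-graph} of $G$ is an induced subgraph of a graph obtained from $G$ by replacing some bundles (possibly none) by single edges. A set $A\subseteq\mathcal C_H$ is \emph{admissible} to a connected graph $H$ if (1) $|A\cap V(H)|$ is even and $A$ contains every vertex of $H$ that is incident to no multiple edge of $H$, and (2) $|B\cap A|$ is even and nonzero for every bundle $B$ of $H$. For general $H$, $A\subseteq\mathcal C_H$ is admissible to $H$ if $\mathcal C_{H'}\cap A$ is admissible to $H'$ for every component $H'$ of $H$. Let $\mathcal A^*(G)$ be the set of all pairs $(H,A)$ where $H$ is a PI-graph of $G$ and $A$ is admissible to $H$. For $(H,A)\in\mathcal A^*(G)$ let $\mathcal P^{\mathrm{even}}_{H,A}$ be the poset, ordered by subgraph containment, of all semi-induced subgraphs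 $I$ of $H$ (including $\emptyset$ and $H$) such that every component of $I$ contains an even number of elements of $A$. A poset is \emph{shellable} if the facets of its order complex can be ordered $F_1,\dots,F_t$ so that for every $k=2,\dots,t$ the complex $\bigl(\bigcup_{i<k}\overline{F_i}\bigr)\cap\overline{F_k}$ is pure of dimension $\dim F_k-1$, where $\overline{F}$ is the complex of all faces of $F$ (nonpure shellability of Björner and Wachs). For $m\ge 2$ define the following graphs on the vertices $v_1,\dots,v_n$, each with exactly one bundle, which consists of $m$ edges between $v_1$ and $v_2$: \begin{itemize} \item $\tilde P_{n,m}$ ($n\ge 2$): the other edges are the simple edges $v_iv_{i+1}$, $2\le i\le n-1$; \item $\tilde S_{n,m}$ ($n\ge 5$ odd): the other edges are the simple edges $v_iv_{i+1}$, $2\le i\le n-2$, and $v_{n-2}v_n$; \item $\tilde T_{n,m}$ ($n\ge 5$ odd): $\tilde S_{n,m}$ with the additional simple edge $v_{n-1}v_n$; \item $\tilde P'_{n,m}$ ($n\ge 3$), $\tilde S'_{n,m}$ and $\tilde T'_{n,m}$ ($n\ge 5$ odd): $\tilde P_{n,m}$, $\tilde S_{n,m}$ and $\tilde T_{n,m}$,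 respectively, with the additional simple edge $v_1v_3$. \end{itemize} \textbf{Theorem.} Let $G$ be a finite graph without loops, multiple edges being allowed. Then $\mathcal P^{\mathrm{even}}_{H,A}$ is shellable for every $(H,A)\in\mathcal A^*(G)$ if and only if each component of $G$ is either a simple graph or isomorphic to one of the graphs $\tilde P_{n,m}$ ($n\ge2$), $\tilde P'_{n,m}$ ($n\ge3$), $\tilde S_{n,m}$, $\tilde T_{n,m}$, $\tilde S'_{n,m}$, $\tilde T'_{n,m}$ ($n\ge5$ odd) with $m\ge2$. -/

import Mathlib

/-! ### Order complexes and (nonpure) shellability -/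

/-- The order complex of a poset: its (nonempty) faces are the nonempty finite chains. -/
def orderComplex (P : Type*) [PartialOrder P] : AbstractSimplicialComplex P where
  faces := {s | s.Nonempty ∧ IsChain (· ≤ ·) (s : Set P)}
  isRelLowerSet_faces := fun _ hs =>
    ⟨hs.1, fun _ hts ht => ⟨ht, hs.2.mono (Finset.coe_subset.2 hts)⟩⟩
  singleton_mem := fun v => ⟨Finset.singleton_nonempty v, by simp⟩

/-- A sequence `F 0, F 1, …` of distinct sets is a shelling of `K` if it lists all facets
(inclusion-maximal faces) of `K` and, for every `k > 0`, every inclusion-maximal member of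
`{s | s ⊆ F k and s ⊆ F i for some i < k}` has exactly one element less than `F k`.  This set is the
subcomplex generated by the earlier facets, intersected with the simplex on `F k`; it always contains
the empty face, so it is required to be pure of dimension `dim (F k) - 1` (with `dim ∅ = -1`). -/
structure IsShelling {ι : Type*} (K : AbstractSimplicialComplex ι) {t : ℕ}
    (F : Fin t → Finset ι) : Prop where
  injective : Function.Injective F
  range_eq : Set.range F = {s | Maximal (· ∈ K.faces) s}
  pure : ∀ k : Fin t, 0 < (k : ℕ) →
    ∀ s, Maximal (fun s : Finset ι => s ⊆ F k ∧ ∃ i < k, s ⊆ F i) s → s.card + 1 = (F k).card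

/-- Shellability in the nonpure sense of Björner and Wachs. -/
def AbstractSimplicialComplex.Shellable {ι : Type*} (K : AbstractSimplicialComplex ι) : Prop :=
  ∃ (t : ℕ) (F : Fin t → Finset ι), IsShelling K F

/-- A poset is shellable if its order complex is. -/
def PosetShellable (P : Type*) [PartialOrder P] : Prop :=
  (orderComplex P).Shellable

namespace Graph

variable {α β : Type*}

/-! ### Components, isomorphism, bundles -/

/-- A graph is connected if it is nonempty and any two vertices are joined by a walk. -/
def IsConnected (G : Graph α β) : Prop :=
  V(G).Nonempty ∧ ∀ x ∈ V(G), ∀ y ∈ V(G), Relation.ReflTransGen G.Adj x y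

/-- `C` is a (connected) component of `G`. -/
def IsComponent (C G : Graph α β) : Prop :=
  C ≤c G ∧ C.IsConnected

/-- Isomorphism of multigraphs. -/
def IsIsomorphic {α' β' : Type*} (G : Graph α β) (H : Graph α' β') : Prop :=
  ∃ (f : V(G) ≃ V(H)) (g : E(G) ≃ E(H)), ∀ (e : E(G)) (x y : V(G)),
    G.IsLink (e : β) (x : α) (y : α) ↔ H.IsLink (g e : β') (f x : α') (f y : α')

/-- `e` is a multiple edge of `G`: another edge of `G` has the same endpoints. -/
def IsMultipleEdge (G : Graph α β) (e : β) : Prop :=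
  ∃ e' ≠ e, ∃ x y, G.IsLink e x y ∧ G.IsLink e' x y

/-- A bundle of `G`: the set of all edges between two vertices, if there are at least two. -/
def IsBundle (G : Graph α β) (B : Set β) : Prop :=
  B.Nontrivial ∧ ∃ x y, B = {e | G.IsLink e x y}

/-! ### Semi-induced subgraphs and partial underlying induced graphs -/

/-- `I` is a semi-induced subgraph of `H`: a subgraph with at least one edge between any two of
its vertices that are adjacent in `H`. -/
def IsSemiInduced (I H : Graph α β) : Prop :=
  I ≤ H ∧ ∀ x ∈ V(I), ∀ y ∈ V(I), H.Adj x y → I.Adj x y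

/-- `K` is a partial underlying graph of `G`: it has the same vertices, and between any two vertices
adjacent in `G` it keeps either all edges of `G` or exactly one of them. -/
def IsPartialUnderlying (K G : Graph α β) : Prop :=
  K ≤s G ∧ ∀ x y, G.Adj x y →
    (∀ e, G.IsLink e x y → K.IsLink e x y) ∨ ∃! e, K.IsLink e x y

/-- `H` is a PI-graph of `G`: an induced subgraph of a partial underlying graph of `G`. -/
def IsPIGraph (H G : Graph α β) : Prop :=
  ∃ K : Graph α β, K.IsPartialUnderlying G ∧ H ≤i K

/-! ### Admissible collections and the poset of even subgraphs -/

/-- The vertices and edges of `G`, as a subset of `α ⊕ β`. -/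
def elements (G : Graph α β) : Set (α ⊕ β) :=
  Sum.inl '' V(G) ∪ Sum.inr '' E(G)

/-- The set `𝒞_G` of all vertices and multiple edges of `G`. -/
def collection (G : Graph α β) : Set (α ⊕ β) :=
  Sum.inl '' V(G) ∪ Sum.inr '' {e | G.IsMultipleEdge e}

/-- Admissibility of `A ⊆ 𝒞_H` for a connected graph `H`. -/
structure AdmissibleConnected (H : Graph α β) (A : Set (α ⊕ β)) : Prop where
  subset : A ⊆ H.collection
  even_vertices : Even {v ∈ V(H) | Sum.inl v ∈ A}.ncard
  mem_of_simple : ∀ v ∈ V(H), (∀ e, H.Inc e v → ¬ H.IsMultipleEdge e) → Sum.inl v ∈ A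
  bundle_nonempty : ∀ B, H.IsBundle B → {e ∈ B | Sum.inr e ∈ A}.Nonempty
  bundle_even : ∀ B, H.IsBundle B → Even {e ∈ B | Sum.inr e ∈ A}.ncard

/-- `A` is an admissible collection of `H`: `A ⊆ 𝒞_H`, and `𝒞_C ∩ A` is admissible to `C` for every
component `C` of `H`. -/
def Admissible (H : Graph α β) (A : Set (α ⊕ β)) : Prop :=
  A ⊆ H.collection ∧ ∀ C : Graph α β, C.IsComponent H → C.AdmissibleConnected (C.collection ∩ A)

/-- `I` is `A`-even: every component of `I` contains an even number of elements of `A`. -/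
def IsEven (I : Graph α β) (A : Set (α ⊕ β)) : Prop :=
  ∀ C : Graph α β, C.IsComponent I → Even (C.elements ∩ A).ncard

/-- The poset of `A`-even semi-induced subgraphs of `H`, ordered by the subgraph relation. -/
abbrev EvenPoset (H : Graph α β) (A : Set (α ⊕ β)) : Type _ :=
  {I : Graph α β // I.IsSemiInduced H ∧ I.IsEven A}

/-- The set `𝒜*(G)` of pairs of a PI-graph `H` of `G` and an admissible collection of `H`. -/
def admissiblePairs (G : Graph α β) : Set (Graph α β × Set (α ⊕ β)) :=
  {p | p.1.IsPIGraph G ∧ p.1.Admissible p.2}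

/-! ### The six families

All of them are of the following form: the vertices are `0, …, n - 1`, the bundle joins `0` and `1`,
and the other edges are given by a relation `R`, of which only the pairs `i < j` matter. -/

/-- The graph with vertices `0, …, n - 1`, where for `i < j` with `R i j` there is an edge
`(i, j, 0)` between `i` and `j`, except that between `0` and `1` there are the `m` edges
`(0, 1, 0), …, (0, 1, m - 1)` (if `R 0 1`, `2 ≤ n` and `1 ≤ m`). -/
def oneBundle (n m : ℕ) (R : ℕ → ℕ → Prop) : Graph ℕ (ℕ × ℕ × ℕ) where
  vertexSet := {i | i < n}
  IsLink e x y :=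
    (e.1 < e.2.1 ∧ e.2.1 < n ∧ R e.1 e.2.1 ∧ (e.2.2 = 0 ∨ e.1 = 0 ∧ e.2.1 = 1 ∧ e.2.2 < m)) ∧
      (x = e.1 ∧ y = e.2.1 ∨ x = e.2.1 ∧ y = e.1)
  isLink_symm := fun _ _ => ⟨fun _ _ h => ⟨h.1, by tauto⟩⟩
  eq_or_eq_of_isLink_of_isLink := by
    rintro e x y v w ⟨-, h⟩ ⟨-, h'⟩
    omega
  left_mem_of_isLink := by
    rintro e x y ⟨h, h'⟩
    simp only [Set.mem_ofPred_eq]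
    omega

/-- The path `0 — 1 — ⋯ — (n-1)`. -/
def pathRel (i j : ℕ) : Prop := j = i + 1

/-- The path `0 — 1 — ⋯ — (n-2)` with a further vertex `n-1` attached to `n-3`. -/
def forkRel (n i j : ℕ) : Prop := (j = i + 1 ∧ j + 1 < n) ∨ (i + 3 = n ∧ j + 1 = n)

/-- The path `0 — 1 — ⋯ — (n-2)` with a further vertex `n-1` attached to both `n-3` and `n-2`. -/
def triangleRel (n i j : ℕ) : Prop := j = i + 1 ∨ (i + 3 = n ∧ j + 1 = n)

/-- The additional edge between `0` and `2` in the primed families. -/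
def chordRel (i j : ℕ) : Prop := i = 0 ∧ j = 2

/-- `P̃_{n,m}` -/
def pathP (n m : ℕ) : Graph ℕ (ℕ × ℕ × ℕ) := oneBundle n m pathRel

/-- `S̃_{n,m}` -/
def graphS (n m : ℕ) : Graph ℕ (ℕ × ℕ × ℕ) := oneBundle n m (forkRel n)

/-- `T̃_{n,m}` -/
def graphT (n m : ℕ) : Graph ℕ (ℕ × ℕ × ℕ) := oneBundle n m (triangleRel n)

/-- `P̃'_{n,m}` -/
def pathP' (n m : ℕ) : Graph ℕ (ℕ × ℕ × ℕ) :=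
  oneBundle n m fun i j => pathRel i j ∨ chordRel i j

/-- `S̃'_{n,m}` -/
def graphS' (n m : ℕ) : Graph ℕ (ℕ × ℕ × ℕ) :=
  oneBundle n m fun i j => forkRel n i j ∨ chordRel i j

/-- `T̃'_{n,m}` -/
def graphT' (n m : ℕ) : Graph ℕ (ℕ × ℕ × ℕ) :=
  oneBundle n m fun i j => triangleRel n i j ∨ chordRel i j

/-- `C` is, up to isomorphism, a member of one of the six families. -/
def IsListed (C : Graph α β) : Prop :=
  ∃ n m : ℕ, 2 ≤ m ∧
    ((2 ≤ n ∧ C.IsIsomorphic (pathP n m)) ∨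
      (3 ≤ n ∧ C.IsIsomorphic (pathP' n m)) ∨
      (5 ≤ n ∧ Odd n ∧
        (C.IsIsomorphic (graphS n m) ∨ C.IsIsomorphic (graphT n m) ∨
          C.IsIsomorphic (graphS' n m) ∨ C.IsIsomorphic (graphT' n m))))

end Graph

/-! ### Shellability from a ranking of the covers -/

/-! Both sides of the equivalence say the same as a third condition on `G`, `HasUniqueLinks`. It has
two clauses. A component contains at most one bundle. And if `u`, `v` are the ends of a bundle and
`W` is a vertex set that avoids them and has only components of even size, then at most one vertex
outside `W ∪ {u, v}` can be reached from `u` or `v` by an edge or through a component of `W`.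

Unique links give shellability. The condition passes to PI-graphs. A semi-induced subgraph is
determined by its vertices and multiple edges, so the poset is one of finite sets (`evenPosetIso`),
and it is a product over the components of `H` (`legalEvenProdIso`). In a component with a bundle,
everything except the bundle edges and the two ends lies in `A`, that is, has odd weight. As long as
no new end of the bundle is added, the poset behaves semimodularly (`exists_join_of_noNew`). Covers
that add an end are classified by `SpecialStep` and are placed before all others by `bundleRank`.
This ranking is essentially a recursive atom ordering of all upper intervals
(`BundleSystem.isAtomRanking`), which survives products (`HasAtomRanking.prod`) and yields a
shelling (`IsAtomRanking.exists_numbering`). Uniqueness of the linked vertex enters at one place,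
`le_of_oneEnd`: two covers that each add one end and one further vertex add the same further vertex.

Shellability gives unique links. A shellable poset has no open interval whose order complex has two
components of positive dimension (`not_posetShellable`). If unique links fail, a suitable pair `(H,
A)` has an interval with exactly six new elements of `A`: the ends `u`, `v`, two edges `e`, `e'` of
their bundle, and two more elements `m`, `m'`. In a chain of length three the two inner members have
two and four of these elements. Counting then shows that both contain the same one of `m`, `m'` and
not the other (`iff_of_six_count`), so the interval falls apart. The elements `m`, `m'` are two
vertices linked to the bundle, or two edges of a second bundle.

Unique links characterize the list. In the six families the vertices can be numbered from the bundle
so that an edge jumps over no number `k ≥ 2`, except possibly over `n - 2`, and then only for odd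
`n`; a parity count gives uniqueness (`eq_of_linkedOver`). Conversely a path is grown from the
bundle. Its last vertex has one new neighbour, or none, or two; two are possible only when the path
has an odd number of vertices, and then the component is exhausted (`IsInitialPath.isListed`). -/

section Shelling

variable {P : Type*} [PartialOrder P]

/-- A ranking of the covers of each element which, with ties broken arbitrarily, yields a recursive
atom ordering of every upper interval. -/
structure IsAtomRanking (ρ : P → P → ℕ) : Prop where
  exchange : ∀ {x a e y}, x ⋖ a → x ⋖ e → e ≠ a → ρ x e ≤ ρ x a → a ≤ y → e ≤ y →
    ∃ z, a ⋖ z ∧ z ≤ y ∧ ∃ k, x ⋖ k ∧ k ≤ z ∧ (k = e ∨ ρ x k < ρ x a)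
  compat : ∀ {x a e b b'}, x ⋖ a → x ⋖ e → e ≠ a → ρ x e ≤ ρ x a → a ⋖ b → a ⋖ b' → e ≤ b' →
    ρ a b < ρ a b' → ∃ k, x ⋖ k ∧ k ≤ b ∧ (k = e ∨ ρ x k < ρ x a)

/-- The poset admits a ranking of covers as in `IsAtomRanking`. -/
def HasAtomRanking (P : Type*) [PartialOrder P] : Prop :=
  ∃ ρ : P → P → ℕ, IsAtomRanking ρ

/-- `F` is a maximal chain of the elements above `x`. -/
def IsMaxChainFrom (x : P) (F : Finset P) : Prop :=
  Maximal (fun s : Finset P => IsChain (· ≤ ·) (s : Set P) ∧ ∀ y ∈ s, x ≤ y) F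

namespace IsMaxChainFrom

variable {x a : P} {F : Finset P}

lemma isChain (h : IsMaxChainFrom x F) : IsChain (· ≤ ·) (F : Set P) := h.prop.1

lemma le (h : IsMaxChainFrom x F) {y : P} (hy : y ∈ F) : x ≤ y := h.prop.2 y hy

lemma mem_of_forall (h : IsMaxChainFrom x F) {t : P} (ht : x ≤ t)
    (hc : ∀ y ∈ F, t ≤ y ∨ y ≤ t) : t ∈ F := by
  classical
  have h1 : insert t F ≤ F := h.le_of_ge ⟨?_, ?_⟩ (Finset.subset_insert t F)
  · exact h1 (Finset.mem_insert_self t F)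
  · rw [Finset.coe_insert]
    exact h.isChain.insert fun y hy _ => hc y hy
  · intro y hy
    rcases Finset.mem_insert.1 hy with rfl | hy
    · exact ht
    · exact h.le hy

lemma self_mem (h : IsMaxChainFrom x F) : x ∈ F :=
  h.mem_of_forall le_rfl fun _ hy => Or.inl (h.le hy)

lemma top_mem [OrderTop P] (h : IsMaxChainFrom x F) : ⊤ ∈ F :=
  h.mem_of_forall le_top fun _ _ => Or.inr le_top

lemma cover_unique (h : IsMaxChainFrom x F) {b : P} (ha : a ∈ F) (hb : b ∈ F) (hxa : x ⋖ a)
    (hxb : x ⋖ b) : a = b := by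
  rcases h.isChain.total ha hb with hab | hab
  · exact (hxb.eq_or_eq hxa.le hab).resolve_left hxa.ne'
  · exact ((hxa.eq_or_eq hxb.le hab).resolve_left hxb.ne').symm

/-- Maximality leaves no gap, so the least element of `F` other than `x` covers `x`. This is the
recursion along which maximal chains are numbered. -/
lemma exists_cover [DecidableEq P] [OrderTop P] (h : IsMaxChainFrom x F) (hx : x ≠ ⊤) :
    ∃ a, x ⋖ a ∧ a ∈ F ∧ IsMaxChainFrom a (F.erase x) := by
  obtain ⟨a, ha⟩ := (F.erase x).exists_minimal ⟨⊤, Finset.mem_erase.2 ⟨hx.symm, h.top_mem⟩⟩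
  have haF : a ∈ F := (Finset.mem_erase.1 ha.1).2
  have hxa : x < a := lt_of_le_of_ne (h.le haF) (Finset.mem_erase.1 ha.1).1.symm
  have hle : ∀ y ∈ F.erase x, a ≤ y := fun y hy => by
    rcases h.isChain.total haF (Finset.mem_erase.1 hy).2 with h1 | h1
    · exact h1
    · exact ha.2 hy h1
  refine ⟨a, ⟨hxa, fun t hxt hta => ?_⟩, haF, ⟨?_, hle⟩, ?_⟩
  · have : t ∈ F := h.mem_of_forall hxt.le fun y hy => by
      by_cases hyx : y = x
      · exact Or.inr (hyx ▸ hxt.le)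
      · exact Or.inl (hta.le.trans (hle y (Finset.mem_erase.2 ⟨hyx, hy⟩)))
    exact (hle t (Finset.mem_erase.2 ⟨hxt.ne', this⟩)).not_gt hta
  · exact h.isChain.mono (by simp)
  · rintro s ⟨hs, hs'⟩ hle' t ht
    have h1 : insert x s ≤ F := h.le_of_ge ⟨?_, ?_⟩ ?_
    · exact Finset.mem_erase.2 ⟨(hxa.trans_le (hs' t ht)).ne', h1 (Finset.mem_insert_of_mem ht)⟩
    · rw [Finset.coe_insert]
      exact hs.insert fun y hy _ => Or.inl (hxa.le.trans (hs' y hy))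
    · intro y hy
      rcases Finset.mem_insert.1 hy with rfl | hy
      · exact le_rfl
      · exact hxa.le.trans (hs' y hy)
    · intro y hy
      by_cases hyx : y = x
      · exact Finset.mem_insert.2 (Or.inl hyx)
      · exact Finset.mem_insert_of_mem (hle' (Finset.mem_erase.2 ⟨hyx, hy⟩))

lemma notMem (h : IsMaxChainFrom a F) (hxa : x < a) : x ∉ F := fun hx => (h.le hx).not_gt hxa

lemma insert [DecidableEq P] (h : IsMaxChainFrom a F) (hxa : x ⋖ a) :
    IsMaxChainFrom x (insert x F) := by
  refine ⟨⟨?_, ?_⟩, ?_⟩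
  · rw [Finset.coe_insert]
    exact h.isChain.insert fun y hy _ => Or.inl (hxa.le.trans (h.le hy))
  · intro y hy
    rcases Finset.mem_insert.1 hy with rfl | hy
    · exact le_rfl
    · exact hxa.le.trans (h.le hy)
  · rintro s ⟨hs, hs'⟩ hle t ht
    have h1 : s.erase x ≤ F := h.le_of_ge ⟨hs.mono (by simp), ?_⟩ ?_
    · by_cases htx : t = x
      · exact Finset.mem_insert.2 (Or.inl htx)
      · exact Finset.mem_insert_of_mem (h1 (Finset.mem_erase.2 ⟨htx, ht⟩))
    · intro y hy
      obtain ⟨hyx, hy⟩ := Finset.mem_erase.1 hy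
      have haS : a ∈ s := hle (Finset.mem_insert_of_mem h.self_mem)
      rcases hs.total haS hy with h2 | h2
      · exact h2
      · exact ((hxa.eq_or_eq (hs' y hy) h2).resolve_left hyx).ge
    · intro y hy
      exact Finset.mem_erase.2 ⟨fun hyx => h.notMem hxa.lt (hyx ▸ hy),
        hle (Finset.mem_insert_of_mem hy)⟩

end IsMaxChainFrom

lemma exists_isMaxChainFrom [Finite P] {x : P} {s : Finset P}
    (hs : IsChain (· ≤ ·) (s : Set P)) (hx : ∀ y ∈ s, x ≤ y) :
    ∃ F, s ⊆ F ∧ IsMaxChainFrom x F := by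
  classical
  have := Fintype.ofFinite P
  obtain ⟨F, h1, h2⟩ := Finite.exists_le_maximal
    (p := fun s : Finset P => IsChain (· ≤ ·) (s : Set P) ∧ ∀ y ∈ s, x ≤ y) ⟨hs, hx⟩
  exact ⟨F, h1, h2⟩

lemma maximal_orderComplex_iff [OrderBot P] {F : Finset P} :
    Maximal (· ∈ (orderComplex P).faces) F ↔ IsMaxChainFrom ⊥ F := by
  constructor
  · intro h
    refine ⟨⟨h.prop.2, fun _ _ => bot_le⟩, fun s hs hle => h.2 ⟨?_, hs.1⟩ hle⟩
    exact h.prop.1.mono hle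
  · intro h
    exact ⟨⟨⟨⊥, h.self_mem⟩, h.isChain⟩, fun s hs hle => h.2 ⟨hs.2, fun _ _ => bot_le⟩ hle⟩

lemma mul_add_lt_mul_add {a b i j N : ℕ} (hab : a < b) (hi : i < N) : a * N + i < b * N + j := by
  have h1 : (a + 1) * N ≤ b * N := Nat.mul_le_mul_right N hab
  have h2 : (a + 1) * N = a * N + N := by ring
  omega

/-- The maximal chains above `x` can be numbered so that the shelling condition holds and the chains
through a prescribed set of covers come first. -/
lemma IsAtomRanking.exists_numbering [Finite P] [OrderTop P] {ρ : P → P → ℕ}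
    (hρ : IsAtomRanking ρ) (x : P) :
    ∀ E : Set P, (∀ b b', x ⋖ b → x ⋖ b' → b ∉ E → b' ∈ E → ρ x b' ≤ ρ x b) →
    ∃ ν : Finset P → ℕ, Set.InjOn ν {F | IsMaxChainFrom x F} ∧
      (∀ F G, IsMaxChainFrom x F → IsMaxChainFrom x G → ν F < ν G →
        ∃ F', IsMaxChainFrom x F' ∧ ν F' < ν G ∧ ∃ p ∈ G, p ∉ F ∧ ∀ q ∈ G, q ≠ p → q ∈ F') ∧
      (∀ F G, IsMaxChainFrom x F → IsMaxChainFrom x G → (∃ a ∈ F, x ⋖ a ∧ a ∈ E) →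
        (¬ ∃ a ∈ G, x ⋖ a ∧ a ∈ E) → ν F < ν G) := by
  classical
  induction x using WellFoundedGT.induction with
  | ind x ih =>
  intro E hE
  by_cases hx : x = ⊤
  · subst hx
    refine ⟨fun _ => 0, ?_, fun _ _ _ _ h => absurd h (lt_irrefl _), ?_⟩
    · have : ∀ F : Finset P, IsMaxChainFrom ⊤ F → F = {⊤} := fun F hF =>
        Finset.eq_singleton_iff_unique_mem.2 ⟨hF.self_mem, fun y hy => top_le_iff.1 (hF.le hy)⟩
      intro F hF G hG _
      rw [this F hF, this G hG]
    · rintro F G - - ⟨a, -, h, -⟩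
      exact absurd h.lt not_top_lt
  obtain ⟨N, ⟨idx⟩⟩ := Finite.exists_equiv_fin P
  -- The factor 2 leaves room to put the covers in `E` first among those of equal rank, and `idx`
  -- breaks the remaining ties. By `hE` this never reverses the order of `ρ`.
  set key : P → ℕ := fun a => 2 * ρ x a + (if a ∈ E then 0 else 1) with hkey
  set r : P → ℕ := fun a => key a * N + idx a with hr
  have hrkey : ∀ a b, key a < key b → r a < r b := fun a b h =>
    mul_add_lt_mul_add h (idx a).2
  have hrinj : ∀ a b, r a = r b → a = b := by
    intro a b hab
    have h1 : key a = key b := by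
      rcases lt_trichotomy (key a) (key b) with h | h | h
      · exact absurd hab (hrkey a b h).ne
      · exact h
      · exact absurd hab (hrkey b a h).ne'
    simp only [hr, h1] at hab
    exact idx.injective (Fin.ext (by omega))
  have hrρ : ∀ a b, r a < r b → ρ x a ≤ ρ x b := by
    intro a b hab
    by_contra h
    have : key b < key a := by
      simp only [hkey]; split_ifs <;> omega
    exact absurd (hrkey b a this) hab.not_gt
  have hρr : ∀ a b, ρ x a < ρ x b → r a < r b := by
    intro a b hab
    apply hrkey
    simp only [hkey]; split_ifs <;> omega
  -- As in a recursive atom ordering, the covers of `a` that lie above an earlier cover of `x` have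
  -- to come first among the covers of `a`. The condition `compat` says exactly that the ranking
  -- allows this.
  set En : P → Set P := fun a => {z | ∃ k, x ⋖ k ∧ r k < r a ∧ k ≤ z} with hEn
  have hEcompat : ∀ a, x ⋖ a → ∀ b b', a ⋖ b → a ⋖ b' → b ∉ En a → b' ∈ En a →
      ρ a b' ≤ ρ a b := by
    intro a ha b b' hb hb' hbE hb'E
    by_contra hlt
    obtain ⟨e, hxe, hre, heb⟩ := hb'E
    obtain ⟨k, hk, hkb, h⟩ := hρ.compat ha hxe (fun h => by simp [h] at hre) (hrρ _ _ hre) hb hb' heb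
      (not_le.1 hlt)
    refine hbE ⟨k, hk, ?_, hkb⟩
    rcases h with rfl | h
    · exact hre
    · exact hρr _ _ h
  choose! ν hν using fun a (ha : x ⋖ a) => ih a ha.lt (En a) (hEcompat a ha)
  have := Fintype.ofFinite P
  obtain ⟨M, hM⟩ : ∃ M, ∀ a F, ν a F < M := by
    obtain ⟨M, hM⟩ := (Set.finite_range fun q : P × Finset P => ν q.1 q.2).bddAbove
    exact ⟨M + 1, fun a F => Nat.lt_succ_of_le (hM ⟨(a, F), rfl⟩)⟩
  choose! c hc using fun F (hF : IsMaxChainFrom x F) => hF.exists_cover hx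
  have hcu : ∀ F a, IsMaxChainFrom x F → x ⋖ a → a ∈ F → c F = a := fun F a hF ha haF =>
    hF.cover_unique (hc F hF).2.1 haF (hc F hF).1 ha
  have hins : ∀ a F, x ⋖ a → IsMaxChainFrom a F →
      c (insert x F) = a ∧ (insert x F).erase x = F := fun a F ha hF =>
    ⟨hcu _ _ (hF.insert ha) ha (Finset.mem_insert_of_mem hF.self_mem),
      Finset.erase_insert (hF.notMem ha.lt)⟩
  -- Lexicographic: first by the cover of `x` in the chain, then by the number of the rest of the
  -- chain; `M` bounds the second component.
  set μ : Finset P → ℕ := fun F => r (c F) * M + ν (c F) (F.erase x) with hμ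
  have hμlt : ∀ F G, r (c F) < r (c G) → μ F < μ G := fun F G h => mul_add_lt_mul_add h (hM _ _)
  have hμcase : ∀ F G, μ F < μ G → r (c F) < r (c G) ∨
      (c F = c G ∧ ν (c G) (F.erase x) < ν (c G) (G.erase x)) := by
    intro F G h
    rcases lt_trichotomy (r (c F)) (r (c G)) with h1 | h1 | h1
    · exact Or.inl h1
    · have h2 := hrinj _ _ h1
      simp only [hμ, h2] at h
      exact Or.inr ⟨h2, by omega⟩
    · exact absurd (hμlt G F h1) h.not_gt
  -- replaces the tail of a chain whose first cover is kept
  have hlift : ∀ G F0, IsMaxChainFrom x G → IsMaxChainFrom (c G) F0 →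
      ν (c G) F0 < ν (c G) (G.erase x) →
      IsMaxChainFrom x (insert x F0) ∧ μ (insert x F0) < μ G := by
    intro G F0 hG hF0 hlt
    obtain ⟨h1, h2⟩ := hins _ F0 (hc G hG).1 hF0
    refine ⟨hF0.insert (hc G hG).1, ?_⟩
    simp only [hμ, h1, h2]
    omega
  refine ⟨μ, ?_, ?_, ?_⟩
  · intro F hF G hG h
    have h1 : r (c F) = r (c G) := by
      rcases lt_trichotomy (r (c F)) (r (c G)) with h1 | h1 | h1
      · exact absurd h (hμlt _ _ h1).ne
      · exact h1
      · exact absurd h (hμlt _ _ h1).ne'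
    have h2 := hrinj _ _ h1
    simp only [hμ, h2] at h
    have h3 := (hν _ (hc G hG).1).1 (h2 ▸ (hc F hF).2.2) (hc G hG).2.2 (by omega)
    rw [← Finset.insert_erase hF.self_mem, h3, Finset.insert_erase hG.self_mem]
  · intro F G hF hG hlt
    rcases hμcase F G hlt with h | ⟨h1, h2⟩
    · set a := c G
      set e := c F
      have hxa := (hc G hG).1
      have hxe := (hc F hF).1
      have hea : e ≠ a := fun h' => by simp [h'] at h
      have haF : a ∉ F := fun h' => hea (hcu F a hF hxa h')
      -- `y` is the least common element of the two chains above `x`. The exchange takes place below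
      -- `y`, so the part of `G` from `y` upwards can be kept.
      obtain ⟨y, hy⟩ := ((F ∩ G).erase x).exists_minimal
        ⟨⊤, Finset.mem_erase.2 ⟨Ne.symm hx, Finset.mem_inter.2 ⟨hF.top_mem, hG.top_mem⟩⟩⟩
      obtain ⟨hyx, hyFG⟩ := Finset.mem_erase.1 hy.1
      obtain ⟨hyF, hyG⟩ := Finset.mem_inter.1 hyFG
      have hyle : ∀ q ∈ F, q ∈ G → q ≠ x → y ≤ q := by
        intro q hqF hqG hqx
        rcases hF.isChain.total hyF hqF with h1 | h1
        · exact h1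
        · exact hy.2 (Finset.mem_erase.2 ⟨hqx, Finset.mem_inter.2 ⟨hqF, hqG⟩⟩) h1
      obtain ⟨z, haz, hzy, k, hxk, hkz, hk⟩ := hρ.exchange hxa hxe hea (hrρ _ _ h)
        ((hc G hG).2.2.le (Finset.mem_erase.2 ⟨hyx, hyG⟩))
        ((hc F hF).2.2.le (Finset.mem_erase.2 ⟨hyx, hyF⟩))
      have hrk : r k < r a := by
        rcases hk with rfl | hk
        · exact h
        · exact hρr _ _ hk
      have hG0 := (hc G hG).2.2
      obtain ⟨g, hag, hgG, hGg⟩ := hG0.exists_cover (ne_top_of_lt haz.lt)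
      -- If the successor `g` of `a` in `G` lies above an earlier cover of `x`, then that cover can
      -- replace `a`, and `a` is the only element lost.
      by_cases hgE : g ∈ En a
      · obtain ⟨k', hxk', hrk', hk'g⟩ := hgE
        have hle : ∀ q ∈ (G.erase x).erase a, k' ≤ q := fun q hq => hk'g.trans (hGg.le hq)
        obtain ⟨F', hsub, hF'⟩ := exists_isMaxChainFrom (x := x)
          (s := insert x (insert k' ((G.erase x).erase a))) (by
            rw [Finset.coe_insert, Finset.coe_insert]
            refine (hGg.isChain.insert fun q hq _ => Or.inl (hle q hq)).insert fun q hq _ =>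
              Or.inl ?_
            rcases hq with rfl | hq
            · exact hxk'.le
            · exact hxk'.le.trans (hle q hq)) (by
            intro q hq
            simp only [Finset.mem_insert] at hq
            rcases hq with rfl | rfl | hq
            · exact le_rfl
            · exact hxk'.le
            · exact hxk'.le.trans (hle q hq))
        have hcF' : c F' = k' := hcu _ _ hF' hxk' (hsub (by simp))
        refine ⟨F', hF', hμlt _ _ (by rw [hcF']; exact hrk'), a, (hc G hG).2.1, haF,
          fun q hq hqa => hsub ?_⟩
        by_cases hqx : q = x <;> simp [hqx, hqa, hq]
      -- Otherwise a chain through `a` and `z` precedes the tail of `G`, because `z` is in `En a`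
      -- and `g` is not. The induction hypothesis at `a` yields the element `p` to drop. It is not
      -- in `F`, since the common elements from `y` on were put into `F''`.
      · obtain ⟨F'', hsub, hF''⟩ := exists_isMaxChainFrom (x := a)
          (s := insert a (insert z ((G.erase x).filter (y ≤ ·)))) (by
            rw [Finset.coe_insert, Finset.coe_insert]
            refine ((hG0.isChain.mono (Finset.coe_subset.2 (Finset.filter_subset _ _))).insert
              fun q hq _ => Or.inl ?_).insert
              fun q hq _ => Or.inl ?_
            · exact hzy.trans (Finset.mem_filter.1 (Finset.mem_coe.1 hq)).2
            · rcases hq with rfl | hq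
              · exact haz.le
              · exact hG0.le (Finset.mem_filter.1 (Finset.mem_coe.1 hq)).1) (by
            intro q hq
            simp only [Finset.mem_insert] at hq
            rcases hq with rfl | rfl | hq
            · exact le_rfl
            · exact haz.le
            · exact hG0.le (Finset.mem_filter.1 hq).1)
        have hfirst := (hν a hxa).2.2 F'' (G.erase x) hF'' hG0
          ⟨z, hsub (by simp), haz, k, hxk, hrk, hkz⟩ (by
            rintro ⟨g', hg', hag', hg'E⟩
            exact hgE (hG0.cover_unique hg' hgG hag' hag ▸ hg'E))
        obtain ⟨F0, hF0, hlt0, p, hp, hpF, hsub0⟩ :=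
          (hν a hxa).2.1 F'' (G.erase x) hF'' hG0 hfirst
        obtain ⟨h3, h4⟩ := hlift G F0 hG hF0 hlt0
        obtain ⟨hpx, hpG⟩ := Finset.mem_erase.1 hp
        refine ⟨_, h3, h4, p, hpG, fun hpF' => hpF (hsub ?_), fun q hq hqp => ?_⟩
        · simp [hpx, hpG, hyle p hpF' hpG hpx]
        · by_cases hqx : q = x
          · simp [hqx]
          · exact Finset.mem_insert_of_mem (hsub0 q (Finset.mem_erase.2 ⟨hqx, hq⟩) hqp)
    · obtain ⟨F0, hF0, hlt0, p, hp, hpF, hsub0⟩ := (hν _ (hc G hG).1).2.1 (F.erase x) (G.erase x)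
        (h1 ▸ (hc F hF).2.2) (hc G hG).2.2 h2
      obtain ⟨h3, h4⟩ := hlift G F0 hG hF0 hlt0
      obtain ⟨hpx, hpG⟩ := Finset.mem_erase.1 hp
      refine ⟨_, h3, h4, p, hpG, fun h => hpF (Finset.mem_erase.2 ⟨hpx, h⟩), fun q hq hqp => ?_⟩
      by_cases hqx : q = x
      · simp [hqx]
      · exact Finset.mem_insert_of_mem (hsub0 q (Finset.mem_erase.2 ⟨hqx, hq⟩) hqp)
  · rintro F G hF hG ⟨a, haF, hxa, haE⟩ hnG
    apply hμlt
    apply hrkey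
    have h1 : c F ∈ E := (hcu F a hF hxa haF) ▸ haE
    have h2 : c G ∉ E := fun h => hnG ⟨c G, (hc G hG).2.1, (hc G hG).1, h⟩
    have h3 := hE _ _ (hc G hG).1 (hc F hF).1 h2 h1
    simp only [hkey, h1, h2, if_true, if_false]
    omega

/-- The facets are the maximal chains from `⊥`, sorted by their numbers. A face common to `F k` and
an earlier facet misses the element `p` supplied by the numbering, and `F k` without `p` lies in an
earlier facet. So a maximal such face is `F k` without `p`. -/
theorem HasAtomRanking.posetShellable [Finite P] [BoundedOrder P] (h : HasAtomRanking P) :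
    PosetShellable P := by
  classical
  have := Fintype.ofFinite P
  obtain ⟨ρ, hρ⟩ := h
  obtain ⟨ν, hinj, hsh, -⟩ := hρ.exists_numbering ⊥ ∅ (by simp)
  set 𝓕 : Finset (Finset P) := Finset.univ.filter (IsMaxChainFrom ⊥) with h𝓕
  have hmem : ∀ F, F ∈ 𝓕 ↔ IsMaxChainFrom ⊥ F := by simp [h𝓕]
  set I := 𝓕.image ν
  set o := I.orderIsoOfFin rfl
  have hpre : ∀ k, ∃ F, IsMaxChainFrom ⊥ F ∧ ν F = o k := fun k => by
    obtain ⟨F, hF, h⟩ := Finset.mem_image.1 (o k).2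
    exact ⟨F, (hmem F).1 hF, h⟩
  choose F hF hνF using hpre
  have hsurj : ∀ G, IsMaxChainFrom ⊥ G → ∃ k, F k = G := by
    intro G hG
    refine ⟨o.symm ⟨ν G, Finset.mem_image_of_mem _ ((hmem G).2 hG)⟩, hinj (hF _) hG ?_⟩
    rw [hνF]; simp
  have hlt : ∀ i k, ν (F i) < ν (F k) ↔ i < k := by
    intro i k
    rw [hνF, hνF, Subtype.coe_lt_coe, o.lt_iff_lt]
  refine ⟨_, F, ⟨fun i j hij => ?_, ?_, ?_⟩⟩
  · have : (o i : ℕ) = o j := by rw [← hνF, ← hνF, hij]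
    exact o.injective (Subtype.ext this)
  · ext s
    rw [Set.mem_ofPred_eq, maximal_orderComplex_iff]
    exact ⟨by rintro ⟨k, rfl⟩; exact hF k, hsurj s⟩
  · rintro k - s hs
    obtain ⟨hsk, i, hik, hsi⟩ := hs.prop
    obtain ⟨F', hF', hlt', p, hp, hpi, hsub⟩ := hsh (F i) (F k) (hF i) (hF k) ((hlt _ _).2 hik)
    obtain ⟨j, rfl⟩ := hsurj F' hF'
    have h1 : s ⊆ (F k).erase p := fun q hq =>
      Finset.mem_erase.2 ⟨fun h => hpi (h ▸ hsi hq), hsk hq⟩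
    have h2 : (F k).erase p ≤ s := hs.le_of_ge ⟨Finset.erase_subset _ _, j, (hlt _ _).1 hlt',
      fun q hq => hsub q (Finset.mem_erase.1 hq).2 (Finset.mem_erase.1 hq).1⟩ h1
    rw [Finset.Subset.antisymm h1 h2, Finset.card_erase_add_one hp]

lemma HasAtomRanking.of_orderIso {Q : Type*} [PartialOrder Q] (φ : P ≃o Q)
    (h : HasAtomRanking Q) : HasAtomRanking P := by
  obtain ⟨ρ, hρ⟩ := h
  refine ⟨fun x a => ρ (φ x) (φ a), ⟨?_, ?_⟩⟩
  · intro x a e y hxa hxe hne hle hay hey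
    obtain ⟨z, h1, h2, k, h3, h4, h5⟩ := hρ.exchange ((apply_covBy_apply_iff φ).2 hxa)
      ((apply_covBy_apply_iff φ).2 hxe) (fun h => hne (φ.injective h)) hle
      (φ.monotone hay) (φ.monotone hey)
    refine ⟨φ.symm z, ?_, ?_, φ.symm k, ?_, ?_, ?_⟩
    · rw [← apply_covBy_apply_iff φ]; simpa
    · rw [← φ.le_iff_le]; simpa
    · rw [← apply_covBy_apply_iff φ]; simpa
    · rw [← φ.le_iff_le]; simpa
    · rcases h5 with rfl | h5
      · left; simp
      · right; simpa
  · intro x a e b b' hxa hxe hne hle hab hab' heb hlt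
    obtain ⟨k, h3, h4, h5⟩ := hρ.compat ((apply_covBy_apply_iff φ).2 hxa)
      ((apply_covBy_apply_iff φ).2 hxe) (fun h => hne (φ.injective h)) hle
      ((apply_covBy_apply_iff φ).2 hab) ((apply_covBy_apply_iff φ).2 hab') (φ.monotone heb) hlt
    refine ⟨φ.symm k, ?_, ?_, ?_⟩
    · rw [← apply_covBy_apply_iff φ]; simpa
    · rw [← φ.le_iff_le]; simpa
    · rcases h5 with rfl | h5
      · left; simp
      · right; simpa

lemma HasAtomRanking.of_subsingleton [Subsingleton P] : HasAtomRanking P :=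
  ⟨fun _ _ => 0, ⟨fun h => absurd (Subsingleton.elim _ _) h.ne,
    fun h => absurd (Subsingleton.elim _ _) h.ne⟩⟩

/-- A cover in the product changes one coordinate. All covers in the first coordinate are ranked
before all covers in the second; steps in different coordinates commute, so only steps in the same
coordinate need the given rankings. -/
lemma HasAtomRanking.prod {Q : Type*} [PartialOrder Q] [Finite P]
    (hP : HasAtomRanking P) (hQ : HasAtomRanking Q) : HasAtomRanking (P × Q) := by
  classical
  obtain ⟨ρ, hρ⟩ := hP
  obtain ⟨σ, hσ⟩ := hQ
  obtain ⟨N, hN⟩ : ∃ N, ∀ a b, ρ a b < N := by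
    obtain ⟨M, hM⟩ := (Set.finite_range fun q : P × P => ρ q.1 q.2).bddAbove
    exact ⟨M + 1, fun a F => Nat.lt_succ_of_le (hM ⟨(a, F), rfl⟩)⟩
  set τ : P × Q → P × Q → ℕ := fun x y =>
    if x.1 = y.1 then N + σ x.2 y.2 else ρ x.1 y.1 with hτ
  have τl : ∀ p q a, p ⋖ a → τ (p, q) (a, q) = ρ p a := fun p q a h => by simp [hτ, h.ne]
  have τr : ∀ p q a, τ (p, q) (p, a) = N + σ q a := fun p q a => by simp [hτ]
  have hcov : ∀ x a : P × Q, x ⋖ a → (∃ a1, x.1 ⋖ a1 ∧ a = (a1, x.2)) ∨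
      ∃ a2, x.2 ⋖ a2 ∧ a = (x.1, a2) := by
    rintro ⟨p, q⟩ ⟨a1, a2⟩ h
    rcases Prod.mk_covBy_mk_iff.1 h with ⟨h', rfl⟩ | ⟨h', rfl⟩
    · exact Or.inl ⟨a1, h', rfl⟩
    · exact Or.inr ⟨a2, h', rfl⟩
  refine ⟨τ, ⟨?_, ?_⟩⟩
  · rintro ⟨p, q⟩ a e ⟨y1, y2⟩ hxa hxe hne hle hay hey
    rcases hcov _ _ hxa with ⟨a1, ha, rfl⟩ | ⟨a2, ha, rfl⟩ <;>
      rcases hcov _ _ hxe with ⟨e1, he, rfl⟩ | ⟨e2, he, rfl⟩ <;> dsimp only at *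
    · rw [τl _ _ _ ha, τl _ _ _ he] at hle
      obtain ⟨z, h1, h2, k, h3, h4, h5⟩ := hρ.exchange ha he (fun h => hne (by rw [h])) hle
        hay.1 hey.1
      refine ⟨(z, q), Prod.mk_covBy_mk_iff.2 (Or.inl ⟨h1, rfl⟩), ⟨h2, hay.2⟩, (k, q),
        Prod.mk_covBy_mk_iff.2 (Or.inl ⟨h3, rfl⟩), ⟨h4, le_rfl⟩, ?_⟩
      rw [τl _ _ _ ha, τl _ _ _ h3]
      exact h5.imp_left fun h => by rw [h]
    · rw [τl _ _ _ ha, τr] at hle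
      have := hN p a1
      omega
    · exact ⟨(e1, a2), Prod.mk_covBy_mk_iff.2 (Or.inl ⟨he, rfl⟩), ⟨hey.1, hay.2⟩, (e1, q), hxe,
        ⟨le_rfl, ha.le⟩, Or.inl rfl⟩
    · rw [τr, τr] at hle
      obtain ⟨z, h1, h2, k, h3, h4, h5⟩ := hσ.exchange ha he (fun h => hne (by rw [h]))
        (by omega) hay.2 hey.2
      refine ⟨(p, z), Prod.mk_covBy_mk_iff.2 (Or.inr ⟨h1, rfl⟩), ⟨hay.1, h2⟩, (p, k),
        Prod.mk_covBy_mk_iff.2 (Or.inr ⟨h3, rfl⟩), ⟨le_rfl, h4⟩, ?_⟩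
      rw [τr, τr]
      exact h5.imp (fun h => by rw [h]) fun h => by omega
  · rintro ⟨p, q⟩ a e b b' hxa hxe hne hle hab hab' heb hlt
    rcases hcov _ _ hxa with ⟨a1, ha, rfl⟩ | ⟨a2, ha, rfl⟩ <;>
      rcases hcov _ _ hxe with ⟨e1, he, rfl⟩ | ⟨e2, he, rfl⟩ <;>
      rcases hcov _ _ hab with ⟨b1, hb, rfl⟩ | ⟨b2, hb, rfl⟩ <;>
      rcases hcov _ _ hab' with ⟨c1, hc, rfl⟩ | ⟨c2, hc, rfl⟩ <;> dsimp only at *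
    case inl.inl.inl.inl =>
      rw [τl _ _ _ ha, τl _ _ _ he] at hle
      rw [τl _ _ _ hb, τl _ _ _ hc] at hlt
      obtain ⟨k, h3, h4, h5⟩ := hρ.compat ha he (fun h => hne (by rw [h])) hle hb hc heb.1 hlt
      refine ⟨(k, q), Prod.mk_covBy_mk_iff.2 (Or.inl ⟨h3, rfl⟩), ⟨h4, le_rfl⟩, ?_⟩
      rw [τl _ _ _ ha, τl _ _ _ h3]
      exact h5.imp_left fun h => by rw [h]
    case inl.inl.inl.inr =>
      exact absurd ((ha.eq_or_eq he.le heb.1).resolve_left he.ne') fun h => hne (by rw [h])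
    case inl.inl.inr.inl =>
      rw [τl _ _ _ hc, τr] at hlt
      have := hN a1 c1
      omega
    case inl.inl.inr.inr =>
      exact absurd ((ha.eq_or_eq he.le heb.1).resolve_left he.ne') fun h => hne (by rw [h])
    case inr.inl.inr.inl =>
      rw [τl _ _ _ hc, τr] at hlt
      have := hN p c1
      omega
    case inr.inl.inr.inr =>
      exact absurd heb.1 he.lt.not_ge
    case inr.inr.inr.inl =>
      exact absurd ((ha.eq_or_eq he.le heb.2).resolve_left he.ne') fun h => hne (by rw [h])
    case inr.inr.inr.inr =>
      rw [τr, τr] at hle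
      rw [τr, τr] at hlt
      obtain ⟨k, h3, h4, h5⟩ := hσ.compat ha he (fun h => hne (by rw [h])) (by omega) hb hc heb.2
        (by omega)
      refine ⟨(p, k), Prod.mk_covBy_mk_iff.2 (Or.inr ⟨h3, rfl⟩), ⟨le_rfl, h4⟩, ?_⟩
      rw [τr, τr]
      exact h5.imp (fun h => by rw [h]) fun h => by omega
    -- Either the ranks of `a` and `e` contradict the priority of the first coordinate, or `a` moves
    -- the second coordinate and `b` the first. In the latter case the step of `b`, taken from the
    -- bottom, is an earlier cover below `b`.
    all_goals
      first
      | (rw [τl _ _ _ ha, τr] at hle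
         have := hN p a1
         omega)
      | (refine ⟨(b1, q), Prod.mk_covBy_mk_iff.2 (Or.inl ⟨hb, rfl⟩), ⟨le_rfl, ha.le⟩, Or.inr ?_⟩
         rw [τl _ _ _ hb, τr]
         have := hN p b1
         omega)

/-- An open interval whose order complex has two components of positive dimension obstructs
shellability. -/
theorem not_posetShellable [Finite P] {x y : P} (Q : P → Prop)
    (hQ : ∀ u v, x < u → u < v → v < y → (Q u ↔ Q v))
    (h1 : ∃ u v, x < u ∧ u < v ∧ v < y ∧ Q u) (h2 : ∃ u v, x < u ∧ u < v ∧ v < y ∧ ¬ Q u) :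
    ¬ PosetShellable P := by
  classical
  have := Fintype.ofFinite P
  rintro ⟨t, F, hF⟩
  have hfac : ∀ k, Maximal (· ∈ (orderComplex P).faces) (F k) := fun k => by
    have : F k ∈ Set.range F := ⟨k, rfl⟩
    rwa [hF.range_eq] at this
  have hext : ∀ s : Finset P, s.Nonempty → IsChain (· ≤ ·) (s : Set P) → ∃ k, s ⊆ F k := by
    intro s hs hc
    obtain ⟨G, h1, h2⟩ := Finite.exists_le_maximal (p := (· ∈ (orderComplex P).faces))
      (show s ∈ (orderComplex P).faces from ⟨hs, hc⟩)
    have : G ∈ Set.range F := by rw [hF.range_eq]; exact h2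
    obtain ⟨k, rfl⟩ := this
    exact ⟨k, h1⟩
  obtain ⟨u, v, hxu, huv, hvy, hQu⟩ := h1
  obtain ⟨u', v', hxu', huv', hvy', hQu'⟩ := h2
  obtain ⟨k₁, hk₁⟩ := hext {x, u, v, y} ⟨x, by simp⟩ (by
    simp only [Finset.coe_insert, Finset.coe_singleton]
    intro a ha b hb _
    simp only [Set.mem_insert_iff, Set.mem_singleton_iff] at ha hb
    have := hxu.trans huv; have := this.trans hvy; have := huv.trans hvy
    rcases ha with rfl | rfl | rfl | rfl <;> rcases hb with rfl | rfl | rfl | rfl <;>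
      first
      | exact Or.inl le_rfl
      | exact Or.inl (le_of_lt (by assumption))
      | exact Or.inr (le_of_lt (by assumption)))
  -- The part of a facet outside the open interval. Facets that contain `c` differ only inside the
  -- interval, so shelling steps between them can be followed there.
  set c := (F k₁).filter (fun t => t ≤ x ∨ y ≤ t) with hc
  have hxy : x < y := (hxu.trans huv).trans hvy
  have hxc : x ∈ c := by simp [hc, hk₁ (show x ∈ _ by simp)]
  have hyc : y ∈ c := by simp [hc, hk₁ (show y ∈ _ by simp)]
  have hbetween : ∀ k, c ⊆ F k → ∀ q ∈ F k, q ∉ c → x < q ∧ q < y := by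
    intro k hk q hq hqc
    have hch := (hfac k).prop.2
    have key : (q ≤ x ∨ y ≤ q) → q ∈ c := by
      intro h
      have hmem : q ∈ F k₁ := by
        have h3 : insert q (F k₁) ≤ F k₁ := (hfac k₁).le_of_ge ⟨by simp, ?_⟩ (Finset.subset_insert _ _)
        · exact h3 (Finset.mem_insert_self _ _)
        · rw [Finset.coe_insert]
          refine (hfac k₁).prop.2.insert fun b hb _ => ?_
          by_cases hbc : b ∈ c
          · exact hch.total hq (hk hbc)
          · have hbx : ¬ (b ≤ x ∨ y ≤ b) := fun h => hbc (by simp only [hc, Finset.mem_filter]; exact ⟨hb, h⟩)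
            push Not at hbx
            have hb1 : x ≤ b := ((hfac k₁).prop.2.total hb (hk₁ (show x ∈ _ by simp))).resolve_left hbx.1
            have hb2 : b ≤ y := ((hfac k₁).prop.2.total (hk₁ (show y ∈ _ by simp)) hb).resolve_left hbx.2
            rcases h with h | h
            · exact Or.inl (h.trans hb1)
            · exact Or.inr (hb2.trans h)
      simp only [hc, Finset.mem_filter]
      exact ⟨hmem, h⟩
    constructor
    · rcases hch.total hq (hk hxc) with h | h
      · exact absurd (key (Or.inl h)) hqc
      · exact lt_of_le_of_ne h fun h' => hqc (h' ▸ hxc)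
    · rcases hch.total hq (hk hyc) with h | h
      · exact lt_of_le_of_ne h fun h' => hqc (h' ▸ hyc)
      · exact absurd (key (Or.inr h)) hqc
  have hnotc : ∀ q, x < q → q < y → q ∉ c := by
    intro q h1 h2 hqc
    rcases (Finset.mem_filter.1 hqc).2 with h | h
    · exact h.not_gt h1
    · exact h.not_gt h2
  have hck₁ : c ⊆ F k₁ := Finset.filter_subset _ _
  obtain ⟨k₂, hk₂⟩ := hext (insert u' (insert v' c)) ⟨u', by simp⟩ (by
    rw [Finset.coe_insert, Finset.coe_insert]
    refine (((hfac k₁).prop.2.mono (by simpa using hck₁)).insert fun b hb _ => ?_).insert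
      fun b hb _ => ?_
    · rcases (Finset.mem_filter.1 (Finset.mem_coe.1 hb)).2 with h | h
      · exact Or.inr (by order)
      · exact Or.inl (by order)
    · rcases hb with rfl | hb
      · exact Or.inl huv'.le
      · rcases (Finset.mem_filter.1 (Finset.mem_coe.1 hb)).2 with h | h
        · exact Or.inr (by order)
        · exact Or.inl (by order))
  have hck₂ : c ⊆ F k₂ := fun q hq => hk₂ (by simp [hq])
  -- the facets that contain `c` and have two interior points in the class `R`
  have hdesc : ∀ R : P → Prop, (∀ u v, x < u → u < v → v < y → (R u ↔ R v)) →
      ∀ k, c ⊆ F k → (∃ u ∈ F k, ∃ v ∈ F k, x < u ∧ u < v ∧ v < y ∧ R u) →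
      ∀ i < k, c ⊆ F i →
      ∃ j < k, c ⊆ F j ∧ ∃ u ∈ F j, ∃ v ∈ F j, x < u ∧ u < v ∧ v < y ∧ R u := by
    rintro R hR k hck ⟨u, hu, v, hv, hxu, huv, hvy, hRu⟩ i hik hci
    -- By purity `s` loses only one element of `F k`, so one of the two points of the class `R`
    -- survives. An earlier facet `F j` contains `s` and has an element outside `F k`; it lies in
    -- the open interval and is comparable to the surviving point, hence belongs to `R` as well.
    obtain ⟨s, hs1, hs2⟩ := Finite.exists_le_maximal
      (p := fun s : Finset P => s ⊆ F k ∧ ∃ i < k, s ⊆ F i) (a := F i ∩ F k)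
      ⟨Finset.inter_subset_right, i, hik, Finset.inter_subset_left⟩
    have hcard := hF.pure k (by have : (i : ℕ) < k := hik; omega) s hs2
    obtain ⟨hsk, j, hjk, hsj⟩ := hs2.prop
    have hcs : c ⊆ s := (Finset.subset_inter hci hck).trans hs1
    obtain ⟨w, hws, hxw, hwy, hRw⟩ : ∃ w ∈ s, x < w ∧ w < y ∧ R w := by
      by_cases hus : u ∈ s
      · exact ⟨u, hus, hxu, huv.trans hvy, hRu⟩
      · by_cases hvs : v ∈ s
        · exact ⟨v, hvs, hxu.trans huv, hvy, (hR u v hxu huv hvy).1 hRu⟩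
        · exfalso
          have h4 : s ⊆ ((F k).erase u).erase v := fun q hq => Finset.mem_erase.2
            ⟨fun h => hvs (h ▸ hq), Finset.mem_erase.2 ⟨fun h => hus (h ▸ hq), hsk hq⟩⟩
          have h5 := Finset.card_le_card h4
          rw [Finset.card_erase_of_mem (Finset.mem_erase.2 ⟨huv.ne', hv⟩),
            Finset.card_erase_of_mem hu] at h5
          have h6 : 1 < (F k).card := Finset.one_lt_card.2 ⟨u, hu, v, hv, huv.ne⟩
          omega
    refine ⟨j, hjk, hcs.trans hsj, ?_⟩
    obtain ⟨w', hw'j, hw'k⟩ : ∃ w' ∈ F j, w' ∉ F k := by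
      by_contra hcon
      push Not at hcon
      have h4 : F j = F k := Finset.Subset.antisymm hcon ((hfac j).le_of_ge (hfac k).prop hcon)
      exact hjk.ne (hF.injective h4)
    obtain ⟨h7, h8⟩ := hbetween j (hcs.trans hsj) w' hw'j fun h => hw'k (hck h)
    have hne : w ≠ w' := fun h => hw'k (h ▸ hsk hws)
    rcases (hfac j).prop.2.total (hsj hws) hw'j with h | h
    · exact ⟨w, hsj hws, w', hw'j, hxw, lt_of_le_of_ne h hne, h8, hRw⟩
    · exact ⟨w', hw'j, w, hsj hws, h7, lt_of_le_of_ne h hne.symm, hwy,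
        (hR w' w h7 (lt_of_le_of_ne h hne.symm) hwy).2 hRw⟩
  -- Descending from a facet of either class leads to the earliest facet containing `c`. Its chain
  -- would then meet both classes, although comparable interior points are in the same class.
  obtain ⟨k₀, hk₀⟩ := Finite.exists_le_minimal (p := fun k => c ⊆ F k) hck₁
  have hreach : ∀ R : P → Prop, (∀ u v, x < u → u < v → v < y → (R u ↔ R v)) →
      ∀ k, c ⊆ F k → (∃ u ∈ F k, ∃ v ∈ F k, x < u ∧ u < v ∧ v < y ∧ R u) →
      ∃ u ∈ F k₀, ∃ v ∈ F k₀, x < u ∧ u < v ∧ v < y ∧ R u := by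
    intro R hR k
    induction k using WellFoundedLT.induction with
    | ind k ih =>
    intro hck hk
    by_cases hkk : k = k₀
    · exact hkk ▸ hk
    · have hlt : k₀ < k := by
        rcases lt_trichotomy k₀ k with h | h | h
        · exact h
        · exact absurd h.symm hkk
        · exact absurd (hk₀.2.2 hck h.le) h.not_ge
      obtain ⟨j, hj, hcj, hj'⟩ := hdesc R hR k hck hk k₀ hlt hk₀.2.prop
      exact ih j hj hcj hj'
  obtain ⟨a, ha, b, -, hxa, hab, hby, hQa⟩ := hreach Q hQ k₁ hck₁
    ⟨u, hk₁ (by simp), v, hk₁ (by simp), hxu, huv, hvy, hQu⟩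
  obtain ⟨a', ha', b', -, hxa', hab', hby', hQa'⟩ := hreach (fun q => ¬ Q q)
    (fun u v h1 h2 h3 => not_congr (hQ u v h1 h2 h3)) k₂ hck₂
    ⟨u', hk₂ (by simp), v', hk₂ (by simp), hxu', huv', hvy', hQu'⟩
  rcases (hfac k₀).prop.2.total ha ha' with h | h
  · rcases h.lt_or_eq with h | rfl
    · exact hQa' ((hQ a a' hxa h (hab'.trans hby')).1 hQa)
    · exact hQa' hQa
  · rcases h.lt_or_eq with h | rfl
    · exact hQa' ((hQ a' a hxa' h (hab.trans hby)).2 hQa)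
    · exact hQa' hQa

end Shelling

/-! ### Even sets -/

section EvenSets

variable {X : Type*} {adj : X → X → Prop} {A S S' C D x y : Finset X} {p q r : X}

/-- `C` is a union of connected components of `S`. -/
def ClosedIn (adj : X → X → Prop) (S C : Finset X) : Prop :=
  C ⊆ S ∧ ∀ p ∈ C, ∀ q ∈ S, adj p q → q ∈ C

open Classical in
/-- The component of `S` that contains `p`. -/
noncomputable def compIn (adj : X → X → Prop) (S : Finset X) (p : X) : Finset X :=
  S.filter fun q => ∀ C, ClosedIn adj S C → p ∈ C → q ∈ C

/-- The elements `p` and `q` are joined by an edge or through a component of `x`. -/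
def LinkedOver [DecidableEq X] (adj : X → X → Prop) (x : Finset X) (p q : X) : Prop :=
  ∃ z ∈ compIn adj (insert p x) p, adj z q

/-- Every component of `S` contains an even number of elements of `A`. -/
def EvenOn [DecidableEq X] (adj : X → X → Prop) (A S : Finset X) : Prop :=
  ∀ C, ClosedIn adj S C → Even (C ∩ A).card

lemma ClosedIn.mem (h : ClosedIn adj S C) (hp : p ∈ C) (hq : q ∈ S) (hpq : adj p q) : q ∈ C :=
  h.2 p hp q hq hpq

lemma compIn_subset : compIn adj S p ⊆ S := by
  simp [compIn]

lemma mem_compIn_self (hp : p ∈ S) : p ∈ compIn adj S p := by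
  simp only [compIn, Finset.mem_filter]
  exact ⟨hp, fun _ _ h => h⟩

lemma compIn_subset_of_closedIn (h : ClosedIn adj S C) (hp : p ∈ C) : compIn adj S p ⊆ C := by
  intro q hq
  simp only [compIn, Finset.mem_filter] at hq
  exact hq.2 C h hp

lemma closedIn_compIn : ClosedIn adj S (compIn adj S p) := by
  refine ⟨compIn_subset, fun a ha b hb hab => ?_⟩
  simp only [compIn, Finset.mem_filter] at ha ⊢
  exact ⟨hb, fun C hC hp => hC.mem (ha.2 C hC hp) hb hab⟩

variable [DecidableEq X]

lemma ClosedIn.inter (h : ClosedIn adj S C) (hS : S' ⊆ S) : ClosedIn adj S' (C ∩ S') :=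
  ⟨Finset.inter_subset_right, fun _ hp _ hq hpq => Finset.mem_inter.2
    ⟨h.mem (Finset.mem_inter.1 hp).1 (hS hq) hpq, hq⟩⟩

lemma ClosedIn.sdiff (hs : ∀ p q, adj p q → adj q p) (h : ClosedIn adj S C) :
    ClosedIn adj S (S \ C) := by
  refine ⟨Finset.sdiff_subset, fun p hp q hq hpq => ?_⟩
  obtain ⟨hpS, hpC⟩ := Finset.mem_sdiff.1 hp
  exact Finset.mem_sdiff.2 ⟨hq, fun hqC => hpC (h.mem hqC hpS (hs _ _ hpq))⟩

lemma card_inter_eq_add (A C x : Finset X) :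
    (C ∩ A).card = ((C ∩ x) ∩ A).card + ((C \ x) ∩ A).card := by
  rw [← Finset.card_union_of_disjoint]
  · congr 1
    ext q
    simp only [Finset.mem_inter, Finset.mem_union, Finset.mem_sdiff]
    tauto
  · rw [Finset.disjoint_left]
    intro q
    simp only [Finset.mem_inter, Finset.mem_sdiff]
    tauto

lemma EvenOn.even_card (h : EvenOn adj A S) : Even (S ∩ A).card :=
  h S ⟨subset_rfl, fun _ _ _ hq _ => hq⟩

lemma EvenOn.closed (h : EvenOn adj A S) (hC : ClosedIn adj S C) : EvenOn adj A C := by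
  intro D hD
  exact h D ⟨hD.1.trans hC.1, fun p hp q hq hpq => hD.mem hp (hC.mem (hD.1 hp) hq hpq) hpq⟩

/-- Parity of the elements added between two even sets. -/
lemma EvenOn.even_sdiff (hx : EvenOn adj A x) (hy : EvenOn adj A y) (hxy : x ⊆ y) :
    Even ((y \ x) ∩ A).card := by
  have h1 := card_inter_eq_add A y x
  rw [Finset.inter_eq_right.2 hxy] at h1
  have h2 := hx.even_card
  have h3 := hy.even_card
  rw [h1] at h3
  exact (Nat.even_add.1 h3).1 h2

/-- Even sets stay even if a connected set of even weight is added. -/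
lemma EvenOn.union (hs : ∀ p q, adj p q → adj q p) (hx : EvenOn adj A x) (hD : Disjoint x D)
    (hev : Even (D ∩ A).card) (hr : r ∈ D)
    (hconn : ∀ C, ClosedIn adj (x ∪ D) C → r ∈ C → D ⊆ C) : EvenOn adj A (x ∪ D) := by
  intro C hC
  rw [card_inter_eq_add A C x]
  have h1 : Even ((C ∩ x) ∩ A).card := hx _ (hC.inter Finset.subset_union_left)
  refine h1.add ?_
  by_cases hrC : r ∈ C
  · have : C \ x = D := by
      ext q
      have := hconn C hC hrC
      have h3 : q ∈ C → q ∈ x ∪ D := fun h => hC.1 h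
      simp only [Finset.mem_union] at h3
      simp only [Finset.mem_sdiff]
      have := @this q
      have : q ∈ x → q ∉ D := fun h => Finset.disjoint_left.1 hD h
      tauto
    rw [this]; exact hev
  · have h2 := hconn _ (hC.sdiff hs) (Finset.mem_sdiff.2 ⟨Finset.mem_union_right _ hr, hrC⟩)
    have : C \ x = ∅ := by
      ext q
      have h3 : q ∈ C → q ∈ x ∪ D := fun h => hC.1 h
      have h4 := @h2 q
      simp only [Finset.mem_union, Finset.mem_sdiff] at h3 h4
      simp only [Finset.mem_sdiff, Finset.notMem_empty, iff_false]
      tauto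
    rw [this]; simp

/-- A set of odd weight is not a union of components of an even set. This is how the evenness of a
larger set is exploited to find something to add. -/
lemma EvenOn.exists_adj (hy : EvenOn adj A y) (hC : C ⊆ y) (hodd : ¬ Even (C ∩ A).card) :
    ∃ p ∈ C, ∃ q ∈ y, q ∉ C ∧ adj p q := by
  by_contra h
  push Not at h
  exact hodd (hy C ⟨hC, fun p hp q hq hpq => by_contra fun hqC => h p hp q hq hqC hpq⟩)

/-- A set with odd weight outside `x` that respects the components of `x` can be left within `y`. -/
lemma EvenOn.exists_adj_of_odd (hx : EvenOn adj A x) (hy : EvenOn adj A y) (hC : C ⊆ y)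
    (hCx : ClosedIn adj x (C ∩ x)) (hodd : Odd ((C \ x) ∩ A).card) :
    ∃ p ∈ C, ∃ q ∈ y, q ∉ C ∧ adj p q := by
  refine hy.exists_adj hC ?_
  rw [card_inter_eq_add A C x, Nat.not_even_iff_odd]
  exact (hx _ hCx).add_odd hodd

lemma LinkedOver.mem (h : LinkedOver adj x p q) (hC : ClosedIn adj S C) (hxS : insert p x ⊆ S)
    (hqS : q ∈ S) (hp : p ∈ C) : q ∈ C := by
  obtain ⟨z, hz, hzq⟩ := h
  have h1 := compIn_subset_of_closedIn (hC.inter hxS)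
    (Finset.mem_inter.2 ⟨hp, Finset.mem_insert_self _ _⟩) hz
  exact hC.mem (Finset.mem_inter.1 h1).1 hqS hzq

lemma compIn_mono (h : S ⊆ S') (hp : p ∈ S) : compIn adj S p ⊆ compIn adj S' p :=
  (compIn_subset_of_closedIn (closedIn_compIn.inter h)
    (Finset.mem_inter.2 ⟨mem_compIn_self (h hp), hp⟩)).trans Finset.inter_subset_left

lemma LinkedOver.mono (h : LinkedOver adj x p q) (hxy : x ⊆ y) : LinkedOver adj y p q := by
  obtain ⟨z, hz, hzq⟩ := h
  exact ⟨z, compIn_mono (Finset.insert_subset_insert p hxy) (Finset.mem_insert_self _ _) hz, hzq⟩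

/-- Otherwise the component of `p` over `x` would remain closed after adding `q`, and it does not
contain `q`. -/
lemma linkedOver_of_forall_closedIn (hq : q ∉ insert p x)
    (h : ∀ C, ClosedIn adj (insert q (insert p x)) C → p ∈ C → q ∈ C) : LinkedOver adj x p q := by
  by_contra hl
  refine hq (compIn_subset (h (compIn adj (insert p x) p) ⟨?_, ?_⟩
    (mem_compIn_self (Finset.mem_insert_self _ _))))
  · exact compIn_subset.trans (Finset.subset_insert _ _)
  · intro a ha b hb hab
    rcases Finset.mem_insert.1 hb with rfl | hb
    · exact absurd ⟨a, ha, hab⟩ hl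
    · exact closedIn_compIn.mem ha hb hab

lemma linkedOver_of_adj (h : adj p q) : LinkedOver adj x p q :=
  ⟨p, mem_compIn_self (Finset.mem_insert_self _ _), h⟩

end EvenSets

/-! ### Even sets of a graph with one bundle -/

section OneBundle

variable {X : Type*}

/-- The set `S` contains the ends of its bundle edges, and an edge of the bundle if it contains both
ends. -/
def LegalOn (B : Finset X) (u v : X) (S : Finset X) : Prop :=
  (∀ b ∈ S, b ∈ B → u ∈ S ∧ v ∈ S) ∧ (u ∈ S → v ∈ S → ∃ b ∈ S, b ∈ B)

lemma legalOn_of_mem {B S : Finset X} {u v p : X} (hu : u ∈ S) (hv : v ∈ S) (hp : p ∈ S)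
    (hpB : p ∈ B) : LegalOn B u v S :=
  ⟨fun _ _ _ => ⟨hu, hv⟩, fun _ _ => ⟨p, hp, hpB⟩⟩

lemma LegalOn.notMem {B S : Finset X} {u v p : X} (h : LegalOn B u v S) (hpB : p ∈ B)
    (huv : u ∉ S ∨ v ∉ S) : p ∉ S := fun hp => by
  rcases huv with hu | hv
  · exact hu (h.1 p hp hpB).1
  · exact hv (h.1 p hp hpB).2

variable [DecidableEq X]

/-- The legal even subsets of `T`. -/
structure IsEvenLegal (adj : X → X → Prop) (A T B : Finset X) (u v : X) (S : Finset X) : Prop where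
  subset : S ⊆ T
  legal : LegalOn B u v S
  even : EvenOn adj A S

/-- A system with the single bundle `B` between `u` and `v` in which everything else has odd weight
and `u`, `v` have at most one neighbour over every even set that avoids them. -/
structure BundleSystem (adj : X → X → Prop) (A T B : Finset X) (u v : X) : Prop where
  symm : ∀ p q, adj p q → adj q p
  ne : u ∈ T → u ≠ v
  left_notMem : u ∉ B
  right_notMem : v ∉ B
  adj_left : ∀ b ∈ B, adj b u
  adj_right : ∀ b ∈ B, adj b v
  eq_or_eq : ∀ b ∈ B, ∀ q, adj b q → q = u ∨ q = v
  weight : ∀ p ∈ T, p ≠ u → p ≠ v → p ∉ B → p ∈ A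
  unique : ∀ x, IsEvenLegal adj A T B u v x → u ∉ x → v ∉ x → ∀ r r' c c',
    r = u ∨ r = v → r' = u ∨ r' = v → r ∈ T → r' ∈ T → c ∈ T → c' ∈ T → c ∉ x → c' ∉ x →
    c ≠ u → c ≠ v → c ∉ B → c' ≠ u → c' ≠ v → c' ∉ B →
    LinkedOver adj x r c → LinkedOver adj x r' c' → c = c'

variable {adj : X → X → Prop} {A T B x y a D : Finset X} {u v p q : X}

/-- A minimal set that can be added to `x`. -/
structure IsStep (adj : X → X → Prop) (A B : Finset X) (u v : X) (x D : Finset X) : Prop where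
  nonempty : D.Nonempty
  disjoint : Disjoint x D
  conn : ∀ p ∈ D, ∀ q ∈ D, ∀ C, ClosedIn adj (x ∪ D) C → p ∈ C → q ∈ C
  even : Even (D ∩ A).card
  legal : LegalOn B u v (x ∪ D)
  eq_of_subset : ∀ K ⊆ D, K.Nonempty → Even (K ∩ A).card → LegalOn B u v (x ∪ K) → K = D

/-- The minimal sets with `u` or `v` that can be added to `x`. -/
inductive SpecialStep (adj : X → X → Prop) (A B : Finset X) (u v : X) (x : Finset X) :
    Finset X → Prop
  | light (r s : X) (hrs : r = u ∧ s = v ∨ r = v ∧ s = u) (hr : r ∉ x) (hs : s ∉ x) (hrA : r ∉ A) :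
      SpecialStep adj A B u v x {r}
  | pair (r s c : X) (hrs : r = u ∧ s = v ∨ r = v ∧ s = u) (hr : r ∉ x) (hs : s ∉ x) (hrA : r ∈ A)
      (hc : c ∉ x) (hcA : c ∈ A) (hcu : c ≠ u) (hcv : c ≠ v) (hcB : c ∉ B)
      (hl : LinkedOver adj x r c) : SpecialStep adj A B u v x {r, c}
  | bothFree (f : X) (hu : u ∉ x) (hv : v ∉ x) (huA : u ∈ A) (hvA : v ∈ A) (hf : f ∈ B)
      (hfA : f ∉ A) : SpecialStep adj A B u v x {u, v, f}
  | bothEdges (e e' : X) (hu : u ∉ x) (hv : v ∉ x) (huA : u ∈ A) (hvA : v ∈ A) (he : e ∈ B)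
      (heA : e ∈ A) (he' : e' ∈ B) (heA' : e' ∈ A) (hne : e ≠ e') :
      SpecialStep adj A B u v x {u, v, e, e'}
  | edge (r s e : X) (hrs : r = u ∧ s = v ∨ r = v ∧ s = u) (hr : r ∉ x) (hs : s ∈ x) (hrA : r ∈ A)
      (he : e ∈ B) (heA : e ∈ A) : SpecialStep adj A B u v x {r, e}
  | vertexFree (r s c f : X) (hrs : r = u ∧ s = v ∨ r = v ∧ s = u) (hr : r ∉ x) (hs : s ∈ x)
      (hrA : r ∈ A) (hc : c ∉ x) (hcA : c ∈ A) (hcu : c ≠ u) (hcv : c ≠ v) (hcB : c ∉ B)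
      (hl : LinkedOver adj x r c ∨ LinkedOver adj x s c) (hf : f ∈ B) (hfA : f ∉ A) :
      SpecialStep adj A B u v x {r, c, f}
  | free (r s f : X) (hrs : r = u ∧ s = v ∨ r = v ∧ s = u) (hr : r ∉ x) (hs : s ∈ x) (hrA : r ∉ A)
      (hf : f ∈ B) (hfA : f ∉ A) : SpecialStep adj A B u v x {r, f}
  | edges (r s e e' : X) (hrs : r = u ∧ s = v ∨ r = v ∧ s = u) (hr : r ∉ x) (hs : s ∈ x)
      (hrA : r ∉ A) (he : e ∈ B) (heA : e ∈ A) (he' : e' ∈ B) (heA' : e' ∈ A) (hne : e ≠ e') :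
      SpecialStep adj A B u v x {r, e, e'}
  | vertexEdge (r s c e : X) (hrs : r = u ∧ s = v ∨ r = v ∧ s = u) (hr : r ∉ x) (hs : s ∈ x)
      (hrA : r ∉ A) (hc : c ∉ x) (hcA : c ∈ A) (hcu : c ≠ u) (hcv : c ≠ v) (hcB : c ∉ B)
      (hl : LinkedOver adj x r c ∨ LinkedOver adj x s c) (he : e ∈ B) (heA : e ∈ A) :
      SpecialStep adj A B u v x {r, c, e}

lemma card_inter_eq_sum {K : Finset X} (hK : K ⊆ D) :
    (K ∩ A).card = ∑ p ∈ D, if p ∈ K ∧ p ∈ A then 1 else 0 := by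
  rw [← Finset.card_filter]
  congr 1
  ext q
  simp only [Finset.mem_inter, Finset.mem_filter]
  have := @hK q
  tauto

/-- Connectedness need only be tested from one root, since complements of unions of components are
again unions of components. -/
lemma IsStep.of_root (hs : ∀ p q, adj p q → adj q p) {r : X} (hr : r ∈ D) (hdisj : Disjoint x D)
    (hconn : ∀ C, ClosedIn adj (x ∪ D) C → r ∈ C → D ⊆ C) (hev : Even (D ∩ A).card)
    (hleg : LegalOn B u v (x ∪ D))
    (hmin : ∀ K ⊆ D, K.Nonempty → Even (K ∩ A).card → LegalOn B u v (x ∪ K) → D ⊆ K) :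
    IsStep adj A B u v x D where
  nonempty := ⟨r, hr⟩
  disjoint := hdisj
  conn p hp q hq C hC hpC := by
    by_cases hrC : r ∈ C
    · exact hconn C hC hrC hq
    · have := hconn _ (hC.sdiff hs) (Finset.mem_sdiff.2 ⟨Finset.mem_union_right _ hr, hrC⟩) hp
      exact absurd hpC (Finset.mem_sdiff.1 this).2
  even := hev
  legal := hleg
  eq_of_subset K hK h1 h2 h3 := Finset.Subset.antisymm hK (hmin K hK h1 h2 h3)

lemma IsStep.isEvenLegal (hS : BundleSystem adj A T B u v) (hx : IsEvenLegal adj A T B u v x)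
    (h : IsStep adj A B u v x D) (hD : D ⊆ T) : IsEvenLegal adj A T B u v (x ∪ D) := by
  obtain ⟨r, hr⟩ := h.nonempty
  exact ⟨Finset.union_subset hx.subset hD, h.legal, hx.even.union hS.symm h.disjoint h.even hr
    fun C hC hrC q hq => h.conn r hr q hq C hC hrC⟩

/-- Two nested even sets differ by a set of even weight, so legality and parity alone rule out
intermediate sets. This is why minimality in `IsStep` does not mention connectedness. -/
lemma IsStep.eq_of_le (hx : IsEvenLegal adj A T B u v x) (ha : IsEvenLegal adj A T B u v a)
    (h : IsStep adj A B u v x D) (hxa : x ⊂ a) (haD : a ⊆ x ∪ D) : a = x ∪ D := by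
  have hxK : x ∪ (a \ x) = a := Finset.union_sdiff_of_subset hxa.subset
  have h1 := h.eq_of_subset (a \ x) ?_ ?_ (hx.even.even_sdiff ha.even hxa.subset)
    (by rw [hxK]; exact ha.legal)
  · rw [← h1, hxK]
  · intro q hq
    obtain ⟨h1, h2⟩ := Finset.mem_sdiff.1 hq
    exact (Finset.mem_union.1 (haD h1)).resolve_left h2
  · exact Finset.sdiff_nonempty.2 hxa.2

lemma isStep_pair (hs : ∀ p q, adj p q → adj q p) (hp : p ∉ x) (hq : q ∉ x) (hpq : p ≠ q)
    (hpA : p ∈ A) (hqA : q ∈ A) (hl : LinkedOver adj x p q) (hleg : LegalOn B u v (x ∪ {p, q})) :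
    IsStep adj A B u v x {p, q} := by
  refine IsStep.of_root hs (r := p) (by simp) (by simp [hp, hq]) ?_ ?_ hleg ?_
  · intro C hC hpC
    have := hl.mem hC (by intro z; simp; tauto) (by simp) hpC
    intro z hz
    simp only [Finset.mem_insert, Finset.mem_singleton] at hz
    rcases hz with rfl | rfl <;> assumption
  · rw [card_inter_eq_sum subset_rfl]
    simp [Finset.sum_pair hpq, hpA, hqA]
  · intro K hK hne hev _
    rw [card_inter_eq_sum hK, Finset.sum_pair hpq] at hev
    obtain ⟨z, hz⟩ := hne
    have := hK hz
    simp only [Finset.mem_insert, Finset.mem_singleton] at this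
    by_cases h1 : p ∈ K <;> by_cases h2 : q ∈ K <;> simp_all [Finset.insert_subset_iff]
    rcases this with rfl | rfl <;> contradiction

lemma isStep_singleton (hs : ∀ p q, adj p q → adj q p) (hp : p ∉ x) (hpA : p ∉ A)
    (hleg : LegalOn B u v (x ∪ {p})) : IsStep adj A B u v x {p} := by
  refine IsStep.of_root hs (r := p) (by simp) (by simp [hp]) ?_ ?_ hleg ?_
  · intro C hC hpC
    simpa using hpC
  · simp [hpA]
  · intro K hK hne _ _
    rcases Finset.subset_singleton_iff.1 hK with rfl | rfl
    · simp at hne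
    · rfl

lemma legalOn_union_of_notMem (hx : LegalOn B u v x) (h1 : u ∉ x ∨ v ∉ x)
    (hD : ∀ p ∈ D, p ∉ B) (h2 : u ∉ x ∪ D ∨ v ∉ x ∪ D) : LegalOn B u v (x ∪ D) := by
  refine ⟨fun b hb hbB => ?_, fun hu hv => ?_⟩
  · rcases Finset.mem_union.1 hb with hb | hb
    · exact absurd hb (hx.notMem hbB h1)
    · exact absurd hbB (hD b hb)
  · rcases h2 with h2 | h2
    · exact absurd hu h2
    · exact absurd hv h2

lemma even_card_of_inter_eq_pair (h : D ∩ A = {p, q}) (hpq : p ≠ q) : Even (D ∩ A).card := by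
  rw [h, Finset.card_pair hpq]
  exact even_two

/-- As `p` and `q` are the only elements of odd weight in `D`, parity forbids taking just one of
them. -/
lemma mem_iff_of_even {K : Finset X} (hK : K ⊆ D) (h : D ∩ A = {p, q}) (hpq : p ≠ q)
    (hev : Even (K ∩ A).card) : p ∈ K ↔ q ∈ K := by
  have hp : p ∈ A := (Finset.mem_inter.1 (h ▸ Finset.mem_insert_self p _ : p ∈ D ∩ A)).2
  have hq : q ∈ A := (Finset.mem_inter.1 (h ▸ by simp : q ∈ D ∩ A)).2
  have hmem : ∀ z ∈ K ∩ A, z = p ∨ z = q := fun z hz => by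
    have : z ∈ D ∩ A := Finset.inter_subset_inter_right hK hz
    rw [h] at this
    simpa using this
  constructor
  · intro hpK
    by_contra hqK
    have : K ∩ A = {p} := by
      ext z
      refine ⟨fun hz => ?_, fun hz => ?_⟩
      · rcases hmem z hz with rfl | rfl
        · simp
        · exact absurd (Finset.mem_inter.1 hz).1 hqK
      · rw [Finset.mem_singleton.1 hz]; exact Finset.mem_inter.2 ⟨hpK, hp⟩
    rw [this] at hev
    simp at hev
  · intro hqK
    by_contra hpK
    have : K ∩ A = {q} := by
      ext z
      refine ⟨fun hz => ?_, fun hz => ?_⟩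
      · rcases hmem z hz with rfl | rfl
        · exact absurd (Finset.mem_inter.1 hz).1 hpK
        · simp
      · rw [Finset.mem_singleton.1 hz]; exact Finset.mem_inter.2 ⟨hqK, hq⟩
    rw [this] at hev
    simp at hev

/-- The new bundle edges of a legal extension force both ends, and conversely. -/
lemma LegalOn.union_facts {K : Finset X} (hx : LegalOn B u v x) (h1 : u ∉ x ∨ v ∉ x)
    (h : LegalOn B u v (x ∪ K)) :
    (∀ b ∈ K, b ∈ B → (u ∈ x ∨ u ∈ K) ∧ (v ∈ x ∨ v ∈ K)) ∧
      ((u ∈ x ∨ u ∈ K) → (v ∈ x ∨ v ∈ K) → ∃ b ∈ K, b ∈ B) := by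
  simp only [LegalOn, Finset.mem_union] at h
  refine ⟨fun b hb hbB => h.1 b (Or.inr hb) hbB, fun hu hv => ?_⟩
  obtain ⟨b, hb, hbB⟩ := h.2 hu hv
  exact ⟨b, hb.resolve_left (hx.notMem hbB h1), hbB⟩

lemma BundleSystem.closed_edge (hS : BundleSystem adj A T B u v) {C S : Finset X}
    (hC : ClosedIn adj S C) {b r s : X} (hbS : b ∈ S) (hbB : b ∈ B)
    (hrs : r = u ∧ s = v ∨ r = v ∧ s = u) (hrC : r ∈ C) (hsS : s ∈ S) : b ∈ C ∧ s ∈ C := by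
  have hb : b ∈ C := hC.mem hrC hbS (by
    rcases hrs with ⟨rfl, rfl⟩ | ⟨rfl, rfl⟩
    · exact hS.symm _ _ (hS.adj_left b hbB)
    · exact hS.symm _ _ (hS.adj_right b hbB))
  refine ⟨hb, hC.mem hb hsS ?_⟩
  rcases hrs with ⟨rfl, rfl⟩ | ⟨rfl, rfl⟩
  · exact hS.adj_right b hbB
  · exact hS.adj_left b hbB

/-- Adding the missing end `r` of the bundle together with a bundle edge and further elements. -/
lemma BundleSystem.isStep_of_missing (hS : BundleSystem adj A T B u v)
    (hx : IsEvenLegal adj A T B u v x) {r s b : X} (hrs : r = u ∧ s = v ∨ r = v ∧ s = u)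
    (hr : r ∉ x) (hs : s ∈ x) (hrD : r ∈ D) (hbD : b ∈ D) (hbB : b ∈ B) (hdisj : Disjoint x D)
    (hconn : ∀ C, ClosedIn adj (x ∪ D) C → r ∈ C → s ∈ C → D ⊆ C)
    (hev : Even (D ∩ A).card)
    (hmin : ∀ K ⊆ D, K.Nonempty → Even (K ∩ A).card → (∀ b ∈ K, b ∈ B → r ∈ K) →
      (r ∈ K → ∃ b ∈ K, b ∈ B) → D ⊆ K) :
    IsStep adj A B u v x D := by
  have h1 : u ∉ x ∨ v ∉ x := by rcases hrs with ⟨rfl, rfl⟩ | ⟨rfl, rfl⟩ <;> simp [hr]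
  refine IsStep.of_root hS.symm hrD hdisj ?_ hev ?_ ?_
  · intro C hC hrC
    exact hconn C hC hrC (hS.closed_edge hC (Finset.mem_union_right _ hbD) hbB hrs hrC
      (Finset.mem_union_left _ hs)).2
  · refine legalOn_of_mem ?_ ?_ (Finset.mem_union_right _ hbD) hbB <;>
      rcases hrs with ⟨rfl, rfl⟩ | ⟨rfl, rfl⟩ <;> simp [hs, hrD]
  · intro K hK hne hevK hleg
    obtain ⟨h2, h3⟩ := hx.legal.union_facts h1 hleg
    refine hmin K hK hne hevK (fun b hb hbB => ?_) fun hrK => ?_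
    · have := h2 b hb hbB
      rcases hrs with ⟨rfl, rfl⟩ | ⟨rfl, rfl⟩
      · exact this.1.resolve_left hr
      · exact this.2.resolve_left hr
    · rcases hrs with ⟨rfl, rfl⟩ | ⟨rfl, rfl⟩
      · exact h3 (Or.inr hrK) (Or.inl hs)
      · exact h3 (Or.inl hs) (Or.inr hrK)

-- Minimality comes from two constraints on a subset: its weight is even, and it contains a bundle
-- edge exactly when, together with `x`, it supplies both ends. In each case these force the whole
-- set, starting from any of its elements. Connectedness comes from the bundle edges, which are
-- adjacent to both ends, and from the prescribed link to `c`.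
set_option maxHeartbeats 1600000 in
lemma SpecialStep.isStep (hS : BundleSystem adj A T B u v) (hx : IsEvenLegal adj A T B u v x)
    (hD : D ⊆ T) (h : SpecialStep adj A B u v x D) : IsStep adj A B u v x D := by
  have huB := hS.left_notMem
  have hvB := hS.right_notMem
  have hxl := hx.legal
  have hrB : ∀ r s, (r = u ∧ s = v ∨ r = v ∧ s = u) → r ∉ B := by
    rintro r s (⟨rfl, rfl⟩ | ⟨rfl, rfl⟩) <;> assumption
  have hmiss : ∀ r s, (r = u ∧ s = v ∨ r = v ∧ s = u) → r ∉ x → u ∉ x ∨ v ∉ x := by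
    rintro r s (⟨rfl, rfl⟩ | ⟨rfl, rfl⟩) h <;> simp [h]
  have hrc : ∀ r s c, (r = u ∧ s = v ∨ r = v ∧ s = u) → c ≠ u → c ≠ v → r ≠ c := by
    rintro r s c (⟨rfl, rfl⟩ | ⟨rfl, rfl⟩) h h' rfl <;> contradiction
  have hne' : ∀ r s, (r = u ∧ s = v ∨ r = v ∧ s = u) → r ∈ T → s = r → False := by
    rintro r s (⟨rfl, rfl⟩ | ⟨rfl, rfl⟩) h rfl
    · exact hS.ne h rfl
    · exact hS.ne h rfl
  cases h with
  | light r s hrs hr hs hrA =>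
    have hrT : r ∈ T := hD (by simp)
    refine isStep_singleton hS.symm hr hrA (legalOn_union_of_notMem hxl (hmiss r s hrs hr) ?_ ?_)
    · simpa using hrB r s hrs
    · have := fun h => hne' r s hrs hrT h
      rcases hrs with ⟨rfl, rfl⟩ | ⟨rfl, rfl⟩ <;> simp [hs] <;> tauto
  | pair r s c hrs hr hs hrA hc hcA hcu hcv hcB hl =>
    have hrT : r ∈ T := hD (by simp)
    refine isStep_pair hS.symm hr hc (hrc r s c hrs hcu hcv) hrA hcA hl
      (legalOn_union_of_notMem hxl (hmiss r s hrs hr) ?_ ?_)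
    · simpa using ⟨hrB r s hrs, hcB⟩
    · have := fun h => hne' r s hrs hrT h
      rcases hrs with ⟨rfl, rfl⟩ | ⟨rfl, rfl⟩ <;> simp [hs, hcu.symm, hcv.symm] <;> tauto
  | bothFree f hu hv huA hvA hf hfA =>
    have huv : u ≠ v := hS.ne (hD (by simp))
    have h1 : f ∉ x := hxl.notMem hf (Or.inl hu)
    have hDA : ({u, v, f} : Finset X) ∩ A = {u, v} := by
      ext z
      simp only [Finset.mem_inter, Finset.mem_insert, Finset.mem_singleton]
      constructor
      · rintro ⟨rfl | rfl | rfl, h⟩ <;> tauto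
      · rintro (rfl | rfl) <;> tauto
    refine IsStep.of_root hS.symm (r := u) (by simp) (by simp [hu, hv, h1]) ?_
      (even_card_of_inter_eq_pair hDA huv)
      (legalOn_of_mem (p := f) (by simp) (by simp) (by simp) hf) ?_
    · intro C hC huC
      have := hS.closed_edge hC (b := f) (by simp) hf (r := u) (s := v) (by simp) huC (by simp)
      simp [Finset.insert_subset_iff, huC, this]
    · intro K hK hne hev hleg
      obtain ⟨h2, h3⟩ := hxl.union_facts (Or.inl hu) hleg
      have h4 := mem_iff_of_even hK hDA huv hev
      obtain ⟨z, hz⟩ := hne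
      have huK : u ∈ K := by
        have := hK hz
        simp only [Finset.mem_insert, Finset.mem_singleton] at this
        rcases this with rfl | rfl | rfl
        · exact hz
        · exact h4.2 hz
        · exact (h2 _ hz hf).1.resolve_left hu
      obtain ⟨b, hb, hbB⟩ := h3 (Or.inr huK) (Or.inr (h4.1 huK))
      have := hK hb
      simp only [Finset.mem_insert, Finset.mem_singleton] at this
      rcases this with rfl | rfl | rfl
      · exact absurd hbB huB
      · exact absurd hbB hvB
      · simp [Finset.insert_subset_iff, huK, h4.1 huK, hb]
  | bothEdges e e' hu hv huA hvA he heA he' heA' hee =>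
    have huv : u ≠ v := hS.ne (hD (by simp))
    have h1 : e ∉ x := hxl.notMem he (Or.inl hu)
    have h1' : e' ∉ x := hxl.notMem he' (Or.inl hu)
    have hue : u ≠ e := fun h => huB (h ▸ he)
    have hve : v ≠ e := fun h => hvB (h ▸ he)
    have hue' : u ≠ e' := fun h => huB (h ▸ he')
    have hve' : v ≠ e' := fun h => hvB (h ▸ he')
    refine IsStep.of_root hS.symm (r := u) (by simp) (by simp [hu, hv, h1, h1']) ?_ ?_
      (legalOn_of_mem (p := e) (by simp) (by simp) (by simp) he) ?_
    · intro C hC huC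
      have h2 := hS.closed_edge hC (b := e) (by simp) he (r := u) (s := v) (by simp) huC (by simp)
      have h3 := hS.closed_edge hC (b := e') (by simp) he' (r := u) (s := v) (by simp) huC (by simp)
      simp [Finset.insert_subset_iff, huC, h2, h3]
    · have : ({u, v, e, e'} : Finset X) ∩ A = {u, v, e, e'} := by
        simp [*]
      rw [this, Finset.card_insert_of_notMem (by simp [*]),
        Finset.card_insert_of_notMem (by simp [*]), Finset.card_pair hee]
      decide
    · intro K hK hne hev hleg
      obtain ⟨h2, h3⟩ := hxl.union_facts (Or.inl hu) hleg
      have hKA : K ∩ A = K := Finset.inter_eq_left.2 (hK.trans (by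
        simp [Finset.insert_subset_iff, *]))
      rw [hKA] at hev
      have hmem : ∀ z ∈ K, z = u ∨ z = v ∨ z = e ∨ z = e' := fun z hz => by simpa using hK hz
      -- All four elements have odd weight, so `K` has even size. Singletons and triples are thereby
      -- excluded, and both ends without an edge are excluded by legality.
      have hsing : ∀ z, K ≠ {z} := by
        rintro z rfl
        simp at hev
      have htrip : ∀ b, b ≠ u → b ≠ v → K ≠ {u, v, b} := by
        rintro b hb hb' rfl
        rw [Finset.card_insert_of_notMem (by simp [huv, hb.symm]), Finset.card_pair hb'.symm] at hev
        exact absurd hev (by decide)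
      have huKv : u ∈ K ∧ v ∈ K := by
        by_contra hcon
        have heK : ∀ b ∈ K, b ∉ B := fun b hb hbB => hcon
          ⟨(h2 b hb hbB).1.resolve_left hu, (h2 b hb hbB).2.resolve_left hv⟩
        have hmem' : ∀ z ∈ K, z = u ∨ z = v := fun z hz => by
          rcases hmem z hz with h | h | rfl | rfl
          · exact Or.inl h
          · exact Or.inr h
          · exact absurd he (heK _ hz)
          · exact absurd he' (heK _ hz)
        obtain ⟨z, hz⟩ := hne
        refine hsing z (Finset.eq_singleton_iff_unique_mem.2 ⟨hz, fun w hw => ?_⟩)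
        rcases hmem' z hz with rfl | rfl <;> rcases hmem' w hw with rfl | rfl <;> tauto
      have h4 : e ∈ K := by
        by_contra h4
        obtain ⟨b, hb, hbB⟩ := h3 (Or.inr huKv.1) (Or.inr huKv.2)
        have hbe : b = e' := by
          rcases hmem b hb with rfl | rfl | rfl | rfl <;> tauto
        subst hbe
        refine htrip b hue'.symm hve'.symm (Finset.Subset.antisymm (fun z hz => ?_) ?_)
        · rcases hmem z hz with rfl | rfl | rfl | rfl <;> simp <;> tauto
        · simp [Finset.insert_subset_iff, huKv, hb]
      have h5 : e' ∈ K := by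
        by_contra h5
        refine htrip e hue.symm hve.symm (Finset.Subset.antisymm (fun z hz => ?_) ?_)
        · rcases hmem z hz with rfl | rfl | rfl | rfl <;> simp <;> tauto
        · simp [Finset.insert_subset_iff, huKv, h4]
      simp [Finset.insert_subset_iff, huKv, h4, h5]
  | edge r s e hrs hr hs hrA he heA =>
    refine isStep_pair hS.symm hr (hxl.notMem he (hmiss r s hrs hr))
      (fun h => hrB r s hrs (h ▸ he)) hrA heA (linkedOver_of_adj (hS.symm _ _ (by
        rcases hrs with ⟨rfl, rfl⟩ | ⟨rfl, rfl⟩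
        · exact hS.adj_left _ he
        · exact hS.adj_right _ he))) ?_
    refine legalOn_of_mem (p := e) ?_ ?_ (by simp) he <;>
      rcases hrs with ⟨rfl, rfl⟩ | ⟨rfl, rfl⟩ <;> simp [hs]
  | vertexFree r s c f hrs hr hs hrA hc hcA hcu hcv hcB hl hf hfA =>
    have h1 : f ∉ x := hxl.notMem hf (hmiss r s hrs hr)
    have hrne := hrc r s c hrs hcu hcv
    have hrB' := hrB r s hrs
    have hDA : ({r, c, f} : Finset X) ∩ A = {r, c} := by
      ext z
      simp only [Finset.mem_inter, Finset.mem_insert, Finset.mem_singleton]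
      constructor
      · rintro ⟨rfl | rfl | rfl, h⟩ <;> tauto
      · rintro (rfl | rfl) <;> tauto
    refine hS.isStep_of_missing hx hrs hr hs (b := f) (by simp) (by simp) hf
      (by simp [hr, hc, h1]) ?_ (even_card_of_inter_eq_pair hDA hrne) ?_
    · intro C hC hrC hsC
      have h2 := hS.closed_edge hC (b := f) (by simp) hf hrs hrC (by simp [hs])
      have : c ∈ C := by
        rcases hl with hl | hl
        · exact hl.mem hC (by intro z; simp; tauto) (by simp) hrC
        · exact hl.mem hC (by intro z; simp; rintro (rfl | h) <;> tauto) (by simp) hsC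
      simp [Finset.insert_subset_iff, hrC, h2, this]
    · intro K hK hne hev h2 h3
      have h4 := mem_iff_of_even hK hDA hrne hev
      have hmem : ∀ z ∈ K, z = r ∨ z = c ∨ z = f := fun z hz => by simpa using hK hz
      have hrK : r ∈ K := by
        obtain ⟨z, hz⟩ := hne
        rcases hmem z hz with rfl | rfl | rfl
        · exact hz
        · exact h4.2 hz
        · exact h2 _ hz hf
      obtain ⟨b, hb, hbB⟩ := h3 hrK
      have : b = f := by rcases hmem b hb with rfl | rfl | rfl <;> tauto
      subst this
      simp [Finset.insert_subset_iff, hrK, h4.1 hrK, hb]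
  | free r s f hrs hr hs hrA hf hfA =>
    have h1 : f ∉ x := hxl.notMem hf (hmiss r s hrs hr)
    have hrB' := hrB r s hrs
    refine hS.isStep_of_missing hx hrs hr hs (b := f) (by simp) (by simp) hf
      (by simp [hr, h1]) ?_ ?_ ?_
    · intro C hC hrC hsC
      have h2 := hS.closed_edge hC (b := f) (by simp) hf hrs hrC (by simp [hs])
      simp [Finset.insert_subset_iff, hrC, h2]
    · have : ({r, f} : Finset X) ∩ A = ∅ := by
        ext z
        simp only [Finset.mem_inter, Finset.mem_insert, Finset.mem_singleton, Finset.notMem_empty,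
          iff_false]
        rintro ⟨rfl | rfl, h⟩ <;> tauto
      rw [this]; simp
    · intro K hK hne hev h2 h3
      have hmem : ∀ z ∈ K, z = r ∨ z = f := fun z hz => by simpa using hK hz
      have hrK : r ∈ K := by
        obtain ⟨z, hz⟩ := hne
        rcases hmem z hz with rfl | rfl
        · exact hz
        · exact h2 _ hz hf
      obtain ⟨b, hb, hbB⟩ := h3 hrK
      have : b = f := by rcases hmem b hb with rfl | rfl <;> tauto
      subst this
      simp [Finset.insert_subset_iff, hrK, hb]
  | edges r s e e' hrs hr hs hrA he heA he' heA' hee =>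
    have h1 : e ∉ x := hxl.notMem he (hmiss r s hrs hr)
    have h1' : e' ∉ x := hxl.notMem he' (hmiss r s hrs hr)
    have hrB' := hrB r s hrs
    have hDA : ({r, e, e'} : Finset X) ∩ A = {e, e'} := by
      ext z
      simp only [Finset.mem_inter, Finset.mem_insert, Finset.mem_singleton]
      constructor
      · rintro ⟨rfl | rfl | rfl, h⟩ <;> tauto
      · rintro (rfl | rfl) <;> tauto
    refine hS.isStep_of_missing hx hrs hr hs (b := e) (by simp) (by simp) he
      (by simp [hr, h1, h1']) ?_ (even_card_of_inter_eq_pair hDA hee) ?_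
    · intro C hC hrC hsC
      have h2 := hS.closed_edge hC (b := e) (by simp) he hrs hrC (by simp [hs])
      have h3 := hS.closed_edge hC (b := e') (by simp) he' hrs hrC (by simp [hs])
      simp [Finset.insert_subset_iff, hrC, h2, h3]
    · intro K hK hne hev h2 h3
      have h4 := mem_iff_of_even hK hDA hee hev
      have hmem : ∀ z ∈ K, z = r ∨ z = e ∨ z = e' := fun z hz => by simpa using hK hz
      have hrK : r ∈ K := by
        obtain ⟨z, hz⟩ := hne
        rcases hmem z hz with rfl | rfl | rfl
        · exact hz
        · exact h2 _ hz he
        · exact h2 _ hz he'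
      obtain ⟨b, hb, hbB⟩ := h3 hrK
      have heK : e ∈ K := by rcases hmem b hb with rfl | rfl | rfl <;> tauto
      simp [Finset.insert_subset_iff, hrK, heK, h4.1 heK]
  | vertexEdge r s c e hrs hr hs hrA hc hcA hcu hcv hcB hl he heA =>
    have h1 : e ∉ x := hxl.notMem he (hmiss r s hrs hr)
    have hce : c ≠ e := fun h => hcB (h ▸ he)
    have hrB' := hrB r s hrs
    have hDA : ({r, c, e} : Finset X) ∩ A = {c, e} := by
      ext z
      simp only [Finset.mem_inter, Finset.mem_insert, Finset.mem_singleton]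
      constructor
      · rintro ⟨rfl | rfl | rfl, h⟩ <;> tauto
      · rintro (rfl | rfl) <;> tauto
    refine hS.isStep_of_missing hx hrs hr hs (b := e) (by simp) (by simp) he
      (by simp [hr, hc, h1]) ?_ (even_card_of_inter_eq_pair hDA hce) ?_
    · intro C hC hrC hsC
      have h2 := hS.closed_edge hC (b := e) (by simp) he hrs hrC (by simp [hs])
      have : c ∈ C := by
        rcases hl with hl | hl
        · exact hl.mem hC (by intro z; simp; tauto) (by simp) hrC
        · exact hl.mem hC (by intro z; simp; rintro (rfl | h) <;> tauto) (by simp) hsC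
      simp [Finset.insert_subset_iff, hrC, h2, this]
    · intro K hK hne hev h2 h3
      have h4 := mem_iff_of_even hK hDA hce hev
      have hmem : ∀ z ∈ K, z = r ∨ z = c ∨ z = e := fun z hz => by simpa using hK hz
      have heK : e ∈ K := by
        obtain ⟨z, hz⟩ := hne
        rcases hmem z hz with rfl | rfl | rfl
        · obtain ⟨b, hb, hbB⟩ := h3 hz
          rcases hmem b hb with rfl | rfl | rfl <;> tauto
        · exact h4.1 hz
        · exact hz
      simp [Finset.insert_subset_iff, h2 e heK he, h4.2 heK, heK]

end OneBundle

/-! ### Finding steps inside a larger even set -/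

section OneBundle

variable {X : Type*} [DecidableEq X] {adj : X → X → Prop} {A T B x y a D : Finset X} {u v p q : X}

/-- A set of odd weight outside `x` is linked over `x` to a further element of `y`. -/
lemma EvenOn.exists_linkedOver (hx : EvenOn adj A x) (hy : EvenOn adj A y) (hxy : x ⊆ y)
    {W : Finset X} (hW : W ⊆ y) (hodd : Odd ((W \ x) ∩ A).card) :
    ∃ p ∈ W, ∃ q ∈ y, q ∉ x ∧ q ∉ W ∧ LinkedOver adj x p q := by
  have hmem : ∀ z, z ∈ W.biUnion (fun p => compIn adj (insert p x) p) ↔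
      ∃ p ∈ W, z ∈ compIn adj (insert p x) p := fun z => Finset.mem_biUnion
  -- The union of the components over `x` of the elements of `W`. It respects the components of `x`
  -- and has the same weight outside `x` as `W`, hence it can be left within `y`.
  have key := hx.exists_adj_of_odd hy
    (C := W.biUnion fun p => compIn adj (insert p x) p) ?_ ⟨Finset.inter_subset_right, ?_⟩ ?_
  · obtain ⟨z, hz, q, hq, hqC, hzq⟩ := key
    obtain ⟨p, hp, hz⟩ := (hmem z).1 hz
    refine ⟨p, hp, q, hq, fun hqx => ?_, fun hqW => ?_, z, hz, hzq⟩
    · exact hqC ((hmem q).2 ⟨p, hp, closedIn_compIn.mem hz (Finset.mem_insert_of_mem hqx) hzq⟩)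
    · exact hqC ((hmem q).2 ⟨q, hqW, mem_compIn_self (Finset.mem_insert_self _ _)⟩)
  · intro z hz
    obtain ⟨p, hp, hz⟩ := (hmem z).1 hz
    rcases Finset.mem_insert.1 (compIn_subset hz) with rfl | h
    · exact hW hp
    · exact hxy h
  · intro z hz q hq hzq
    obtain ⟨hz, hzx⟩ := Finset.mem_inter.1 hz
    obtain ⟨p, hp, hz⟩ := (hmem z).1 hz
    exact Finset.mem_inter.2
      ⟨(hmem q).2 ⟨p, hp, closedIn_compIn.mem hz (Finset.mem_insert_of_mem hq) hzq⟩, hq⟩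
  · have : W.biUnion (fun p => compIn adj (insert p x) p) \ x = W \ x := by
      ext z
      simp only [Finset.mem_sdiff, hmem]
      refine and_congr_left fun hzx => ⟨?_, fun hz =>
        ⟨z, hz, mem_compIn_self (Finset.mem_insert_self _ _)⟩⟩
      rintro ⟨p, hp, hz⟩
      rcases Finset.mem_insert.1 (compIn_subset hz) with rfl | h
      · exact hp
      · exact absurd h hzx
    rw [this]
    exact hodd

lemma linkedOver_of_mem_compIn (hs : ∀ p q, adj p q → adj q p) (hp : p ∉ x) (hq : q ∈ x)
    (h : q ∈ compIn adj (insert p x) p) : LinkedOver adj x q p := by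
  have hpq : p ≠ q := fun h => hp (h ▸ hq)
  refine linkedOver_of_forall_closedIn (by simp [hp, hpq]) fun C hC hqC => ?_
  rw [Finset.insert_eq_self.2 hq] at hC
  by_contra hpC
  have := compIn_subset_of_closedIn (hC.sdiff hs)
    (Finset.mem_sdiff.2 ⟨Finset.mem_insert_self _ _, hpC⟩) h
  exact (Finset.mem_sdiff.1 this).2 hqC

namespace BundleSystem

/-- The neighbours of a bundle edge are among the two ends, so its component over `x` consists of
itself and components of the ends that lie in `x`. -/
lemma linkedOver_edge (hS : BundleSystem adj A T B u v) {b : X} (hb : b ∈ B)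
    (h : LinkedOver adj x b q) :
    q = u ∨ q = v ∨ (u ∈ x ∧ LinkedOver adj x u q) ∨ (v ∈ x ∧ LinkedOver adj x v q) := by
  obtain ⟨z, hz, hzq⟩ := h
  have hsub : ∀ w ∈ compIn adj (insert b x) b,
      w = b ∨ (u ∈ x ∧ w ∈ compIn adj (insert u x) u) ∨
        (v ∈ x ∧ w ∈ compIn adj (insert v x) v) := by
    intro w hw
    classical
    have := compIn_subset_of_closedIn (C := (insert b x).filter fun w =>
      w = b ∨ (u ∈ x ∧ w ∈ compIn adj (insert u x) u) ∨
        (v ∈ x ∧ w ∈ compIn adj (insert v x) v)) ⟨Finset.filter_subset _ _, ?_⟩ ?_ hw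
    · exact (Finset.mem_filter.1 this).2
    · intro w hw t ht hwt
      refine Finset.mem_filter.2 ⟨ht, ?_⟩
      rcases Finset.mem_insert.1 ht with rfl | htx
      · exact Or.inl rfl
      obtain ⟨_, rfl | ⟨h1, h2⟩ | ⟨h1, h2⟩⟩ := Finset.mem_filter.1 hw
      · rcases hS.eq_or_eq _ hb _ hwt with rfl | rfl
        · exact Or.inr (Or.inl ⟨htx, mem_compIn_self (Finset.mem_insert_self _ _)⟩)
        · exact Or.inr (Or.inr ⟨htx, mem_compIn_self (Finset.mem_insert_self _ _)⟩)
      · exact Or.inr (Or.inl ⟨h1, closedIn_compIn.mem h2 (Finset.mem_insert_of_mem htx) hwt⟩)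
      · exact Or.inr (Or.inr ⟨h1, closedIn_compIn.mem h2 (Finset.mem_insert_of_mem htx) hwt⟩)
    · simp
  rcases hsub z hz with rfl | ⟨h1, h2⟩ | ⟨h1, h2⟩
  · exact (hS.eq_or_eq _ hb _ hzq).imp_right Or.inl
  · exact Or.inr (Or.inr (Or.inl ⟨h1, z, h2, hzq⟩))
  · exact Or.inr (Or.inr (Or.inr ⟨h1, z, h2, hzq⟩))

/-- Elements linked to the ends of the bundle are linked to each other once both ends are there. -/
lemma linkedOver_of_ends (hS : BundleSystem adj A T B u v) (hleg : LegalOn B u v x) (hu : u ∈ x)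
    (hv : v ∈ x) (hpq : p ≠ q) (hq : q ∉ x)
    (h1 : LinkedOver adj x u p ∨ LinkedOver adj x v p)
    (h2 : LinkedOver adj x u q ∨ LinkedOver adj x v q) : LinkedOver adj x p q := by
  refine linkedOver_of_forall_closedIn (by simp [hq, hpq.symm]) fun C hC hp => ?_
  obtain ⟨b, hb, hbB⟩ := hleg.2 hu hv
  have hS1 : insert u x ⊆ insert q (insert p x) := by intro z; simp; rintro (rfl | h) <;> tauto
  have hS2 : insert v x ⊆ insert q (insert p x) := by intro z; simp; rintro (rfl | h) <;> tauto
  have hSu : u ∈ insert q (insert p x) := hS1 (by simp)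
  have hSv : v ∈ insert q (insert p x) := hS2 (by simp)
  have hSb : b ∈ insert q (insert p x) := by simp [hb]
  have hend : ∀ D, ClosedIn adj (insert q (insert p x)) D → (u ∈ D ↔ v ∈ D) := fun D hD =>
    ⟨fun h => (hS.closed_edge hD hSb hbB (Or.inl ⟨rfl, rfl⟩) h hSv).2,
      fun h => (hS.closed_edge hD hSb hbB (Or.inr ⟨rfl, rfl⟩) h hSu).2⟩
  have huC : u ∈ C := by
    by_contra huC
    have hC' := hC.sdiff hS.symm
    have huC' : u ∈ insert q (insert p x) \ C := Finset.mem_sdiff.2 ⟨hSu, huC⟩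
    have : p ∈ insert q (insert p x) \ C := by
      rcases h1 with h1 | h1
      · exact h1.mem hC' hS1 (by simp) huC'
      · exact h1.mem hC' hS2 (by simp) ((hend _ hC').1 huC')
    exact (Finset.mem_sdiff.1 this).2 hp
  rcases h2 with h2 | h2
  · exact h2.mem hC hS1 (by simp) huC
  · exact h2.mem hC hS2 (by simp) ((hend _ hC).1 huC)

set_option maxHeartbeats 1600000 in
/-- An even set with a new end of the bundle contains a special step. -/
lemma exists_specialStep (hS : BundleSystem adj A T B u v) (hx : IsEvenLegal adj A T B u v x)
    (hy : IsEvenLegal adj A T B u v y) (hxy : x ⊆ y) {r s : X}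
    (hrs : r = u ∧ s = v ∨ r = v ∧ s = u) (hry : r ∈ y) (hrx : r ∉ x) :
    ∃ D, SpecialStep adj A B u v x D ∧ D ⊆ y := by
  have hrne : r ≠ s := by
    rcases hrs with ⟨rfl, rfl⟩ | ⟨rfl, rfl⟩
    · exact hS.ne (hy.subset hry)
    · rintro rfl
      exact hS.ne (hy.subset hry) rfl
  have hrB : r ∉ B ∧ s ∉ B := by
    rcases hrs with ⟨rfl, rfl⟩ | ⟨rfl, rfl⟩
    · exact ⟨hS.left_notMem, hS.right_notMem⟩
    · exact ⟨hS.right_notMem, hS.left_notMem⟩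
  have hsy : ∀ b ∈ y, b ∈ B → s ∈ y := fun b hb hbB => by
    rcases hrs with ⟨rfl, rfl⟩ | ⟨rfl, rfl⟩
    · exact (hy.legal.1 b hb hbB).2
    · exact (hy.legal.1 b hb hbB).1
  have hby : s ∈ y → ∃ b ∈ y, b ∈ B := fun hs => by
    rcases hrs with ⟨rfl, rfl⟩ | ⟨rfl, rfl⟩
    · exact hy.legal.2 hry hs
    · exact hy.legal.2 hs hry
  have hord : ∀ c, c ≠ r → c ≠ s → c ≠ u ∧ c ≠ v := fun c h1 h2 => by
    rcases hrs with ⟨rfl, rfl⟩ | ⟨rfl, rfl⟩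
    · exact ⟨h1, h2⟩
    · exact ⟨h2, h1⟩
  have hBx : ∀ b ∈ B, b ∉ x := fun b hb => hx.legal.notMem hb (by
    rcases hrs with ⟨rfl, rfl⟩ | ⟨rfl, rfl⟩ <;> simp [hrx])
  have hsr : s = u ∧ r = v ∨ s = v ∧ r = u := by tauto
  have hedge : ∀ b ∈ B, ∀ q, q ≠ r → q ≠ s → LinkedOver adj x b q →
      s ∈ x ∧ LinkedOver adj x s q := fun b hb q h1 h2 hl => by
    have := hS.linkedOver_edge hb hl
    rcases hrs with ⟨rfl, rfl⟩ | ⟨rfl, rfl⟩ <;> tauto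
  by_cases hsx : s ∈ x
  · obtain ⟨b, hb, hbB⟩ := hby (hxy hsx)
    -- If exactly one of `r` and `e` has odd weight and `y` has no other bundle edge of odd weight,
    -- then the ends together with the bundle edges of `y` have odd weight outside `x`. So they are
    -- linked to a further vertex `c`; a link from an edge passes through `s`, the end in `x`.
    have hlink : ∀ e, e ∈ y → e ∈ B → (∀ b ∈ y, b ∈ B → b ∈ A → b = e) → (r ∈ A ↔ e ∉ A) →
        ∃ c ∈ y, c ∉ x ∧ c ∈ A ∧ c ≠ u ∧ c ≠ v ∧ c ∉ B ∧
          (LinkedOver adj x r c ∨ LinkedOver adj x s c) := by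
      intro e hey heB heu hre
      have key := hx.even.exists_linkedOver hy.even hxy
        (W := insert r (insert s (y ∩ B))) ?_ ?_
      · obtain ⟨p, hp, q, hqy, hqx, hqW, hl⟩ := key
        simp only [Finset.mem_insert, Finset.mem_inter, not_or, not_and] at hqW
        obtain ⟨hqr, hqs, hqB⟩ := hqW
        obtain ⟨h1, h2⟩ := hord q hqr hqs
        refine ⟨q, hqy, hqx, hS.weight q (hy.subset hqy) h1 h2 (hqB hqy), h1, h2, hqB hqy, ?_⟩
        simp only [Finset.mem_insert, Finset.mem_inter] at hp
        rcases hp with rfl | rfl | ⟨_, hp⟩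
        · exact Or.inl hl
        · exact Or.inr hl
        · exact Or.inr (hedge p hp q hqr hqs hl).2
      · intro z
        simp only [Finset.mem_insert, Finset.mem_inter]
        rintro (rfl | rfl | h)
        · exact hry
        · exact hxy hsx
        · exact h.1
      · by_cases hrA : r ∈ A
        · have : (insert r (insert s (y ∩ B)) \ x) ∩ A = {r} := by
            ext z
            simp only [Finset.mem_insert, Finset.mem_inter, Finset.mem_sdiff,
              Finset.mem_singleton]
            constructor
            · rintro ⟨⟨rfl | rfl | h, h1⟩, h2⟩
              · rfl
              · exact absurd hsx h1
              · exact absurd (heu z h.1 h.2 h2 ▸ h2) (hre.1 hrA)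
            · rintro rfl
              exact ⟨⟨Or.inl rfl, hrx⟩, hrA⟩
          rw [this]; simp
        · have heA : e ∈ A := by tauto
          have : (insert r (insert s (y ∩ B)) \ x) ∩ A = {e} := by
            ext z
            simp only [Finset.mem_insert, Finset.mem_inter, Finset.mem_sdiff,
              Finset.mem_singleton]
            constructor
            · rintro ⟨⟨rfl | rfl | h, h1⟩, h2⟩
              · exact absurd h2 hrA
              · exact absurd hsx h1
              · exact heu z h.1 h.2 h2
            · rintro rfl
              exact ⟨⟨Or.inr (Or.inr ⟨hey, heB⟩), hBx _ heB⟩, heA⟩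
          rw [this]; simp
    by_cases hrA : r ∈ A
    · by_cases he : ∃ e ∈ y, e ∈ B ∧ e ∈ A
      · obtain ⟨e, hey, heB, heA⟩ := he
        exact ⟨_, .edge r s e hrs hrx hsx hrA heB heA, by simp [Finset.insert_subset_iff, *]⟩
      · push Not at he
        obtain ⟨c, hcy, hcx, hcA, hcu, hcv, hcB, hl⟩ := hlink b hb hbB
          (fun b hb hbB hbA => absurd hbA (he b hb hbB)) (by simp [hrA, he b hb hbB])
        exact ⟨_, .vertexFree r s c b hrs hrx hsx hrA hcx hcA hcu hcv hcB hl hbB (he b hb hbB),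
          by simp [Finset.insert_subset_iff, *]⟩
    · by_cases hf : ∃ f ∈ y, f ∈ B ∧ f ∉ A
      · obtain ⟨f, hfy, hfB, hfA⟩ := hf
        exact ⟨_, .free r s f hrs hrx hsx hrA hfB hfA, by simp [Finset.insert_subset_iff, *]⟩
      push Not at hf
      by_cases he : ∃ e ∈ y, e ∈ B ∧ e ≠ b
      · obtain ⟨e, hey, heB, hne⟩ := he
        exact ⟨_, .edges r s e b hrs hrx hsx hrA heB (hf e hey heB) hbB (hf b hb hbB) hne,
          by simp [Finset.insert_subset_iff, *]⟩
      push Not at he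
      obtain ⟨c, hcy, hcx, hcA, hcu, hcv, hcB, hl⟩ := hlink b hb hbB
        (fun b hb hbB _ => he b hb hbB) (by simp [hrA, hf b hb hbB])
      exact ⟨_, .vertexEdge r s c b hrs hrx hsx hrA hcx hcA hcu hcv hcB hl hbB (hf b hb hbB),
          by simp [Finset.insert_subset_iff, *]⟩
  · by_cases hrA : r ∉ A
    · exact ⟨_, .light r s hrs hrx hsx hrA, by simpa using hry⟩
    push Not at hrA
    obtain ⟨p, hp, q, hqy, hqx, hqW, hl⟩ := hx.even.exists_linkedOver hy.even hxy (W := {r})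
      (by simpa using hry) (by
        have : ({r} \ x) ∩ A = {r} := by
          ext z
          simp only [Finset.mem_inter, Finset.mem_sdiff, Finset.mem_singleton]
          constructor
          · tauto
          · rintro rfl; tauto
        rw [this]; simp)
    rw [Finset.mem_singleton] at hp hqW
    subst hp
    by_cases hq : q ≠ s ∧ q ∉ B
    · obtain ⟨h1, h2⟩ := hord q hqW hq.1
      exact ⟨_, .pair p s q hrs hrx hsx hrA hqx (hS.weight q (hy.subset hqy) h1 h2 hq.2) h1 h2
        hq.2 hl, by simp [Finset.insert_subset_iff, *]⟩
    have hs : s ∈ y := by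
      by_cases h : q = s
      · exact h ▸ hqy
      · exact hsy q hqy (by tauto)
    by_cases hsA : s ∉ A
    · exact ⟨_, .light s p hsr hsx hrx hsA, by simpa using hs⟩
    push Not at hsA
    have huv : u ∉ x ∧ v ∉ x ∧ u ∈ A ∧ v ∈ A ∧ u ∈ y ∧ v ∈ y := by
      rcases hrs with ⟨rfl, rfl⟩ | ⟨rfl, rfl⟩ <;> tauto
    obtain ⟨hux, hvx, huA, hvA, huy, hvy⟩ := huv
    obtain ⟨b, hb, hbB⟩ := hby hs
    by_cases hf : ∃ f ∈ y, f ∈ B ∧ f ∉ A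
    · obtain ⟨f, hfy, hfB, hfA⟩ := hf
      exact ⟨_, .bothFree f hux hvx huA hvA hfB hfA, by simp [Finset.insert_subset_iff, *]⟩
    push Not at hf
    by_cases he : ∃ e ∈ y, e ∈ B ∧ e ≠ b
    · obtain ⟨e, hey, heB, hne⟩ := he
      exact ⟨_, .bothEdges e b hux hvx huA hvA heB (hf e hey heB) hbB (hf b hb hbB) hne,
        by simp [Finset.insert_subset_iff, *]⟩
    push Not at he
    -- Both ends are new and of odd weight, and `b` is the only bundle edge of `y`, also of odd
    -- weight. The three together are odd, so something else is linked to them. It is not linked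
    -- through `b`, which has no neighbour in `x`.
    have hWx : (({p, s, b} : Finset X) \ x) ∩ A = {p, s, b} := by
      ext z
      simp only [Finset.mem_inter, Finset.mem_sdiff, Finset.mem_singleton, Finset.mem_insert]
      constructor
      · tauto
      · rintro (rfl | rfl | rfl)
        · tauto
        · tauto
        · exact ⟨⟨by tauto, hBx _ hbB⟩, hf _ hb hbB⟩
    obtain ⟨t, ht, c, hcy, hcx, hcW, hlc⟩ := hx.even.exists_linkedOver hy.even hxy
      (W := {p, s, b}) (by simp [Finset.insert_subset_iff, *]) (by
        rw [hWx, Finset.card_insert_of_notMem, Finset.card_pair]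
        · decide
        · rintro rfl; exact hrB.2 hbB
        · simp only [Finset.mem_insert, Finset.mem_singleton]
          rintro (h | rfl)
          · exact hrne h
          · exact hrB.1 hbB)
    simp only [Finset.mem_insert, Finset.mem_singleton, not_or] at ht hcW
    have hcB : c ∉ B := fun h => hcW.2.2 (he c hcy h)
    obtain ⟨h1, h2⟩ := hord c hcW.1 hcW.2.1
    have hcA := hS.weight c (hy.subset hcy) h1 h2 hcB
    rcases ht with rfl | rfl | rfl
    · exact ⟨_, .pair t s c hrs hrx hsx hrA hcx hcA h1 h2 hcB hlc,
        by simp [Finset.insert_subset_iff, *]⟩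
    · exact ⟨_, .pair t p c hsr hsx hrx hsA hcx hcA h1 h2 hcB hlc,
        by simp [Finset.insert_subset_iff, *]⟩
    · exact absurd (hedge t hbB c hcW.1 hcW.2.1 hlc).1 hsx

/-- Without new ends of the bundle, elements of odd weight can be added in pairs. -/
lemma exists_linked_pair (hS : BundleSystem adj A T B u v) (hx : IsEvenLegal adj A T B u v x)
    (hy : IsEvenLegal adj A T B u v y) (hxy : x ⊆ y) (hu : u ∈ y → u ∈ x) (hv : v ∈ y → v ∈ x)
    (hp : p ∈ y) (hpx : p ∉ x) (hpA : p ∈ A) :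
    ∃ q ∈ y, q ∉ x ∧ q ≠ p ∧ q ∈ A ∧ LinkedOver adj x p q := by
  -- A bundle edge of even weight cannot serve as partner. If `p` is linked to such an edge, then
  -- `p` is linked to an end of the bundle in `x`, and the argument is repeated with all such edges
  -- of `y` added to `p`: whatever they reach, they reach through the ends, hence from `p`.
  by_cases hf : ∃ f ∈ y, f ∈ B ∧ f ∉ x ∧ f ∉ A ∧ LinkedOver adj x p f
  · obtain ⟨f, hfy, hfB, hfx, hfA, hpf⟩ := hf
    have hux := hu (hy.legal.1 f hfy hfB).1
    have hvx := hv (hy.legal.1 f hfy hfB).2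
    have hpu : LinkedOver adj x u p ∨ LinkedOver adj x v p := by
      obtain ⟨z, hz, hzf⟩ := hpf
      rcases hS.eq_or_eq f hfB z (hS.symm _ _ hzf) with rfl | rfl
      · exact Or.inl (linkedOver_of_mem_compIn hS.symm hpx hux hz)
      · exact Or.inr (linkedOver_of_mem_compIn hS.symm hpx hvx hz)
    obtain ⟨t, ht, q, hqy, hqx, hqW, hl⟩ := hx.even.exists_linkedOver hy.even hxy
      (W := insert p ((y ∩ B) \ A)) (by
        intro z
        simp only [Finset.mem_insert, Finset.mem_inter, Finset.mem_sdiff]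
        rintro (rfl | h)
        · exact hp
        · exact h.1.1) (by
        have : (insert p ((y ∩ B) \ A) \ x) ∩ A = {p} := by
          ext z
          simp only [Finset.mem_insert, Finset.mem_inter, Finset.mem_sdiff, Finset.mem_singleton]
          constructor
          · tauto
          · rintro rfl; tauto
        rw [this]; simp)
    simp only [Finset.mem_insert, Finset.mem_inter, Finset.mem_sdiff, not_or] at ht hqW
    have hqu : q ≠ u := fun h => hqx (h ▸ hux)
    have hqv : q ≠ v := fun h => hqx (h ▸ hvx)
    have hqA : q ∈ A := by
      by_cases hqB : q ∈ B
      · tauto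
      · exact hS.weight q (hy.subset hqy) hqu hqv hqB
    refine ⟨q, hqy, hqx, hqW.1, hqA, ?_⟩
    rcases ht with rfl | ht
    · exact hl
    · refine hS.linkedOver_of_ends hx.legal hux hvx (Ne.symm hqW.1) hqx hpu ?_
      have := hS.linkedOver_edge ht.1.2 hl
      tauto
  · push Not at hf
    obtain ⟨t, ht, q, hqy, hqx, hqW, hl⟩ := hx.even.exists_linkedOver hy.even hxy (W := {p})
      (by simpa using hp) (by
        have : ({p} \ x) ∩ A = {p} := by
          ext z
          simp only [Finset.mem_inter, Finset.mem_sdiff, Finset.mem_singleton]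
          constructor
          · tauto
          · rintro rfl; tauto
        rw [this]; simp)
    rw [Finset.mem_singleton] at ht hqW
    subst ht
    refine ⟨q, hqy, hqx, hqW, ?_, hl⟩
    by_contra hqA
    by_cases hqB : q ∈ B
    · exact hf q hqy hqB hqx hqA hl
    · exact hqA (hS.weight q (hy.subset hqy) (fun h => hqx (h ▸ hu (h ▸ hqy)))
        (fun h => hqx (h ▸ hv (h ▸ hqy))) hqB)

end BundleSystem

end OneBundle

/-! ### Covers in the poset of legal even sets -/

section OneBundle

variable {X : Type*} [DecidableEq X] {adj : X → X → Prop} {A T B D : Finset X} {u v p q : X}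

/-- The poset of legal even subsets of `T`. -/
abbrev EvenLegal (adj : X → X → Prop) (A T B : Finset X) (u v : X) : Type _ :=
  {S : Finset X // IsEvenLegal adj A T B u v S}

lemma LegalOn.union_of_noNew {x y K : Finset X} (hx : LegalOn B u v x) (hy : LegalOn B u v y)
    (hK : K ⊆ y) (hu : u ∈ y → u ∈ x) (hv : v ∈ y → v ∈ x) : LegalOn B u v (x ∪ K) := by
  have h1 := hx.1
  have h2 := hx.2
  refine ⟨fun b hb hbB => ?_, fun hu' hv' => ?_⟩
  · simp only [Finset.mem_union] at hb ⊢
    rcases hb with hb | hb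
    · exact ⟨Or.inl (h1 b hb hbB).1, Or.inl (h1 b hb hbB).2⟩
    · exact ⟨Or.inl (hu (hy.1 b (hK hb) hbB).1), Or.inl (hv (hy.1 b (hK hb) hbB).2)⟩
  · simp only [Finset.mem_union] at hu' hv'
    obtain ⟨b, hb, hbB⟩ := h2 (hu'.elim id fun h => hu (hK h)) (hv'.elim id fun h => hv (hK h))
    exact ⟨b, Finset.mem_union_left _ hb, hbB⟩

/-- The rank of the cover `a` of `x`: covers with a new end of the bundle come first. -/
def bundleRank (A : Finset X) (u v : X) (num : X → ℕ) (N : ℕ) (x a : Finset X) : ℕ :=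
  if u ∈ a \ x ∨ v ∈ a \ x then
    if (a \ x).card ≤ 2 then (a \ x).card else 3 + ∑ p ∈ (a \ x) \ A, num p
  else N

namespace BundleSystem

variable {x y a e z : EvenLegal adj A T B u v}

lemma exists_cover (hS : BundleSystem adj A T B u v) (h : IsStep adj A B u v x.1 D) (hxy : x ≤ y)
    (hD : D ⊆ y.1) : ∃ z, x ⋖ z ∧ z ≤ y ∧ z.1 = x.1 ∪ D := by
  refine ⟨⟨x.1 ∪ D, h.isEvenLegal hS x.2 (hD.trans y.2.subset)⟩, ⟨?_, ?_⟩,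
    Finset.union_subset hxy hD, rfl⟩
  · refine lt_of_le_of_ne (Finset.subset_union_left (s₁ := x.1)) fun hxe => ?_
    obtain ⟨p, hp⟩ := h.nonempty
    have : p ∈ x.1 := by rw [hxe]; exact Finset.mem_union_right _ hp
    exact Finset.disjoint_left.1 h.disjoint this hp
  · intro c hxc hc
    exact hc.ne (Subtype.ext (h.eq_of_le x.2 c.2 hxc hc.le))

/-- A new end of the bundle. -/
lemma exists_special_cover (hS : BundleSystem adj A T B u v) (hxy : x ≤ y)
    (h : (u ∈ y.1 ∧ u ∉ x.1) ∨ (v ∈ y.1 ∧ v ∉ x.1)) :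
    ∃ z D, x ⋖ z ∧ z ≤ y ∧ z.1 = x.1 ∪ D ∧ SpecialStep adj A B u v x.1 D ∧
      IsStep adj A B u v x.1 D := by
  have : ∃ D, SpecialStep adj A B u v x.1 D ∧ D ⊆ y.1 := by
    rcases h with ⟨h1, h2⟩ | ⟨h1, h2⟩
    · exact hS.exists_specialStep x.2 y.2 hxy (Or.inl ⟨rfl, rfl⟩) h1 h2
    · exact hS.exists_specialStep x.2 y.2 hxy (Or.inr ⟨rfl, rfl⟩) h1 h2
  obtain ⟨D, hD, hDy⟩ := this
  have hstep := hD.isStep hS x.2 (hDy.trans y.2.subset)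
  obtain ⟨z, h1, h2, h3⟩ := hS.exists_cover hstep hxy hDy
  exact ⟨z, D, h1, h2, h3, hD, hstep⟩

lemma sdiff_eq_of_eq_union (h : z.1 = x.1 ∪ D) (hD : IsStep adj A B u v x.1 D) :
    z.1 \ x.1 = D := by
  rw [h, Finset.union_sdiff_left, Finset.sdiff_eq_self_iff_disjoint]
  exact hD.disjoint.symm

/-- A set with a new end contains a special step, and for a cover this step has to be everything. -/
lemma specialStep_of_covBy (hS : BundleSystem adj A T B u v) (hxa : x ⋖ a)
    (h : (u ∈ a.1 ∧ u ∉ x.1) ∨ (v ∈ a.1 ∧ v ∉ x.1)) :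
    SpecialStep adj A B u v x.1 (a.1 \ x.1) := by
  obtain ⟨z, D, h1, h2, h3, h4, h5⟩ := hS.exists_special_cover hxa.le h
  obtain rfl : z = a := (hxa.eq_or_eq h1.le h2).resolve_left h1.lt.ne'
  rwa [sdiff_eq_of_eq_union h3 h5]

/-- The covers without a new end of the bundle. -/
lemma covBy_of_noNew (hS : BundleSystem adj A T B u v) (hxa : x ⋖ a) (hu : u ∈ a.1 → u ∈ x.1)
    (hv : v ∈ a.1 → v ∈ x.1) :
    (∃ f, f ∉ x.1 ∧ f ∉ A ∧ a.1 = x.1 ∪ {f}) ∨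
      ∃ p q, p ∉ x.1 ∧ q ∉ x.1 ∧ p ≠ q ∧ p ∈ A ∧ q ∈ A ∧ LinkedOver adj x.1 p q ∧
        a.1 = x.1 ∪ {p, q} := by
  obtain ⟨p, hpa, hpx⟩ := Finset.exists_of_ssubset (show x.1 ⊂ a.1 from hxa.lt)
  by_cases hpA : p ∈ A
  · obtain ⟨q, hqa, hqx, hqp, hqA, hl⟩ := hS.exists_linked_pair x.2 a.2 hxa.le hu hv hpa hpx hpA
    have hK : ({p, q} : Finset X) ⊆ a.1 := by simp [Finset.insert_subset_iff, hpa, hqa]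
    obtain ⟨z, h1, h2, h3⟩ := hS.exists_cover (isStep_pair hS.symm hpx hqx hqp.symm hpA hqA hl
      (x.2.legal.union_of_noNew a.2.legal hK hu hv)) hxa.le hK
    obtain rfl : z = a := (hxa.eq_or_eq h1.le h2).resolve_left h1.lt.ne'
    exact Or.inr ⟨p, q, hpx, hqx, hqp.symm, hpA, hqA, hl, h3⟩
  · have hK : ({p} : Finset X) ⊆ a.1 := by simp [hpa]
    obtain ⟨z, h1, h2, h3⟩ := hS.exists_cover (isStep_singleton hS.symm hpx hpA
      (x.2.legal.union_of_noNew a.2.legal hK hu hv)) hxa.le hK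
    obtain rfl : z = a := (hxa.eq_or_eq h1.le h2).resolve_left h1.lt.ne'
    exact Or.inl ⟨p, hpx, hpA, h3⟩

/-- Within a set without new ends of the bundle, a pair of elements of odd weight, or a single
element, can be added to `a`. -/
lemma exists_cover_of_linked (hS : BundleSystem adj A T B u v) (hay : a ≤ y)
    (hu : u ∈ y.1 → u ∈ a.1) (hv : v ∈ y.1 → v ∈ a.1) (hp : p ∈ y.1) (hq : q ∈ y.1)
    (hpA : p ∈ A) (hqA : q ∈ A) (hpq : p ≠ q) (hl : LinkedOver adj a.1 p q)
    (hpa : p ∉ a.1) (hqa : q ∉ a.1) :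
    ∃ z, a ⋖ z ∧ z ≤ y ∧ z.1 = a.1 ∪ {p, q} := by
  have hK : ({p, q} : Finset X) ⊆ y.1 := by simp [Finset.insert_subset_iff, hp, hq]
  exact hS.exists_cover (isStep_pair hS.symm hpa hqa hpq hpA hqA hl
    (a.2.legal.union_of_noNew y.2.legal hK hu hv)) hay hK

lemma exists_cover_of_mem (hS : BundleSystem adj A T B u v) (hay : a ≤ y)
    (hu : u ∈ y.1 → u ∈ a.1) (hv : v ∈ y.1 → v ∈ a.1) (hp : p ∈ y.1) (hpa : p ∉ a.1) :
    ∃ z, a ⋖ z ∧ z ≤ y ∧ p ∈ z.1 := by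
  by_cases hpA : p ∈ A
  · obtain ⟨q, hqy, hqa, hqp, hqA, hl⟩ := hS.exists_linked_pair a.2 y.2 hay hu hv hp hpa hpA
    obtain ⟨z, h1, h2, h3⟩ := hS.exists_cover_of_linked hay hu hv hp hqy hpA hqA hqp.symm hl hpa hqa
    exact ⟨z, h1, h2, by simp [h3]⟩
  · have hK : ({p} : Finset X) ⊆ y.1 := by simp [hp]
    obtain ⟨z, h1, h2, h3⟩ := hS.exists_cover (isStep_singleton hS.symm hpa hpA
      (a.2.legal.union_of_noNew y.2.legal hK hu hv)) hay hK
    exact ⟨z, h1, h2, by simp [h3]⟩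

/-- Semimodularity away from the ends of the bundle. -/
lemma exists_join_of_noNew (hS : BundleSystem adj A T B u v) (hxa : x ⋖ a) (hxe : x ⋖ e)
    (hea : e ≠ a) (hay : a ≤ y) (hey : e ≤ y) (hu : u ∈ y.1 → u ∈ x.1) (hv : v ∈ y.1 → v ∈ x.1) :
    ∃ z, a ⋖ z ∧ z ≤ y ∧ e ≤ z := by
  have hle : ¬ e ≤ a := fun h => hea ((hxa.eq_or_eq hxe.le h).resolve_left hxe.lt.ne')
  have hua : u ∈ y.1 → u ∈ a.1 := fun h => hxa.le (hu h)
  have hva : v ∈ y.1 → v ∈ a.1 := fun h => hxa.le (hv h)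
  have hsingle : ∀ p ∈ e.1, p ∉ a.1 → (∀ q ∈ e.1, q = p ∨ q ∈ a.1) →
      ∃ z, a ⋖ z ∧ z ≤ y ∧ e ≤ z := by
    intro p hp hpa h
    obtain ⟨z, h1, h2, h3⟩ := hS.exists_cover_of_mem hay hua hva (hey hp) hpa
    refine ⟨z, h1, h2, fun q hq => ?_⟩
    rcases h q hq with rfl | h
    · exact h3
    · exact h1.le h
  rcases hS.covBy_of_noNew hxe (fun h => hu (hey h)) (fun h => hv (hey h)) with
    ⟨f, hfx, hfA, hef⟩ | ⟨p, q, hpx, hqx, hpq, hpA, hqA, hl, he⟩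
  · have hfa : f ∉ a.1 := fun h => hle (by
      show e.1 ⊆ a.1
      rw [hef]
      exact Finset.union_subset hxa.le (by simpa using h))
    refine hsingle f (by simp [hef]) hfa fun q hq => ?_
    simp only [hef, Finset.mem_union, Finset.mem_singleton] at hq
    exact hq.symm.imp_right fun h => hxa.le h
  · have hpe : p ∈ e.1 := by simp [he]
    have hqe : q ∈ e.1 := by simp [he]
    have hmem : ∀ t ∈ e.1, t = p ∨ t = q ∨ t ∈ a.1 := fun t ht => by
      simp only [he, Finset.mem_union, Finset.mem_insert, Finset.mem_singleton] at ht
      have : t ∈ x.1 → t ∈ a.1 := fun h => hxa.le h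
      tauto
    by_cases hpa : p ∈ a.1
    · by_cases hqa : q ∈ a.1
      · exact absurd (fun t ht => by rcases hmem t ht with rfl | rfl | h <;> assumption) hle
      · refine hsingle q hqe hqa fun t ht => ?_
        rcases hmem t ht with h | h | h
        · exact Or.inr (h ▸ hpa)
        · exact Or.inl h
        · exact Or.inr h
    · by_cases hqa : q ∈ a.1
      · refine hsingle p hpe hpa fun t ht => ?_
        rcases hmem t ht with h | h | h
        · exact Or.inl h
        · exact Or.inr (h ▸ hqa)
        · exact Or.inr h
      · obtain ⟨z, h1, h2, h3⟩ := hS.exists_cover_of_linked hay hua hva (hey hpe) (hey hqe) hpA hqA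
          hpq (hl.mono hxa.le) hpa hqa
        refine ⟨z, h1, h2, fun t ht => ?_⟩
        rw [h3]
        rcases hmem t ht with rfl | rfl | h <;> simp [*]

end BundleSystem

end OneBundle

/-! ### The ranking of covers for one bundle -/

section OneBundle

variable {X : Type*} [DecidableEq X] {adj : X → X → Prop} {A T B D : Finset X} {u v p q r s : X}

/-- The special steps with just one end of the bundle, in the absence of both. -/
lemma SpecialStep.oneEnd_or_bothEnds {x : Finset X} (h : SpecialStep adj A B u v x D) :
    (∃ r s, (r = u ∧ s = v ∨ r = v ∧ s = u) ∧ r ∉ x ∧ s ∉ x ∧ ((r ∉ A ∧ D = {r}) ∨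
      (r ∈ A ∧ ∃ c, c ∉ x ∧ c ≠ u ∧ c ≠ v ∧ c ∉ B ∧ LinkedOver adj x r c ∧ D = {r, c}))) ∨
      (u ∈ x ∪ D ∧ v ∈ x ∪ D) := by
  have hends : ∀ {r s}, (r = u ∧ s = v ∨ r = v ∧ s = u) → r ∈ x ∪ D → s ∈ x ∪ D →
      u ∈ x ∪ D ∧ v ∈ x ∪ D := by
    rintro r s (⟨rfl, rfl⟩ | ⟨rfl, rfl⟩) h1 h2 <;> exact ⟨by assumption, by assumption⟩
  cases h with
  | light r s hrs hr hs hrA => exact Or.inl ⟨r, s, hrs, hr, hs, Or.inl ⟨hrA, rfl⟩⟩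
  | pair r s c hrs hr hs hrA hc hcA hcu hcv hcB hl =>
    exact Or.inl ⟨r, s, hrs, hr, hs, Or.inr ⟨hrA, c, hc, hcu, hcv, hcB, hl, rfl⟩⟩
  | bothFree f hu hv huA hvA hf hfA => exact Or.inr ⟨by simp, by simp⟩
  | bothEdges e e' hu hv huA hvA he heA he' heA' hne => exact Or.inr ⟨by simp, by simp⟩
  | edge r s e hrs hr hs hrA he heA => exact Or.inr (hends hrs (by simp) (by simp [hs]))
  | vertexFree r s c f hrs hr hs hrA hc hcA hcu hcv hcB hl hf hfA =>
    exact Or.inr (hends hrs (by simp) (by simp [hs]))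
  | free r s f hrs hr hs hrA hf hfA => exact Or.inr (hends hrs (by simp) (by simp [hs]))
  | edges r s e e' hrs hr hs hrA he heA he' heA' hne =>
    exact Or.inr (hends hrs (by simp) (by simp [hs]))
  | vertexEdge r s c e hrs hr hs hrA hc hcA hcu hcv hcB hl he heA =>
    exact Or.inr (hends hrs (by simp) (by simp [hs]))

/-- The special steps that add an end of odd weight in the presence of the other end. -/
lemma SpecialStep.of_mem_weight {x : Finset X} (h : SpecialStep adj A B u v x D)
    (hrs : r = u ∧ s = v ∨ r = v ∧ s = u) (hs : s ∈ x) (hr : r ∉ x) (hrA : r ∈ A) :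
    D.card ≤ 2 ∨ ∃ c f, D = {r, c, f} ∧ c ∉ x ∧ c ∈ A ∧ c ≠ u ∧ c ≠ v ∧ c ∉ B ∧ f ∈ B ∧ f ∉ A ∧
      (LinkedOver adj x r c ∨ LinkedOver adj x s c) := by
  have hrs' : ∀ {r' s'}, (r' = u ∧ s' = v ∨ r' = v ∧ s' = u) → r' ∉ x → r' = r ∧ s' = s := by
    rintro r' s' (⟨rfl, rfl⟩ | ⟨rfl, rfl⟩) hr' <;> rcases hrs with ⟨rfl, rfl⟩ | ⟨rfl, rfl⟩
    · exact ⟨rfl, rfl⟩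
    · exact absurd hs hr'
    · exact absurd hs hr'
    · exact ⟨rfl, rfl⟩
  have hno : u ∉ x → v ∉ x → False := by
    rcases hrs with ⟨rfl, rfl⟩ | ⟨rfl, rfl⟩ <;> exact fun h1 h2 => by contradiction
  cases h with
  | light r' s' hrs hr hs hrA => exact Or.inl (by simp)
  | pair r' s' c hrs hr hs hrA hc hcA hcu hcv hcB hl => exact Or.inl Finset.card_le_two
  | bothFree f hu hv huA hvA hf hfA => exact (hno hu hv).elim
  | bothEdges e e' hu hv huA hvA he heA he' heA' hne => exact (hno hu hv).elim
  | edge r' s' e hrs hr hs hrA he heA => exact Or.inl Finset.card_le_two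
  | vertexFree r' s' c f hrs hr hs hrA hc hcA hcu hcv hcB hl hf hfA =>
    obtain ⟨rfl, rfl⟩ := hrs' hrs hr
    exact Or.inr ⟨c, f, rfl, hc, hcA, hcu, hcv, hcB, hf, hfA, hl⟩
  | free r' s' f hrs hr hs hrA' hf hfA => exact Or.inl Finset.card_le_two
  | edges r' s' e e' hrs hr hs hrA' he heA he' heA' hne =>
    obtain ⟨rfl, rfl⟩ := hrs' hrs hr
    exact absurd hrA hrA'
  | vertexEdge r' s' c e hrs hr hs hrA' hc hcA hcu hcv hcB hl he heA =>
    obtain ⟨rfl, rfl⟩ := hrs' hrs hr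
    exact absurd hrA hrA'

lemma SpecialStep.new_end {x z : Finset X} (h : SpecialStep adj A B u v x D) (hz : z = x ∪ D)
    (hD : IsStep adj A B u v x D) : (u ∈ z ∧ u ∉ x) ∨ (v ∈ z ∧ v ∉ x) := by
  have hend : ∀ {r s}, (r = u ∧ s = v ∨ r = v ∧ s = u) → r ∈ D → u ∈ D ∨ v ∈ D := by
    rintro r s (⟨rfl, rfl⟩ | ⟨rfl, rfl⟩) h
    · exact Or.inl h
    · exact Or.inr h
  have : u ∈ D ∨ v ∈ D := by
    cases h with
    | light r s hrs => exact hend hrs (by simp)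
    | pair r s c hrs => exact hend hrs (by simp)
    | bothFree f hu hv huA hvA hf hfA => simp
    | bothEdges e e' hu hv huA hvA he heA he' heA' hne => simp
    | edge r s e hrs => exact hend hrs (by simp)
    | vertexFree r s c f hrs => exact hend hrs (by simp)
    | free r s f hrs => exact hend hrs (by simp)
    | edges r s e e' hrs => exact hend hrs (by simp)
    | vertexEdge r s c e hrs => exact hend hrs (by simp)
  rw [hz]
  exact this.imp (fun h => ⟨Finset.mem_union_right _ h, Finset.disjoint_right.1 hD.disjoint h⟩)
    fun h => ⟨Finset.mem_union_right _ h, Finset.disjoint_right.1 hD.disjoint h⟩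

section Rank

variable {num : X → ℕ} {N : ℕ} {x a : Finset X}

lemma bundleRank_of_noNew (h : ¬ (u ∈ a \ x ∨ v ∈ a \ x)) : bundleRank A u v num N x a = N := by
  rw [bundleRank, if_neg h]

lemma bundleRank_of_card_le (h : u ∈ a \ x ∨ v ∈ a \ x) (hc : (a \ x).card ≤ 2) :
    bundleRank A u v num N x a = (a \ x).card := by
  rw [bundleRank, if_pos h, if_pos hc]

lemma le_bundleRank (h : u ∈ a \ x ∨ v ∈ a \ x) (hc : ¬ (a \ x).card ≤ 2) :
    3 ≤ bundleRank A u v num N x a := by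
  rw [bundleRank, if_pos h, if_neg hc]
  omega

lemma bundleRank_lt (haT : a ⊆ T) (hN : 3 + ∑ p ∈ T, num p < N) (h : u ∈ a \ x ∨ v ∈ a \ x) :
    bundleRank A u v num N x a < N := by
  rw [bundleRank, if_pos h]
  have : ∑ p ∈ (a \ x) \ A, num p ≤ ∑ p ∈ T, num p :=
    Finset.sum_le_sum_of_subset ((Finset.sdiff_subset.trans Finset.sdiff_subset).trans haT)
  split_ifs <;> omega

lemma bundleRank_triple {c f : X} (hr : r = u ∨ r = v) (h : a \ x = {r, c, f}) (hrA : r ∈ A)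
    (hcA : c ∈ A) (hfA : f ∉ A) (hrc : r ≠ c) : bundleRank A u v num N x a = 3 + num f := by
  have h1 : r ≠ f := fun h => hfA (h ▸ hrA)
  have h2 : c ≠ f := fun h => hfA (h ▸ hcA)
  have h3 : ({r, c, f} : Finset X) \ A = {f} := by
    ext z
    simp only [Finset.mem_sdiff, Finset.mem_insert, Finset.mem_singleton]
    constructor
    · rintro ⟨rfl | rfl | rfl, h'⟩
      · exact absurd hrA h'
      · exact absurd hcA h'
      · rfl
    · rintro rfl
      exact ⟨Or.inr (Or.inr rfl), hfA⟩
  have h4 : ({r, c, f} : Finset X).card = 3 := by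
    rw [Finset.card_insert_of_notMem (by simp [hrc, h1]), Finset.card_pair h2]
  rw [bundleRank, h, if_pos, if_neg (by omega), h3, Finset.sum_singleton]
  rcases hr with rfl | rfl <;> simp

end Rank

namespace BundleSystem

variable {x y a e z : EvenLegal adj A T B u v} {num : X → ℕ} {N : ℕ}

/-- If the cover `a` has just one end of the bundle, the earlier special covers are contained in all
sets above `a` with the other end. -/
lemma le_of_oneEnd (hS : BundleSystem adj A T B u v) (hxa : x ⋖ a) (hxe : x ⋖ e) (hea : e ≠ a)
    (hua : ¬ (u ∈ a.1 ∧ v ∈ a.1)) (ha : u ∈ a.1 \ x.1 ∨ v ∈ a.1 \ x.1)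
    (he : u ∈ e.1 \ x.1 ∨ v ∈ e.1 \ x.1)
    (hr : bundleRank A u v num N x.1 e.1 ≤ bundleRank A u v num N x.1 a.1) :
    ((u ∈ e.1 ∧ u ∉ a.1) ∨ (v ∈ e.1 ∧ v ∉ a.1)) ∧
      ∀ t : EvenLegal adj A T B u v, a ≤ t → (u ∈ t.1 ∧ u ∉ a.1) ∨ (v ∈ t.1 ∧ v ∉ a.1) →
        e ≤ t := by
  have hax : a.1 = x.1 ∪ (a.1 \ x.1) := (Finset.union_sdiff_of_subset hxa.le).symm
  have hex : e.1 = x.1 ∪ (e.1 \ x.1) := (Finset.union_sdiff_of_subset hxe.le).symm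
  have ha1 := (hS.specialStep_of_covBy hxa (by simpa using ha)).oneEnd_or_bothEnds
  have he1 := (hS.specialStep_of_covBy hxe (by simpa using he)).oneEnd_or_bothEnds
  rw [← hax] at ha1
  rw [← hex] at he1
  obtain ⟨r, s, hrs, hrx, hsx, ha2⟩ := ha1.resolve_right hua
  have hacard : (a.1 \ x.1).card ≤ 2 := by
    rcases ha2 with ⟨_, h⟩ | ⟨_, c, _, _, _, _, _, h⟩
    · simp [h]
    · rw [h]; exact Finset.card_le_two
  rw [bundleRank_of_card_le ha hacard] at hr
  have hecard : (e.1 \ x.1).card ≤ 2 := by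
    by_contra h
    have := le_bundleRank (A := A) (num := num) (N := N) he h
    omega
  rw [bundleRank_of_card_le he hecard] at hr
  have hux : u ∉ x.1 ∧ v ∉ x.1 := by
    rcases hrs with ⟨rfl, rfl⟩ | ⟨rfl, rfl⟩ <;> exact ⟨by assumption, by assumption⟩
  -- A cover of `x` with both ends would also need a bundle edge, hence at least three new elements,
  -- while the rank of `a` allows only two.
  have hue : ¬ (u ∈ e.1 ∧ v ∈ e.1) := by
    rintro ⟨h1, h2⟩
    obtain ⟨b, hb, hbB⟩ := e.2.legal.2 h1 h2
    have hbx := x.2.legal.notMem hbB (Or.inl hux.1)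
    have hsub : ({u, v, b} : Finset X) ⊆ e.1 \ x.1 := by
      simp [Finset.insert_subset_iff, hux, h1, h2, hb, hbx]
    have := Finset.card_le_card hsub
    rw [Finset.card_insert_of_notMem, Finset.card_pair] at this
    · omega
    · rintro rfl; exact hS.right_notMem hbB
    · simp only [Finset.mem_insert, Finset.mem_singleton, not_or]
      refine ⟨hS.ne (e.2.subset h1), ?_⟩
      rintro rfl; exact hS.left_notMem hbB
  obtain ⟨r', s', hrs', hrx', hsx', he2⟩ := he1.resolve_right hue
  have hraT : r ∈ a.1 \ x.1 := by
    rcases ha2 with ⟨_, h⟩ | ⟨_, c, _, _, _, _, _, h⟩ <;> rw [h] <;> simp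
  have hreT : r' ∈ e.1 \ x.1 := by
    rcases he2 with ⟨_, h⟩ | ⟨_, c, _, _, _, _, _, h⟩ <;> rw [h] <;> simp
  rw [Finset.mem_sdiff] at hraT hreT
  -- the two extra vertices agree
  have hcc : ∀ c c', c ∉ x.1 → c ≠ u → c ≠ v → c ∉ B → LinkedOver adj x.1 r c →
      c' ∉ x.1 → c' ≠ u → c' ≠ v → c' ∉ B → LinkedOver adj x.1 r' c' →
      a.1 \ x.1 = {r, c} → e.1 \ x.1 = {r', c'} → c = c' := by
    intro c c' h1 h2 h3 h4 h5 h1' h2' h3' h4' h5' ha he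
    have hca : c ∈ a.1 := (Finset.mem_sdiff.1 (ha ▸ (by simp : c ∈ ({r, c} : Finset X)))).1
    have hce : c' ∈ e.1 := (Finset.mem_sdiff.1 (he ▸ (by simp : c' ∈ ({r', c'} : Finset X)))).1
    exact hS.unique x.1 x.2 hux.1 hux.2 r r' c c' (hrs.imp And.left And.left)
      (hrs'.imp And.left And.left) (a.2.subset hraT.1) (e.2.subset hreT.1) (a.2.subset hca)
      (e.2.subset hce) h1 h1' h2 h3 h4 h2' h3' h4' h5 h5'
  -- If `a` and `e` added the same end, uniqueness of the linked vertex would make them equal.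
  have hr's : r' = s := by
    by_contra hne
    have hrr : r' = r := by
      rcases hrs with ⟨rfl, rfl⟩ | ⟨rfl, rfl⟩ <;> rcases hrs' with ⟨rfl, rfl⟩ | ⟨rfl, rfl⟩ <;>
        first | rfl | exact absurd rfl hne
    subst hrr
    refine hea (Subtype.ext ?_)
    rw [hax, hex]
    congr 1
    rcases ha2 with ⟨h1, h2⟩ | ⟨h1, c, h2, h3, h4, h5, h6, h7⟩ <;>
      rcases he2 with ⟨h1', h2'⟩ | ⟨h1', c', h2', h3', h4', h5', h6', h7'⟩
    · rw [h2, h2']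
    · exact absurd h1' h1
    · exact absurd h1 h1'
    · rw [h7, h7', hcc c c' h2 h3 h4 h5 h6 h2' h3' h4' h5' h6' h7 h7']
  subst hr's
  have hra' : r' ∉ a.1 := fun h => hua (by
    rcases hrs with ⟨rfl, rfl⟩ | ⟨rfl, rfl⟩
    · exact ⟨hraT.1, h⟩
    · exact ⟨h, hraT.1⟩)
  refine ⟨?_, fun t hat ht => ?_⟩
  · rcases hrs with ⟨rfl, rfl⟩ | ⟨rfl, rfl⟩
    · exact Or.inr ⟨hreT.1, hra'⟩
    · exact Or.inl ⟨hreT.1, hra'⟩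
  · have hr't : r' ∈ t.1 := by
      rcases hrs with ⟨rfl, rfl⟩ | ⟨rfl, rfl⟩
      · exact (ht.resolve_left fun h => h.2 hraT.1).1
      · exact (ht.resolve_right fun h => h.2 hraT.1).1
    show e.1 ⊆ t.1
    rw [hex]
    refine Finset.union_subset (hxa.le.trans hat) ?_
    -- The extra vertex of `e`, if there is one, is that of `a`. The bad case, in which only `e` has
    -- an extra vertex, is excluded because single elements are ranked before pairs.
    rcases ha2 with ⟨h1, h2⟩ | ⟨h1, c, h2, h3, h4, h5, h6, h7⟩ <;>
      rcases he2 with ⟨h1', h2'⟩ | ⟨h1', c', h2', h3', h4', h5', h6', h7'⟩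
    · rw [h2']; simpa using hr't
    · rw [h2, h7', Finset.card_singleton, Finset.card_pair] at hr
      · omega
      · rcases hrs' with ⟨rfl, rfl⟩ | ⟨rfl, rfl⟩
        · exact h3'.symm
        · exact h4'.symm
    · rw [h2']; simpa using hr't
    · rw [h7', ← hcc c c' h2 h3 h4 h5 h6 h2' h3' h4' h5' h6' h7 h7']
      have hca : c ∈ a.1 := (Finset.mem_sdiff.1 (h7 ▸ (by simp : c ∈ ({r, c} : Finset X)))).1
      simp [Finset.insert_subset_iff, hr't, hat hca]

/-- The exchange property at a cover with both ends of the bundle. -/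
lemma exchange_of_bothEnds (hS : BundleSystem adj A T B u v) (hnum : Set.InjOn num T)
    (hxa : x ⋖ a) (hxe : x ⋖ e) (hea : e ≠ a)
    (hua : u ∈ a.1) (hva : v ∈ a.1) (ha : u ∈ a.1 \ x.1 ∨ v ∈ a.1 \ x.1)
    (he : u ∈ e.1 \ x.1 ∨ v ∈ e.1 \ x.1)
    (hr : bundleRank A u v num N x.1 e.1 ≤ bundleRank A u v num N x.1 a.1)
    (hay : a ≤ y) (hey : e ≤ y) :
    ∃ z, a ⋖ z ∧ z ≤ y ∧ ∃ k, x ⋖ k ∧ k ≤ z ∧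
      (k = e ∨ bundleRank A u v num N x.1 k.1 < bundleRank A u v num N x.1 a.1) := by
  have hle : ¬ e ≤ a := fun h => hea ((hxa.eq_or_eq hxe.le h).resolve_left hxe.lt.ne')
  have hex : e.1 = x.1 ∪ (e.1 \ x.1) := (Finset.union_sdiff_of_subset hxe.le).symm
  have hSe := hS.specialStep_of_covBy hxe (by simpa using he)
  have hSa := hS.specialStep_of_covBy hxa (by simpa using ha)
  suffices h : (∃ z, a ⋖ z ∧ z ≤ y ∧ e ≤ z) ∨ ∃ z, a ⋖ z ∧ z ≤ y ∧ ∃ k, x ⋖ k ∧ k ≤ z ∧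
      bundleRank A u v num N x.1 k.1 < bundleRank A u v num N x.1 a.1 by
    rcases h with ⟨z, h1, h2, h3⟩ | ⟨z, h1, h2, k, h3, h4, h5⟩
    · exact ⟨z, h1, h2, e, hxe, h3, Or.inl rfl⟩
    · exact ⟨z, h1, h2, k, h3, h4, Or.inr h5⟩
  have hends : ∀ {r}, r = u ∨ r = v → r ∈ a.1 := by rintro r (rfl | rfl) <;> assumption
  obtain ⟨D, hD⟩ : ∃ D, D = e.1 \ x.1 := ⟨_, rfl⟩
  have hmemD : ∀ t ∈ e.1, t ∈ D ∨ t ∈ a.1 := fun t ht => by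
    by_cases htx : t ∈ x.1
    · exact Or.inr (hxa.le htx)
    · exact Or.inl (hD ▸ Finset.mem_sdiff.2 ⟨ht, htx⟩)
  have hDe : ∀ t ∈ D, t ∈ e.1 := fun t ht => by
    rw [hD] at ht
    exact (Finset.mem_sdiff.1 ht).1
  -- If `e` has at most one element, or one linked pair of odd weights, not in `a`, then a single
  -- cover of `a` inside `y` contains `e`. All kinds of special steps but one reduce to this.
  have hsingle : ∀ p ∈ D, (∀ q ∈ D, q = p ∨ q ∈ a.1) → ∃ z, a ⋖ z ∧ z ≤ y ∧ e ≤ z := by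
    intro p hp h
    have h' : ∀ q ∈ e.1, q = p ∨ q ∈ a.1 := fun q hq => (hmemD q hq).elim (h q) Or.inr
    have hpa : p ∉ a.1 := fun hpa => hle fun q hq => (h' q hq).elim (fun h => h ▸ hpa) id
    obtain ⟨z, h1, h2, h3⟩ := hS.exists_cover_of_mem hay (fun _ => hua) (fun _ => hva)
      (hey (hDe p hp)) hpa
    exact ⟨z, h1, h2, fun q hq => (h' q hq).elim (fun h => h ▸ h3) fun h => h1.le h⟩
  have hdouble : ∀ p ∈ D, ∀ q ∈ D, p ≠ q → p ∈ A → q ∈ A →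
      (LinkedOver adj x.1 u p ∨ LinkedOver adj x.1 v p) →
      (LinkedOver adj x.1 u q ∨ LinkedOver adj x.1 v q) →
      (∀ t ∈ D, t = p ∨ t = q ∨ t ∈ a.1) → ∃ z, a ⋖ z ∧ z ≤ y ∧ e ≤ z := by
    intro p hp q hq hpq hpA hqA hlp hlq h
    by_cases hpa : p ∈ a.1
    · refine hsingle q hq fun t ht => (h t ht).elim (fun h => Or.inr (h ▸ hpa)) id
    by_cases hqa : q ∈ a.1
    · exact hsingle p hp fun t ht => (h t ht).imp_right fun h => h.elim (fun h => h ▸ hqa) id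
    obtain ⟨z, h1, h2, h3⟩ := hS.exists_cover_of_linked hay (fun _ => hua) (fun _ => hva)
      (hey (hDe p hp)) (hey (hDe q hq)) hpA hqA hpq
      (hS.linkedOver_of_ends a.2.legal hua hva hpq hqa
        (hlp.imp (fun h => h.mono hxa.le) fun h => h.mono hxa.le)
        (hlq.imp (fun h => h.mono hxa.le) fun h => h.mono hxa.le)) hpa hqa
    refine ⟨z, h1, h2, fun t ht => ?_⟩
    show t ∈ z.1
    rw [h3]
    rcases hmemD t ht with ht | ht
    · rcases h t ht with rfl | rfl | h
      · simp
      · simp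
      · exact Finset.mem_union_left _ h
    · exact Finset.mem_union_left _ ht
  have hedge : ∀ {b}, b ∈ B → LinkedOver adj x.1 u b ∨ LinkedOver adj x.1 v b := fun hb =>
    Or.inl (linkedOver_of_adj (hS.symm _ _ (hS.adj_left _ hb)))
  have hlink : ∀ {r s c}, (r = u ∧ s = v ∨ r = v ∧ s = u) →
      (LinkedOver adj x.1 r c ∨ LinkedOver adj x.1 s c) →
      (LinkedOver adj x.1 u c ∨ LinkedOver adj x.1 v c) := by
    rintro r s c (⟨rfl, rfl⟩ | ⟨rfl, rfl⟩) h
    · exact h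
    · exact h.symm
  rw [← hD] at hSe
  cases hSe with
  | light r s hrs hr hs hrA =>
    exact Or.inl (hsingle r (by simp) (by simp))
  | pair r s c hrs hr hs hrA hc hcA hcu hcv hcB hl =>
    refine Or.inl (hsingle c (by simp) fun t ht => ?_)
    simp only [Finset.mem_insert, Finset.mem_singleton] at ht
    rcases ht with h | h
    · exact Or.inr (h ▸ hends (hrs.imp And.left And.left))
    · exact Or.inl h
  | bothFree f hu hv huA hvA hf hfA =>
    refine Or.inl (hsingle f (by simp) fun t ht => ?_)
    simp only [Finset.mem_insert, Finset.mem_singleton] at ht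
    rcases ht with rfl | rfl | h
    · exact Or.inr hua
    · exact Or.inr hva
    · exact Or.inl h
  | bothEdges e e' hu hv huA hvA he heA he' heA' hne =>
    refine Or.inl (hdouble e (by simp) e' (by simp) hne heA heA' (hedge he) (hedge he')
      fun t ht => ?_)
    simp only [Finset.mem_insert, Finset.mem_singleton] at ht
    rcases ht with rfl | rfl | h | h
    · exact Or.inr (Or.inr hua)
    · exact Or.inr (Or.inr hva)
    · exact Or.inl h
    · exact Or.inr (Or.inl h)
  | edge r s e hrs hr hs hrA he heA =>
    refine Or.inl (hsingle e (by simp) fun t ht => ?_)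
    simp only [Finset.mem_insert, Finset.mem_singleton] at ht
    rcases ht with h | h
    · exact Or.inr (h ▸ hends (hrs.imp And.left And.left))
    · exact Or.inl h
  | free r s f hrs hr hs hrA hf hfA =>
    refine Or.inl (hsingle f (by simp) fun t ht => ?_)
    simp only [Finset.mem_insert, Finset.mem_singleton] at ht
    rcases ht with h | h
    · exact Or.inr (h ▸ hends (hrs.imp And.left And.left))
    · exact Or.inl h
  | edges r s e e' hrs hr hs hrA he heA he' heA' hne =>
    refine Or.inl (hdouble e (by simp) e' (by simp) hne heA heA' (hedge he) (hedge he')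
      fun t ht => ?_)
    simp only [Finset.mem_insert, Finset.mem_singleton] at ht
    rcases ht with h | h | h
    · exact Or.inr (Or.inr (h ▸ hends (hrs.imp And.left And.left)))
    · exact Or.inl h
    · exact Or.inr (Or.inl h)
  | vertexEdge r s c e hrs hr hs hrA hc hcA hcu hcv hcB hl he heA =>
    refine Or.inl (hdouble c (by simp) e (by simp) (fun h => hcB (h ▸ he)) hcA heA (hlink hrs hl)
      (hedge he) fun t ht => ?_)
    simp only [Finset.mem_insert, Finset.mem_singleton] at ht
    rcases ht with h | h | h
    · exact Or.inr (Or.inr (h ▸ hends (hrs.imp And.left And.left)))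
    · exact Or.inl h
    · exact Or.inr (Or.inl h)
  | vertexFree r s c f hrs hrx hs hrA hc hcA hcu hcv hcB hl hf hfA =>
    have hr' : r = u ∨ r = v := hrs.imp And.left And.left
    have hrne : ∀ c, c ≠ u → c ≠ v → r ≠ c := fun c h1 h2 h => by
      rcases hr' with h' | h'
      · exact h1 (h ▸ h')
      · exact h2 (h ▸ h')
    by_cases hca : c ∈ a.1
    · refine Or.inl (hsingle f (by simp) fun t ht => ?_)
      simp only [Finset.mem_insert, Finset.mem_singleton] at ht
      rcases ht with h | h | h
      · exact Or.inr (h ▸ hends hr')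
      · exact Or.inr (h ▸ hca)
      · exact Or.inl h
    by_cases hfa : f ∈ a.1
    · refine Or.inl (hsingle c (by simp) fun t ht => ?_)
      simp only [Finset.mem_insert, Finset.mem_singleton] at ht
      rcases ht with h | h | h
      · exact Or.inr (h ▸ hends hr')
      · exact Or.inl h
      · exact Or.inr (h ▸ hfa)
    -- Here neither `c` nor the edge `f` of even weight is in `a`, and adding both may take more
    -- than one cover. The rank forces `a` to be of the same kind, with `c'` and `f'`, and `num f <
    -- num f'`. A cover of `a` containing `f` then also contains the earlier set `{r, c', f}` over
    -- `x`; this is why triples are ranked by their edge.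
    refine Or.inr ?_
    rw [bundleRank_triple hr' hD.symm hrA hcA hfA (hrne c hcu hcv)] at hr
    rcases hSa.of_mem_weight hrs hs hrx hrA with hcard |
      ⟨c', f', hac, hcx', hcA', hcu', hcv', hcB', hfB', hfA', hl'⟩
    · rw [bundleRank_of_card_le ha hcard] at hr
      omega
    have hfx : f ∉ x.1 := fun h => hfa (hxa.le h)
    have hf'a : f' ∈ a.1 := (Finset.mem_sdiff.1 (hac ▸ (by simp) : f' ∈ a.1 \ x.1)).1
    have hc'a : c' ∈ a.1 := (Finset.mem_sdiff.1 (hac ▸ (by simp) : c' ∈ a.1 \ x.1)).1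
    rw [bundleRank_triple hr' hac hrA hcA' hfA' (hrne c' hcu' hcv')] at hr ⊢
    have hfy : f ∈ y.1 := hey (hDe f (by simp))
    obtain ⟨z, h1, h2, h3⟩ := hS.exists_cover_of_mem hay (fun _ => hua) (fun _ => hva) hfy hfa
    have hkz : ({r, c', f} : Finset X) ⊆ z.1 := by
      simp only [Finset.insert_subset_iff, Finset.singleton_subset_iff]
      exact ⟨h1.le (hends hr'), h1.le hc'a, h3⟩
    have hstep := (SpecialStep.vertexFree (adj := adj) r s c' f hrs hrx hs hrA hcx' hcA' hcu' hcv'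
      hcB' hl' hf hfA).isStep hS x.2 (hkz.trans z.2.subset)
    obtain ⟨k, hk1, hk2, hk3⟩ := hS.exists_cover hstep (hxa.le.trans h1.le) hkz
    refine ⟨z, h1, h2, k, hk1, hk2, ?_⟩
    rw [bundleRank_triple hr' (sdiff_eq_of_eq_union hk3 hstep) hrA hcA' hfA (hrne c' hcu' hcv')]
    have hne : num f ≠ num f' := fun h => by
      have := hnum (Finset.mem_coe.2 (y.2.subset hfy)) (Finset.mem_coe.2 (a.2.subset hf'a)) h
      exact hfa (this ▸ hf'a)
    omega

/-- If neither `a` nor `y` adds an end to `x`, the exchange is semimodularity. If `a` adds none but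
`y` does, then some cover of `a` adds an end, and below it there is a cover of `x` with an end,
which is ranked earlier than `a`. If `a` adds just one end, every earlier cover lies below every
larger set with the other end. If `a` contains both ends after adding one, the exchange is done by
cases. For `compat`, a cover `b` ranked strictly before another one must add an end, so the same
arguments put an earlier cover of `x` below `b`. -/
lemma isAtomRanking (hS : BundleSystem adj A T B u v) (hnum : Set.InjOn num T)
    (hN : 3 + ∑ p ∈ T, num p < N) :
    IsAtomRanking fun x a : EvenLegal adj A T B u v => bundleRank A u v num N x.1 a.1 where
  exchange {x a e y} hxa hxe hea hr hay hey := by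
    by_cases ha : u ∈ a.1 \ x.1 ∨ v ∈ a.1 \ x.1
    · have he : u ∈ e.1 \ x.1 ∨ v ∈ e.1 \ x.1 := by
        by_contra he
        have := bundleRank_lt (A := A) a.2.subset hN ha
        rw [bundleRank_of_noNew he] at hr
        omega
      by_cases hua : u ∈ a.1 ∧ v ∈ a.1
      · exact hS.exchange_of_bothEnds hnum hxa hxe hea hua.1 hua.2 ha he hr hay hey
      · obtain ⟨h1, h2⟩ := hS.le_of_oneEnd hxa hxe hea hua ha he hr
        obtain ⟨z, D, h3, h4, h5, h6, h7⟩ := hS.exists_special_cover hay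
          (h1.imp (fun h => ⟨hey h.1, h.2⟩) fun h => ⟨hey h.1, h.2⟩)
        exact ⟨z, h3, h4, e, hxe, h2 z h3.le (h6.new_end h5 h7), Or.inl rfl⟩
    · have hra := bundleRank_of_noNew (A := A) (num := num) (N := N) ha
      by_cases hy : u ∈ y.1 \ x.1 ∨ v ∈ y.1 \ x.1
      · have hax : (u ∈ a.1 → u ∈ x.1) ∧ (v ∈ a.1 → v ∈ x.1) := by
          simpa only [Finset.mem_sdiff, not_or, not_and, not_not] using ha
        simp only [Finset.mem_sdiff] at hy
        obtain ⟨z, D, h3, h4, h5, h6, h7⟩ := hS.exists_special_cover hay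
          (hy.imp (fun h => ⟨h.1, fun h' => h.2 (hax.1 h')⟩)
            fun h => ⟨h.1, fun h' => h.2 (hax.2 h')⟩)
        obtain ⟨k, D', k3, k4, k5, k6, k7⟩ := hS.exists_special_cover (hxa.le.trans h3.le)
          ((h6.new_end h5 h7).imp (fun h => ⟨h.1, fun h' => h.2 (hxa.le h')⟩)
            fun h => ⟨h.1, fun h' => h.2 (hxa.le h')⟩)
        refine ⟨z, h3, h4, k, k3, k4, Or.inr ?_⟩
        rw [hra]
        exact bundleRank_lt k.2.subset hN (by simpa using k6.new_end k5 k7)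
      · simp only [Finset.mem_sdiff, not_or, not_and, not_not] at hy
        obtain ⟨z, h1, h2, h3⟩ := hS.exists_join_of_noNew hxa hxe hea hay hey hy.1 hy.2
        exact ⟨z, h1, h2, e, hxe, h3, Or.inl rfl⟩
  compat {x a e b b'} hxa hxe hea hr hab hab' heb' hlt := by
    have hb : u ∈ b.1 \ a.1 ∨ v ∈ b.1 \ a.1 := by
      by_contra hb
      simp only [bundleRank_of_noNew hb] at hlt
      by_cases hb' : u ∈ b'.1 \ a.1 ∨ v ∈ b'.1 \ a.1
      · exact absurd (bundleRank_lt (A := A) b'.2.subset hN hb') (by omega)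
      · rw [bundleRank_of_noNew hb'] at hlt
        omega
    have hb1 : (u ∈ b.1 ∧ u ∉ a.1) ∨ (v ∈ b.1 ∧ v ∉ a.1) := by simpa using hb
    by_cases ha : u ∈ a.1 \ x.1 ∨ v ∈ a.1 \ x.1
    · have he : u ∈ e.1 \ x.1 ∨ v ∈ e.1 \ x.1 := by
        by_contra he
        have := bundleRank_lt (A := A) a.2.subset hN ha
        simp only [bundleRank_of_noNew he] at hr
        omega
      have hua : ¬ (u ∈ a.1 ∧ v ∈ a.1) := fun h => hb1.elim (fun h' => h'.2 h.1) fun h' => h'.2 h.2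
      exact ⟨e, hxe, (hS.le_of_oneEnd hxa hxe hea hua ha he hr).2 b hab.le hb1, Or.inl rfl⟩
    · obtain ⟨k, D', k3, k4, k5, k6, k7⟩ := hS.exists_special_cover (hxa.le.trans hab.le)
        (hb1.imp (fun h => ⟨h.1, fun h' => h.2 (hxa.le h')⟩)
          fun h => ⟨h.1, fun h' => h.2 (hxa.le h')⟩)
      refine ⟨k, k3, k4, Or.inr ?_⟩
      simp only [bundleRank_of_noNew ha]
      exact bundleRank_lt k.2.subset hN (by simpa using k6.new_end k5 k7)

theorem hasAtomRanking (hS : BundleSystem adj A T B u v) :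
    HasAtomRanking (EvenLegal adj A T B u v) := by
  obtain ⟨num, hnum⟩ := Set.countable_iff_exists_injOn.1 T.countable_toSet
  exact ⟨_, hS.isAtomRanking hnum (Nat.lt_succ_self _)⟩

end BundleSystem

end OneBundle

/-! ### The poset of even subgraphs as a poset of sets -/

namespace Graph

open Relation

variable {α β : Type*} {G H I J K : Graph α β} {A : Set (α ⊕ β)} {a b : α} {e f : β}

/-- Adjacency and incidence of vertices and edges. -/
def elemAdj (H : Graph α β) : α ⊕ β → α ⊕ β → Prop
  | .inl a, .inl b => H.Adj a b
  | .inl a, .inr e => H.Inc e a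
  | .inr e, .inl a => H.Inc e a
  | .inr _, .inr _ => False

/-- The sets of vertices and multiple edges that come from semi-induced subgraphs. -/
def LegalSet (H : Graph α β) (S : Finset (α ⊕ β)) : Prop :=
  (∀ e a, Sum.inr e ∈ S → H.Inc e a → Sum.inl a ∈ S) ∧
    ∀ e a b, H.IsMultipleEdge e → H.IsLink e a b → Sum.inl a ∈ S → Sum.inl b ∈ S →
      ∃ f, Sum.inr f ∈ S ∧ H.IsLink f a b

lemma elemAdj_symm (H : Graph α β) : ∀ p q, H.elemAdj p q → H.elemAdj q p
  | .inl _, .inl _, h => Adj.symm h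
  | .inl _, .inr _, h => h
  | .inr _, .inl _, h => h

@[simp] lemma inl_mem_elements : Sum.inl a ∈ I.elements ↔ a ∈ V(I) := by simp [elements]

@[simp] lemma inr_mem_elements : Sum.inr e ∈ I.elements ↔ e ∈ E(I) := by simp [elements]

@[simp] lemma inl_mem_collection : Sum.inl a ∈ I.collection ↔ a ∈ V(I) := by simp [collection]

@[simp] lemma inr_mem_collection : Sum.inr e ∈ I.collection ↔ I.IsMultipleEdge e := by
  simp [collection]

lemma IsMultipleEdge.mem (h : H.IsMultipleEdge e) : e ∈ E(H) := by
  obtain ⟨_, _, _, _, h, _⟩ := h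
  exact h.edge_mem

lemma IsMultipleEdge.of_isLink (h : H.IsMultipleEdge e) (he : H.IsLink e a b)
    (hf : H.IsLink f a b) : H.IsMultipleEdge f := by
  obtain ⟨e', hne, x, y, h1, h2⟩ := h
  by_cases hfe : f = e
  · exact hfe ▸ ⟨e', hne, x, y, h1, h2⟩
  · exact ⟨e, fun h => hfe h.symm, a, b, hf, he⟩

lemma IsMultipleEdge.mono (hHG : H ≤ G) (h : H.IsMultipleEdge e) : G.IsMultipleEdge e := by
  obtain ⟨e', hne, x, y, h1, h2⟩ := h
  exact ⟨e', hne, x, y, h1.mono hHG, h2.mono hHG⟩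

lemma elements_mono (h : I ≤ J) : I.elements ⊆ J.elements := by
  rintro (a | e) hp
  · simpa using h.vertexSet_mono (by simpa using hp)
  · simpa using h.edgeSet_mono (by simpa using hp)

lemma finite_collection (hV : V(H).Finite) (hE : E(H).Finite) : H.collection.Finite :=
  (hV.image _).union ((hE.subset fun _ he => IsMultipleEdge.mem he).image _)

/-! #### Components -/

lemma induce_isClosedSubgraph {W : Set α} (hW : W ⊆ V(I)) (h : ∀ a ∈ W, ∀ b, I.Adj a b → b ∈ W) :
    I.induce W ≤c I :=
  IsClosedSubgraph.mk' (induce_le hW) fun e x ⟨y, hxy⟩ hx =>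
    (show (I.induce W).IsLink e x y from ⟨hxy, hx, h x hx y hxy.adj⟩).edge_mem

lemma reflTransGen_mem (ha : a ∈ V(I)) (h : ReflTransGen I.Adj a b) : b ∈ V(I) := by
  induction h with
  | refl => exact ha
  | tail _ h _ => exact h.right_mem

lemma reflTransGen_symm (h : ReflTransGen I.Adj a b) : ReflTransGen I.Adj b a := by
  induction h with
  | refl => exact .refl
  | tail _ h ih => exact .head h.symm ih

lemma isComponent_induce (ha : a ∈ V(I)) :
    (I.induce {b | ReflTransGen I.Adj a b}).IsComponent I := by
  refine ⟨induce_isClosedSubgraph (fun b hb => reflTransGen_mem ha hb) fun b hb c hbc => hb.tail hbc,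
    ⟨a, ReflTransGen.refl⟩, fun x hx y hy => ?_⟩
  have key : ∀ z, ReflTransGen I.Adj a z →
      ReflTransGen (I.induce {b | ReflTransGen I.Adj a b}).Adj a z := by
    intro z hz
    induction hz with
    | refl => exact .refl
    | tail h1 h2 ih =>
      obtain ⟨e, he⟩ := h2
      exact ih.tail ⟨e, he, h1, h1.tail he.adj⟩
  exact (reflTransGen_symm (key x hx)).trans (key y hy)

lemma IsComponent.mem_of_reflTransGen (hK : K.IsComponent I) (ha : a ∈ V(K))
    (h : ReflTransGen I.Adj a b) : b ∈ V(K) := by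
  induction h with
  | refl => exact ha
  | tail _ h ih => exact (hK.1.mem_iff_of_adj h).1 ih

/-- The semi-induced subgraph with given vertices and multiple edges. -/
def ofSet (H : Graph α β) (S : Finset (α ⊕ β)) : Graph α β where
  vertexSet := {a | Sum.inl a ∈ S}
  IsLink e x y := H.IsLink e x y ∧ Sum.inl x ∈ S ∧ Sum.inl y ∈ S ∧
    (H.IsMultipleEdge e → Sum.inr e ∈ S)
  isLink_symm := fun _ _ => ⟨fun _ _ h => ⟨h.1.symm, h.2.2.1, h.2.1, h.2.2.2⟩⟩
  eq_or_eq_of_isLink_of_isLink := fun _ _ _ _ _ h h' => h.1.left_eq_or_eq h'.1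
  left_mem_of_isLink := fun _ _ _ h => h.2.1

lemma isSemiInduced_ofSet {S : Finset (α ⊕ β)} (hS : ∀ p ∈ S, p ∈ H.collection)
    (hleg : H.LegalSet S) :
    (H.ofSet S).IsSemiInduced H := by
  refine ⟨⟨fun a ha => by simpa using hS _ ha, fun _ _ _ h => h.1⟩, fun x hx y hy ⟨e, he⟩ => ?_⟩
  by_cases hm : H.IsMultipleEdge e
  · obtain ⟨f, hfS, hf⟩ := hleg.2 e x y hm he hx hy
    exact ⟨f, hf, hx, hy, fun _ => hfS⟩
  · exact ⟨e, he, hx, hy, fun h => absurd h hm⟩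

lemma mem_ofSet {S : Finset (α ⊕ β)} (hS : ∀ p ∈ S, p ∈ H.collection)
    (hleg : H.LegalSet S) (p : α ⊕ β) :
    p ∈ S ↔ p ∈ (H.ofSet S).elements ∧ p ∈ H.collection := by
  match p with
  | .inl a => exact ⟨fun h => ⟨inl_mem_elements.2 h, hS _ h⟩, fun h => inl_mem_elements.1 h.1⟩
  | .inr e =>
    refine ⟨fun h => ⟨?_, hS _ h⟩, fun ⟨h1, h2⟩ => ?_⟩
    · obtain ⟨x, y, hxy⟩ := exists_isLink_of_mem_edgeSet
        (IsMultipleEdge.mem (by simpa using hS _ h) : e ∈ E(H))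
      rw [inr_mem_elements]
      exact IsLink.edge_mem (x := x) (y := y) ⟨hxy, hleg.1 e x h hxy.inc_left,
        hleg.1 e y h hxy.inc_right, fun _ => h⟩
    · rw [inr_mem_elements] at h1
      obtain ⟨x, y, hxy⟩ := exists_isLink_of_mem_edgeSet h1
      exact hxy.2.2.2 (by simpa using h2)

lemma IsSemiInduced.legalSet (hI : I.IsSemiInduced H) {S : Finset (α ⊕ β)}
    (hS : ∀ p, p ∈ S ↔ p ∈ I.elements ∧ p ∈ H.collection) : H.LegalSet S := by
  refine ⟨fun e a he ha => ?_, fun e a b hm he ha hb => ?_⟩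
  · have heI : e ∈ E(I) := by simpa using ((hS _).1 he).1
    have := ((hI.1.inc_congr heI).2 ha).vertex_mem
    exact (hS _).2 ⟨by simpa using this, by simpa using hI.1.vertexSet_mono this⟩
  · obtain ⟨f, hf⟩ := hI.2 a (by simpa using ((hS _).1 ha).1) b (by simpa using ((hS _).1 hb).1)
      he.adj
    exact ⟨f, (hS _).2 ⟨by simpa using hf.edge_mem,
      by simpa using hm.of_isLink he (hf.mono hI.1)⟩, hf.mono hI.1⟩

variable [DecidableEq (α ⊕ β)]

/-- Evenness of a semi-induced subgraph in terms of its vertices and multiple edges. -/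
lemma IsSemiInduced.isEven_iff (hI : I.IsSemiInduced H) {S A' : Finset (α ⊕ β)}
    (hS : ∀ p, p ∈ S ↔ p ∈ I.elements ∧ p ∈ H.collection) (hA : A ⊆ H.collection)
    (hA' : ∀ p, p ∈ A' ↔ p ∈ A) : I.IsEven A ↔ EvenOn H.elemAdj A' S := by
  classical
  have hvS : ∀ a, Sum.inl a ∈ S ↔ a ∈ V(I) := fun a => by
    rw [hS]
    simpa using fun h => hI.1.vertexSet_mono h
  have heS : ∀ e, Sum.inr e ∈ S → e ∈ E(I) := fun e he => by simpa using ((hS _).1 he).1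
  have hclosed : ∀ K : Graph α β, K.IsComponent I →
      ClosedIn H.elemAdj S (S.filter (· ∈ K.elements)) := by
    intro K hK
    refine ⟨Finset.filter_subset _ _, fun p hp q hq hpq => ?_⟩
    rw [Finset.mem_filter] at hp ⊢
    refine ⟨hq, ?_⟩
    obtain ⟨hpS, hpK⟩ := hp
    match p, q, hpq with
    | .inl a, .inl b, hpq =>
      simp only [inl_mem_elements] at hpK ⊢
      exact (hK.1.mem_iff_of_adj (hI.2 a ((hvS a).1 hpS) b ((hvS b).1 hq) hpq)).1 hpK
    | .inl a, .inr e, hpq =>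
      simp only [inl_mem_elements, inr_mem_elements] at hpK ⊢
      exact hK.1.closed ((hI.1.inc_congr (heS e hq)).2 hpq) hpK
    | .inr e, .inl a, hpq =>
      simp only [inl_mem_elements, inr_mem_elements] at hpK ⊢
      have h1 : I.Inc e a := (hI.1.inc_congr (heS e hpS)).2 hpq
      exact ((hK.1.le.inc_congr hpK).2 h1).vertex_mem
  have hcard : ∀ K : Graph α β, K.IsComponent I →
      (K.elements ∩ A).ncard = (S.filter (· ∈ K.elements) ∩ A').card := by
    intro K hK
    rw [← Set.ncard_coe_finset]
    congr 1
    ext p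
    simp only [Finset.coe_inter, Finset.coe_filter, Set.mem_inter_iff, Set.mem_ofPred_eq,
      Finset.mem_coe, hA', hS]
    exact ⟨fun h => ⟨⟨⟨elements_mono hK.1.le h.1, hA h.2⟩, h.1⟩, h.2⟩, fun h => ⟨h.1.2, h.2⟩⟩
  -- A union of components is treated by splitting off graph components one at a time. A nonempty
  -- one contains a vertex, because an edge is adjacent to its ends.
  refine ⟨fun h C hC => ?_, fun h K hK => ?_⟩
  · induction C using Finset.strongInduction with
    | H C ih =>
    rcases C.eq_empty_or_nonempty with rfl | ⟨p, hp⟩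
    · simp
    obtain ⟨a, haC⟩ : ∃ a, Sum.inl a ∈ C := by
      match p, hp with
      | .inl a, hp => exact ⟨a, hp⟩
      | .inr e, hp =>
        obtain ⟨x, y, hxy⟩ := exists_isLink_of_mem_edgeSet (heS e (hC.1 hp))
        exact ⟨x, hC.mem hp ((hvS x).2 hxy.left_mem) (hxy.mono hI.1).inc_left⟩
    have haI : a ∈ V(I) := (hvS a).1 (hC.1 haC)
    have hK := isComponent_induce haI
    set K := I.induce {b | ReflTransGen I.Adj a b} with hKdef
    set D := S.filter (· ∈ K.elements) with hD
    have hvC : ∀ b ∈ V(K), Sum.inl b ∈ C := by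
      intro b (hb : ReflTransGen I.Adj a b)
      induction hb with
      | refl => exact haC
      | tail _ h ih => exact hC.mem ih ((hvS _).2 h.right_mem) (h.mono hI.1)
    have hDC : D ⊆ C := by
      intro q hq
      rw [hD, Finset.mem_filter] at hq
      match q, hq with
      | .inl b, hq => exact hvC b (by simpa using hq.2)
      | .inr e, hq =>
        obtain ⟨x, y, hxy⟩ := exists_isLink_of_mem_edgeSet (show e ∈ E(K) by simpa using hq.2)
        exact hC.mem (hvC x hxy.left_mem) hq.1 ((hxy.mono hK.1.le).mono hI.1).inc_left
    have hDcl := hclosed K hK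
    have haD : Sum.inl a ∈ D := by
      rw [hD, Finset.mem_filter]
      exact ⟨hC.1 haC, inl_mem_elements.2 (ReflTransGen.refl : ReflTransGen I.Adj a a)⟩
    have h1 : Even (D ∩ A').card := by
      rw [← hcard K hK]
      exact h K hK
    have hCD : ClosedIn H.elemAdj S (C \ D) := by
      have := hDcl.sdiff H.elemAdj_symm
      refine ⟨Finset.sdiff_subset.trans hC.1, fun p hp q hq hpq => ?_⟩
      rw [Finset.mem_sdiff] at hp ⊢
      exact ⟨hC.mem hp.1 hq hpq, (Finset.mem_sdiff.1 (this.mem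
        (Finset.mem_sdiff.2 ⟨hC.1 hp.1, hp.2⟩) hq hpq)).2⟩
    have h2 := ih (C \ D) (Finset.ssubset_iff_subset_ne.2 ⟨Finset.sdiff_subset, fun h =>
      (Finset.mem_sdiff.1 (h ▸ haC)).2 haD⟩) hCD
    rw [card_inter_eq_add A' C D, Finset.inter_eq_right.2 hDC]
    exact h1.add h2
  · rw [hcard K hK]
    exact h _ (hclosed K hK)

/-- The legal even subsets of `T`. -/
abbrev LegalEven (H : Graph α β) (A T : Finset (α ⊕ β)) : Type _ :=
  {S : Finset (α ⊕ β) // S ⊆ T ∧ H.LegalSet S ∧ EvenOn H.elemAdj A S}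

/-- The poset of even subgraphs as a poset of sets. -/
noncomputable def evenPosetIso {A' T : Finset (α ⊕ β)} (hT : ∀ p, p ∈ T ↔ p ∈ H.collection)
    (hA : A ⊆ H.collection) (hA' : ∀ p, p ∈ A' ↔ p ∈ A) : H.EvenPoset A ≃o H.LegalEven A' T := by
  classical
  have hmem : ∀ (I : Graph α β) (p : α ⊕ β), p ∈ T.filter (· ∈ I.elements) ↔
      p ∈ I.elements ∧ p ∈ H.collection := fun I p => by rw [Finset.mem_filter, hT, and_comm]
  have hcol : ∀ S : H.LegalEven A' T, ∀ p ∈ S.1, p ∈ H.collection := fun S p hp =>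
    (hT p).1 (S.2.1 hp)
  let toSet : H.EvenPoset A → H.LegalEven A' T := fun I => ⟨T.filter (· ∈ I.1.elements),
    Finset.filter_subset _ _, I.2.1.legalSet (hmem I.1),
    (I.2.1.isEven_iff (hmem I.1) hA hA').1 I.2.2⟩
  let toGraph : H.LegalEven A' T → H.EvenPoset A := fun S =>
    ⟨H.ofSet S.1, isSemiInduced_ofSet (hcol S) S.2.2.1,
      ((isSemiInduced_ofSet (hcol S) S.2.2.1).isEven_iff (mem_ofSet (hcol S) S.2.2.1) hA hA').2
        S.2.2.2⟩
  have hmono : Monotone toGraph := fun S S' h =>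
    ⟨fun a ha => h ha, fun e x y ⟨h1, h2, h3, h4⟩ => ⟨h1, h h2, h h3, fun hm => h (h4 hm)⟩⟩
  have hmono' : Monotone toSet := fun I J h p hp => by
    rw [Finset.mem_filter] at hp ⊢
    exact ⟨hp.1, elements_mono h hp.2⟩
  have hleft : ∀ I, toGraph (toSet I) = I := by
    rintro ⟨I, hI, hev⟩
    refine Subtype.ext (Graph.ext ?_ fun e x y => ?_)
    · ext a
      show Sum.inl a ∈ T.filter (· ∈ I.elements) ↔ _
      rw [hmem]
      simpa using fun h => hI.1.vertexSet_mono h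
    · show (H.IsLink e x y ∧ Sum.inl x ∈ T.filter (· ∈ I.elements) ∧
        Sum.inl y ∈ T.filter (· ∈ I.elements) ∧
        (H.IsMultipleEdge e → Sum.inr e ∈ T.filter (· ∈ I.elements))) ↔ _
      simp only [hmem, inl_mem_elements, inr_mem_elements, inl_mem_collection, inr_mem_collection]
      refine ⟨fun ⟨h1, h2, h3, h4⟩ => ?_, fun h => ⟨h.mono hI.1,
        ⟨h.left_mem, hI.1.vertexSet_mono h.left_mem⟩,
        ⟨h.right_mem, hI.1.vertexSet_mono h.right_mem⟩, fun hm => ⟨h.edge_mem, hm⟩⟩⟩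
      -- An edge that is not multiple is the only edge of `H` between its ends, so a semi-induced
      -- subgraph containing both ends must contain it. Hence vertices and multiple edges determine
      -- the subgraph.
      by_cases hm : H.IsMultipleEdge e
      · exact (hI.1.isLink_iff (h4 hm).1).2 h1
      · obtain ⟨f, hf⟩ := hI.2 x h2.1 y h3.1 h1.adj
        by_cases hfe : f = e
        · exact hfe ▸ hf
        · exact absurd ⟨f, hfe, x, y, h1, hf.mono hI.1⟩ hm
  have hright : ∀ S, toSet (toGraph S) = S := fun S => Subtype.ext (Finset.ext fun p =>
    (hmem _ p).trans (mem_ofSet (hcol S) S.2.2.1 p).symm)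
  exact
    { toFun := toSet
      invFun := toGraph
      left_inv := hleft
      right_inv := hright
      map_rel_iff' := fun {I J} => ⟨fun h => by
        have h' : toGraph (toSet I) ≤ toGraph (toSet J) := hmono h
        rwa [hleft, hleft] at h', fun h => hmono' h⟩ }

end Graph

/-! ### Sufficiency -/

namespace Graph

open Relation

/-- For sets of vertices, adjacency of elements is adjacency in the graph. This translates
components and links between the two settings. -/
lemma closedIn_map {α β : Type*} {H : Graph α β} {x : Finset (α ⊕ β)} {W : Finset α}
    (hx : ∀ p, p ∈ x ↔ ∃ a ∈ W, p = Sum.inl a) {C : Finset α} (hC : ClosedIn H.Adj W C) :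
    ClosedIn H.elemAdj x (C.map Function.Embedding.inl) := by
  refine ⟨fun p hp => ?_, fun p hp q hq hpq => ?_⟩
  · obtain ⟨a, ha, rfl⟩ := Finset.mem_map.1 hp
    exact (hx _).2 ⟨a, hC.1 ha, rfl⟩
  · obtain ⟨a, ha, rfl⟩ := Finset.mem_map.1 hp
    obtain ⟨b, hb, rfl⟩ := (hx _).1 hq
    exact Finset.mem_map.2 ⟨b, hC.mem ha hb hpq, rfl⟩

variable {α β : Type*} [DecidableEq α] [DecidableEq β] {G H I J K : Graph α β} {a b u v : α}
  {e f : β}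

/-- Two bundles in the same component coincide, and over a set of vertices with even components
that avoids the ends of a bundle, these ends have at most one common neighbour. -/
structure HasUniqueLinks (H : Graph α β) : Prop where
  isLink : ∀ e f a b c d, H.IsMultipleEdge e → H.IsMultipleEdge f → H.IsLink e a b →
    H.IsLink f c d → ReflTransGen H.Adj a c → H.IsLink f a b
  unique : ∀ e u v, H.IsMultipleEdge e → H.IsLink e u v → ∀ W : Finset α, (∀ w ∈ W, w ∈ V(H)) →
    u ∉ W → v ∉ W → (∀ C, ClosedIn H.Adj W C → Even C.card) → ∀ r r' c c',
    r = u ∨ r = v → r' = u ∨ r' = v → c ∉ W → c' ∉ W → c ≠ u → c ≠ v → c' ≠ u → c' ≠ v →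
    LinkedOver H.Adj W r c → LinkedOver H.Adj W r' c' → c = c'

section Sets

variable {x S C : Finset (α ⊕ β)} {W : Finset α}

lemma linkedOver_of_elemAdj (hx : ∀ p, p ∈ x ↔ ∃ a ∈ W, p = Sum.inl a)
    (h : LinkedOver H.elemAdj x (Sum.inl a) (Sum.inl b)) : LinkedOver H.Adj W a b := by
  obtain ⟨z, hz, hzb⟩ := h
  have hx' : ∀ p, p ∈ insert (Sum.inl a) x ↔ ∃ c ∈ insert a W, p = Sum.inl c := fun p => by
    simp only [Finset.mem_insert, hx]
    constructor
    · rintro (rfl | ⟨c, hc, rfl⟩)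
      · exact ⟨a, Or.inl rfl, rfl⟩
      · exact ⟨c, Or.inr hc, rfl⟩
    · rintro ⟨c, rfl | hc, rfl⟩
      · exact Or.inl rfl
      · exact Or.inr ⟨c, hc, rfl⟩
  have := compIn_subset_of_closedIn
    (closedIn_map hx' (closedIn_compIn (S := insert a W) (p := a)))
    (Finset.mem_map.2 ⟨a, mem_compIn_self (Finset.mem_insert_self _ _), rfl⟩) hz
  obtain ⟨c, hc, rfl⟩ := Finset.mem_map.1 this
  exact ⟨c, hc, hzb⟩

end Sets

section Ranking

variable {A T D D' : Finset (α ⊕ β)}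

/-- Legal even sets decompose along the components. -/
def legalEvenProdIso (hD : ClosedIn H.elemAdj T D)
    (hD' : ClosedIn H.elemAdj T D') (hdisj : Disjoint D D') :
    H.LegalEven A (D ∪ D') ≃o H.LegalEven A D × H.LegalEven A D' := by
  have hres : ∀ S : H.LegalEven A (D ∪ D'), ∀ D, ClosedIn H.elemAdj T D →
      H.LegalSet (S.1 ∩ D) ∧ EvenOn H.elemAdj A (S.1 ∩ D) := by
    rintro ⟨S, hS, hleg, hev⟩ D'' hD''
    have hST : S ⊆ T := hS.trans (Finset.union_subset hD.1 hD'.1)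
    refine ⟨⟨fun e a he ha => ?_, fun e a b hm he ha hb => ?_⟩, ?_⟩
    · rw [Finset.mem_inter] at he ⊢
      have := hleg.1 e a he.1 ha
      exact ⟨this, hD''.mem he.2 (hST this) ha⟩
    · rw [Finset.mem_inter] at ha hb
      obtain ⟨f, hf, hab⟩ := hleg.2 e a b hm he ha.1 hb.1
      exact ⟨f, Finset.mem_inter.2 ⟨hf, hD''.mem ha.2 (hST hf) hab.inc_left⟩, hab⟩
    · rw [Finset.inter_comm]
      exact hev.closed (hD''.inter hST)
  have hsep : ∀ {D D' : Finset (α ⊕ β)}, ClosedIn H.elemAdj T D → ClosedIn H.elemAdj T D' →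
      Disjoint D D' → ∀ a b, H.Adj a b → Sum.inl a ∈ D → Sum.inl b ∈ D' → False := by
    intro D D' hD hD' hdisj a b hab ha hb
    exact Finset.disjoint_left.1 hdisj (hD.mem ha (hD'.1 hb) hab) hb
  have hglue : ∀ S : H.LegalEven A D × H.LegalEven A D',
      H.LegalSet (S.1.1 ∪ S.2.1) ∧ EvenOn H.elemAdj A (S.1.1 ∪ S.2.1) := by
    rintro ⟨⟨S, hS, hleg, hev⟩, ⟨S', hS', hleg', hev'⟩⟩
    refine ⟨⟨fun e a he ha => ?_, fun e a b hm he ha hb => ?_⟩, fun C hC => ?_⟩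
    · rw [Finset.mem_union] at he ⊢
      exact he.imp (fun he => hleg.1 e a he ha) fun he => hleg'.1 e a he ha
    · rw [Finset.mem_union] at ha hb
      rcases ha with ha | ha <;> rcases hb with hb | hb
      · obtain ⟨f, hf, h⟩ := hleg.2 e a b hm he ha hb
        exact ⟨f, Finset.mem_union_left _ hf, h⟩
      · exact (hsep hD hD' hdisj a b he.adj (hS ha) (hS' hb)).elim
      · exact (hsep hD' hD hdisj.symm a b he.adj (hS' ha) (hS hb)).elim
      · obtain ⟨f, hf, h⟩ := hleg'.2 e a b hm he ha hb
        exact ⟨f, Finset.mem_union_right _ hf, h⟩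
    · have h1 := hev _ (hC.inter Finset.subset_union_left)
      have h2 := hev' _ (hC.inter Finset.subset_union_right)
      rw [card_inter_eq_add A C S]
      have h5 : C \ S = C ∩ S' := by
        ext p
        have h3 := @hC.1 p
        have h4 : p ∈ S → p ∈ S' → False := fun h h' =>
          Finset.disjoint_left.1 hdisj (hS h) (hS' h')
        simp only [Finset.mem_union] at h3
        simp only [Finset.mem_sdiff, Finset.mem_inter]
        tauto
      rw [h5]
      exact h1.add h2
  refine
    { toFun := fun S => (⟨S.1 ∩ D, Finset.inter_subset_right, hres S D hD⟩,
        ⟨S.1 ∩ D', Finset.inter_subset_right, hres S D' hD'⟩)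
      invFun := fun S => ⟨S.1.1 ∪ S.2.1, Finset.union_subset_union S.1.2.1 S.2.2.1, hglue S⟩
      left_inv := fun S => Subtype.ext ?_
      right_inv := fun S => Prod.ext (Subtype.ext ?_) (Subtype.ext ?_)
      map_rel_iff' := fun {S S'} => ⟨fun h => ?_, fun h => ⟨Finset.inter_subset_inter_right h,
        Finset.inter_subset_inter_right h⟩⟩ }
  · show S.1 ∩ D ∪ S.1 ∩ D' = S.1
    rw [← Finset.inter_union_distrib_left]
    exact Finset.inter_eq_left.2 S.2.1
  · show (S.1.1 ∪ S.2.1) ∩ D = S.1.1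
    rw [Finset.union_inter_distrib_right, Finset.inter_eq_left.2 S.1.2.1,
      Finset.disjoint_iff_inter_eq_empty.1 (hdisj.symm.mono_left S.2.2.1), Finset.union_empty]
  · show (S.1.1 ∪ S.2.1) ∩ D' = S.2.1
    rw [Finset.union_inter_distrib_right, Finset.inter_eq_left.2 S.2.2.1,
      Finset.disjoint_iff_inter_eq_empty.1 (hdisj.mono_left S.1.2.1), Finset.empty_union]
  · intro p hp
    rcases Finset.mem_union.1 (S.2.1 hp) with h' | h'
    · exact Finset.mem_of_mem_inter_left (h.1 (Finset.mem_inter.2 ⟨hp, h'⟩))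
    · exact Finset.mem_of_mem_inter_left (h.2 (Finset.mem_inter.2 ⟨hp, h'⟩))

instance : Finite (H.LegalEven A D) :=
  Finite.of_injective (fun S => (⟨S.1, Finset.mem_powerset.2 S.2.1⟩ : D.powerset)) fun _ _ h =>
    Subtype.ext (congrArg (fun z : D.powerset => z.1) h)

/-- A ranking for the components gives one for their union. -/
lemma hasAtomRanking_of_compIn
    (h : ∀ p ∈ T, HasAtomRanking (H.LegalEven A (compIn H.elemAdj T p))) :
    ∀ D, ClosedIn H.elemAdj T D → HasAtomRanking (H.LegalEven A D) := by
  intro D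
  induction D using Finset.strongInduction with
  | H D ih =>
  intro hD
  rcases D.eq_empty_or_nonempty with rfl | ⟨p, hp⟩
  · have : Subsingleton (H.LegalEven A ∅) := ⟨fun S S' => Subtype.ext (by
      rw [Finset.subset_empty.1 S.2.1, Finset.subset_empty.1 S'.2.1])⟩
    exact HasAtomRanking.of_subsingleton
  · have hpT := hD.1 hp
    have hsub : compIn H.elemAdj T p ⊆ D := compIn_subset_of_closedIn hD hp
    have hcl : ClosedIn H.elemAdj T (compIn H.elemAdj T p) := closedIn_compIn
    have hcl' : ClosedIn H.elemAdj T (D \ compIn H.elemAdj T p) := by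
      have h1 := hcl.sdiff H.elemAdj_symm
      refine ⟨Finset.sdiff_subset.trans hD.1, fun p hp q hq hpq => ?_⟩
      rw [Finset.mem_sdiff] at hp ⊢
      exact ⟨hD.mem hp.1 hq hpq, (Finset.mem_sdiff.1 (h1.mem
        (Finset.mem_sdiff.2 ⟨hD.1 hp.1, hp.2⟩) hq hpq)).2⟩
    have h2 := ih _ (Finset.ssubset_iff_subset_ne.2 ⟨Finset.sdiff_subset, fun h =>
      (Finset.mem_sdiff.1 (h ▸ hp)).2 (mem_compIn_self hpT)⟩) hcl'
    have h3 := (h p hpT).prod h2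
    rw [← Finset.union_sdiff_of_subset hsub]
    exact h3.of_orderIso (legalEvenProdIso hcl hcl' Finset.disjoint_sdiff)

end Ranking

end Graph

/-! ### Single components as systems with at most one bundle -/

namespace Graph

open Relation

variable {α β : Type*} [DecidableEq α] [DecidableEq β] {G H I J K : Graph α β} {a b u v : α}
  {e f : β} {A T : Finset (α ⊕ β)}

lemma _root_.HasAtomRanking.congr {X : Type*} {p q : Finset X → Prop}
    (h : HasAtomRanking {S // p S}) (hpq : ∀ S, q S ↔ p S) : HasAtomRanking {S // q S} := by
  obtain rfl : q = p := funext fun S => propext (hpq S)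
  exact h

/-- A ranking for a component without bundle. -/
lemma hasAtomRanking_of_simple {D : Finset (α ⊕ β)} (hT : ∀ p, p ∈ T ↔ p ∈ H.collection)
    (hA : ∀ a ∈ V(H), (∀ e, H.Inc e a → ¬ H.IsMultipleEdge e) → Sum.inl a ∈ A)
    (hD : ClosedIn H.elemAdj T D) (hne : ∀ e, Sum.inr e ∉ D) :
    HasAtomRanking (H.LegalEven A D) := by
  have hweight : ∀ p ∈ D, p ∈ A := by
    intro p hp
    match p, hp with
    | .inr e, hp => exact absurd hp (hne e)
    | .inl a, hp =>
      refine hA a (by simpa using (hT _).1 (hD.1 hp)) fun e he hm => hne e ?_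
      exact hD.mem hp ((hT _).2 (by simpa using hm)) he
  by_cases hw : ∃ w, w ∉ D
  · obtain ⟨w, hw⟩ := hw
    -- A component without bundle becomes a system with empty bundle whose two ends are one and the
    -- same point outside `D`. This is why `BundleSystem.ne` is required only for an end in the
    -- system.
    have hS : BundleSystem H.elemAdj A D ∅ w w :=
      { symm := H.elemAdj_symm
        ne := fun h => absurd h hw
        left_notMem := by simp
        right_notMem := by simp
        adj_left := by simp
        adj_right := by simp
        eq_or_eq := by simp
        weight := fun p hp _ _ _ => hweight p hp
        unique := by
          rintro x hx - - r r' c c' (rfl | rfl) - hr <;> exact absurd hr hw }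
    refine hS.hasAtomRanking.congr fun S => ?_
    refine ⟨fun h => ⟨h.1, ⟨by simp, fun hwS => absurd (h.1 hwS) hw⟩, h.2.2⟩,
      fun h => ⟨h.1, ⟨fun e a he => absurd (h.1 he) (hne e), fun e a b hm he ha => ?_⟩, h.3⟩⟩
    exact absurd (hD.mem (h.1 ha) ((hT (Sum.inr e)).2 (by simpa using hm)) he.inc_left) (hne e)
  -- If `D` is everything, then there are no edges at all, because `D` contains none. Singletons are
  -- then components of odd weight, so only the empty set is even.
  · push Not at hw
    have : Subsingleton (H.LegalEven A D) := by
      refine ⟨fun S S' => ?_⟩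
      have hemp : ∀ S : H.LegalEven A D, S.1 = ∅ := by
        intro S
        refine Finset.eq_empty_of_forall_notMem fun p hp => ?_
        have h1 := S.2.2.2 {p} ⟨by simpa using hp, fun p' _ q _ hpq => ?_⟩
        · rw [Finset.inter_eq_left.2 (by simpa using hweight p (S.2.1 hp))] at h1
          simp at h1
        · match p', q, hpq with
          | .inl a, .inl b, ⟨e, _⟩ => exact absurd (hw (.inr e)) (hne e)
          | .inl a, .inr e, _ => exact absurd (hw (.inr e)) (hne e)
          | .inr e, .inl a, _ => exact absurd (hw (.inr e)) (hne e)
      exact Subtype.ext ((hemp S).trans (hemp S').symm)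
    exact HasAtomRanking.of_subsingleton

/-- The vertices reachable from `u`, together with the edges of `T` incident to them, form a union
of components of `T`, so the component of `p` cannot leave them. -/
lemma reflTransGen_of_mem_compIn {p : α ⊕ β} (hu : Sum.inl u ∈ compIn H.elemAdj T p) (ha : Sum.inl a ∈ compIn H.elemAdj T p) (hp : p ∈ T) : ReflTransGen H.Adj u a := by
  classical
  set R := T.filter fun q => (∃ b, q = Sum.inl b ∧ ReflTransGen H.Adj u b) ∨
    ∃ e b, q = Sum.inr e ∧ H.Inc e b ∧ ReflTransGen H.Adj u b with hR
  have hRcl : ClosedIn H.elemAdj T R := by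
    refine ⟨Finset.filter_subset _ _, fun q hq t ht hqt => ?_⟩
    rw [hR, Finset.mem_filter] at hq ⊢
    refine ⟨ht, ?_⟩
    obtain ⟨-, ⟨b, rfl, hb⟩ | ⟨e, b, rfl, heb, hb⟩⟩ := hq
    · match t, hqt with
      | .inl c, hqt => exact Or.inl ⟨c, rfl, hb.tail hqt⟩
      | .inr e, hqt => exact Or.inr ⟨e, b, rfl, hqt, hb⟩
    · match t, hqt with
      | .inl c, hqt =>
        refine Or.inl ⟨c, rfl, ?_⟩
        obtain ⟨d, hd⟩ := heb
        rcases Inc.eq_or_eq_of_isLink hqt hd with rfl | rfl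
        · exact hb
        · exact hb.tail hd.adj
  have huR : Sum.inl u ∈ R := by
    rw [hR, Finset.mem_filter]
    exact ⟨compIn_subset hu, Or.inl ⟨u, rfl, .refl⟩⟩
  have hpR : p ∈ R := by
    by_contra hpR
    have := compIn_subset_of_closedIn (hRcl.sdiff H.elemAdj_symm)
      (Finset.mem_sdiff.2 ⟨hp, hpR⟩) hu
    exact (Finset.mem_sdiff.1 this).2 huR
  have := compIn_subset_of_closedIn hRcl hpR ha
  rw [hR, Finset.mem_filter] at this
  obtain ⟨-, ⟨b, hb, h⟩ | ⟨e, b, hb, -⟩⟩ := this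
  · exact Sum.inl_injective hb ▸ h
  · cases hb

/-- A ranking for a component with a bundle. -/
lemma HasUniqueLinks.hasAtomRanking_compIn [H.Loopless] (hH : H.HasUniqueLinks)
    (hT : ∀ p, p ∈ T ↔ p ∈ H.collection)
    (hA : ∀ a ∈ V(H), (∀ e, H.Inc e a → ¬ H.IsMultipleEdge e) → Sum.inl a ∈ A)
    {p : α ⊕ β} (hp : p ∈ T) : HasAtomRanking (H.LegalEven A (compIn H.elemAdj T p)) := by
  classical
  have hD : ClosedIn H.elemAdj T (compIn H.elemAdj T p) := closedIn_compIn
  by_cases hne : ∀ e, Sum.inr e ∉ compIn H.elemAdj T p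
  · exact hasAtomRanking_of_simple hT hA hD hne
  push Not at hne
  obtain ⟨e, he⟩ := hne
  have hr := @reflTransGen_of_mem_compIn α β _ _ H
  set D := compIn H.elemAdj T p with hDdef
  have hem : H.IsMultipleEdge e := by simpa using (hT _).1 (hD.1 he)
  obtain ⟨u, v, huv⟩ := exists_isLink_of_mem_edgeSet hem.mem
  have hinc : ∀ {f a}, Sum.inr f ∈ D → H.Inc f a → Sum.inl a ∈ D := fun hf ha =>
    hD.mem hf ((hT _).2 (by simpa using ha.vertex_mem)) ha
  have hinc' : ∀ {f a}, H.IsMultipleEdge f → Sum.inl a ∈ D → H.Inc f a → Sum.inr f ∈ D :=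
    fun hf hd ha => hD.mem hd ((hT _).2 (by simpa using hf)) ha
  have huD : Sum.inl u ∈ D := hinc he huv.inc_left
  have hlink : ∀ {f}, Sum.inr f ∈ D → H.IsLink f u v := by
    intro f hf
    have hfm : H.IsMultipleEdge f := by simpa using (hT _).1 (hD.1 hf)
    obtain ⟨c, d, hcd⟩ := exists_isLink_of_mem_edgeSet hfm.mem
    exact hH.isLink e f u v c d hem hfm huv hcd (hr huD (hinc hf hcd.inc_left) hp)
  set B := T.filter fun q => ∃ f, q = Sum.inr f ∧ H.IsLink f u v with hB
  have hmB : ∀ f, Sum.inr f ∈ B ↔ H.IsLink f u v := fun f => by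
    rw [hB, Finset.mem_filter, hT]
    constructor
    · rintro ⟨-, g, hg, h⟩
      exact Sum.inr_injective hg ▸ h
    · exact fun h => ⟨by simpa using hem.of_isLink huv h, f, rfl, h⟩
  have hBr : ∀ q ∈ B, ∃ f, q = Sum.inr f ∧ H.IsLink f u v := fun q hq =>
    (Finset.mem_filter.1 hq).2
  -- The component has only one bundle, so a vertex other than its ends meets no multiple edge and
  -- must be in `A`.
  have hord : ∀ q ∈ D, q ≠ Sum.inl u → q ≠ Sum.inl v → q ∉ B →
      ∃ a, q = Sum.inl a ∧ Sum.inl a ∈ A := by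
    intro q hq hqu hqv hqB
    match q, hq, hqu, hqv, hqB with
    | .inr f, hq, _, _, hqB => exact absurd ((hmB f).2 (hlink hq)) hqB
    | .inl a, hq, hqu, hqv, _ =>
      refine ⟨a, rfl, hA a (by simpa using (hT _).1 (hD.1 hq)) fun f hf hm => ?_⟩
      rcases hf.eq_or_eq_of_isLink (hlink (hinc' hm hq hf)) with rfl | rfl
      · exact hqu rfl
      · exact hqv rfl
  have hS : BundleSystem H.elemAdj A D B (Sum.inl u) (Sum.inl v) :=
    { symm := H.elemAdj_symm
      ne := fun _ h => huv.ne (Sum.inl_injective h)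
      left_notMem := fun h => by obtain ⟨f, hf, -⟩ := hBr _ h; cases hf
      right_notMem := fun h => by obtain ⟨f, hf, -⟩ := hBr _ h; cases hf
      adj_left := fun b hb => by
        obtain ⟨f, rfl, hf⟩ := hBr _ hb
        exact hf.inc_left
      adj_right := fun b hb => by
        obtain ⟨f, rfl, hf⟩ := hBr _ hb
        exact hf.inc_right
      eq_or_eq := fun b hb q hq => by
        obtain ⟨f, rfl, hf⟩ := hBr _ hb
        match q, hq with
        | .inl a, hq =>
          rcases Inc.eq_or_eq_of_isLink hq hf with rfl | rfl
          · exact Or.inl rfl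
          · exact Or.inr rfl
      weight := fun q hq h1 h2 h3 => by
        obtain ⟨a, rfl, ha⟩ := hord q hq h1 h2 h3
        exact ha
      -- An even set that avoids the ends contains no bundle edge. It consists of vertices of odd
      -- weight, so for it even weight means even size, as in `HasUniqueLinks`.
      unique := by
        intro x hx hux hvx r r' c c' hr hr' hrD hrD' hcD hcD' hcx hcx' hcu hcv hcB hcu' hcv' hcB'
          hl hl'
        have hxB : ∀ q ∈ x, q ∉ B := fun q hq hqB => hux (hx.legal.1 q hq hqB).1
        have hxA : ∀ q ∈ x, ∃ a, q = Sum.inl a ∧ Sum.inl a ∈ A := fun q hq =>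
          hord q (hx.subset hq) (fun h => hux (h ▸ hq)) (fun h => hvx (h ▸ hq)) (hxB q hq)
        obtain ⟨c, rfl, -⟩ := hord c hcD hcu hcv hcB
        obtain ⟨c', rfl, -⟩ := hord c' hcD' hcu' hcv' hcB'
        have hxW : ∀ q, q ∈ x ↔ ∃ a ∈ x.toLeft, q = Sum.inl a := fun q => by
          constructor
          · intro hq
            obtain ⟨a, rfl, -⟩ := hxA q hq
            exact ⟨a, Finset.mem_toLeft.2 hq, rfl⟩
          · rintro ⟨a, ha, rfl⟩
            exact Finset.mem_toLeft.1 ha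
        have hends : ∀ {r : α ⊕ β}, r = Sum.inl u ∨ r = Sum.inl v →
            ∃ a, r = Sum.inl a ∧ (a = u ∨ a = v) := by
          rintro r (rfl | rfl)
          · exact ⟨u, rfl, Or.inl rfl⟩
          · exact ⟨v, rfl, Or.inr rfl⟩
        obtain ⟨r, rfl, hru⟩ := hends hr
        obtain ⟨r', rfl, hru'⟩ := hends hr'
        have h2 : ∀ {c d : α}, (Sum.inl c : α ⊕ β) ≠ Sum.inl d → c ≠ d := fun h h' => h (h' ▸ rfl)
        refine congrArg Sum.inl (hH.unique e u v hem huv x.toLeft (fun w hw => ?_)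
          (fun h => hux (Finset.mem_toLeft.1 h)) (fun h => hvx (Finset.mem_toLeft.1 h))
          (fun C hC => ?_) r r' c c' hru hru' (fun h => hcx (Finset.mem_toLeft.1 h))
          (fun h => hcx' (Finset.mem_toLeft.1 h)) (h2 hcu) (h2 hcv) (h2 hcu') (h2 hcv')
          (linkedOver_of_elemAdj hxW hl) (linkedOver_of_elemAdj hxW hl'))
        · simpa using (hT _).1 (hD.1 (hx.subset (Finset.mem_toLeft.1 hw)))
        · have h3 := closedIn_map hxW hC
          have h4 := hx.even _ h3
          rwa [Finset.inter_eq_left.2, Finset.card_map] at h4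
          intro q hq
          obtain ⟨a, rfl, ha⟩ := hxA q (h3.1 hq)
          exact ha }
  refine hS.hasAtomRanking.congr fun S => ?_
  refine ⟨fun ⟨h1, h2, h3⟩ => ⟨h1, ⟨fun b hb hbB => ?_, fun hu hv => ?_⟩, h3⟩,
    fun ⟨h1, h2, h3⟩ => ⟨h1, ⟨fun f a hf ha => ?_, fun f a b hm hf ha hb => ?_⟩, h3⟩⟩
  · obtain ⟨f, rfl, hf⟩ := hBr _ hbB
    exact ⟨h2.1 f u hb hf.inc_left, h2.1 f v hb hf.inc_right⟩
  · obtain ⟨f, hf, hl⟩ := h2.2 e u v hem huv hu hv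
    exact ⟨Sum.inr f, hf, (hmB f).2 hl⟩
  · have hfl := hlink (h1 hf)
    have h4 := h2.1 _ hf ((hmB f).2 hfl)
    rcases ha.eq_or_eq_of_isLink hfl with rfl | rfl
    · exact h4.1
    · exact h4.2
  · have hfl := hlink (hinc' hm (h1 ha) hf.inc_left)
    rcases hf.eq_and_eq_or_eq_and_eq hfl with ⟨rfl, rfl⟩ | ⟨rfl, rfl⟩
    · obtain ⟨q, hq, hqB⟩ := h2.2 ha hb
      obtain ⟨g, rfl, hg⟩ := hBr _ hqB
      exact ⟨g, hq, hg⟩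
    · obtain ⟨q, hq, hqB⟩ := h2.2 hb ha
      obtain ⟨g, rfl, hg⟩ := hBr _ hqB
      exact ⟨g, hq, hg.symm⟩

end Graph

/-! ### Passage to PI-graphs and the proof of shellability -/

section EvenSets

variable {X : Type*} {adj adj' : X → X → Prop} {S C : Finset X} {p q : X}

lemma ClosedIn.congr (h : ∀ p ∈ S, ∀ q ∈ S, adj' p q → adj p q) (hC : ClosedIn adj S C) :
    ClosedIn adj' S C :=
  ⟨hC.1, fun p hp q hq hpq => hC.mem hp hq (h p (hC.1 hp) q hq hpq)⟩

lemma LinkedOver.congr [DecidableEq X] (h : ∀ p q, adj p q → adj' p q)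
    (hl : LinkedOver adj S p q) : LinkedOver adj' S p q := by
  obtain ⟨z, hz, hzq⟩ := hl
  exact ⟨z, compIn_subset_of_closedIn (closedIn_compIn.congr fun _ _ _ _ => h _ _)
    (mem_compIn_self (Finset.mem_insert_self _ _)) hz, h _ _ hzq⟩

end EvenSets

namespace Graph

open Relation

variable {α β : Type*} {G H K : Graph α β} {a b : α} {A : Set (α ⊕ β)}

lemma IsPIGraph.le (h : H.IsPIGraph G) : H ≤ G := by
  obtain ⟨K, h1, h2⟩ := h
  exact h2.le.trans h1.1.le

lemma IsPIGraph.adj (h : H.IsPIGraph G) (ha : a ∈ V(H)) (hb : b ∈ V(H)) (hab : G.Adj a b) :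
    H.Adj a b := by
  obtain ⟨K, h1, h2⟩ := h
  have : K.Adj a b := by
    rcases h1.2 a b hab with h3 | ⟨e, he, -⟩
    · obtain ⟨e, he⟩ := hab
      exact ⟨e, h3 e he⟩
    · exact ⟨e, he⟩
  exact (h2.adj_congr ha hb).2 this

/-- Passing to a PI-graph creates no multiple edges and does not change adjacency between the
remaining vertices, so the components of `W` are the same in both graphs. -/
lemma HasUniqueLinks.of_isPIGraph [DecidableEq α] (hG : G.HasUniqueLinks) (h : H.IsPIGraph G) :
    H.HasUniqueLinks where
  isLink e f a b c d he hf hab hcd hac := by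
    have hle := h.le
    have h1 := hG.isLink e f a b c d (he.mono hle) (hf.mono hle) (hab.mono hle) (hcd.mono hle)
      (ReflTransGen.mono (fun _ _ h => Adj.mono hle h) _ _ hac)
    exact (hle.isLink_iff hcd.edge_mem).2 h1
  unique e u v he huv W hW hu hv hev r r' c c' hr hr' hc hc' hcu hcv hcu' hcv' hl hl' := by
    have hle := h.le
    exact hG.unique e u v (he.mono hle) (huv.mono hle) W (fun w hw => hle.vertexSet_mono (hW w hw))
      hu hv (fun C hC => hev C (hC.congr fun p hp q hq hpq => hpq.mono hle)) r r' c c' hr hr' hc hc'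
      hcu hcv hcu' hcv' (hl.congr fun p q hpq => hpq.mono hle) (hl'.congr fun p q hpq => hpq.mono hle)

lemma IsMultipleEdge.of_isClosedSubgraph (hK : K ≤c G) {e : β} (he : e ∈ E(K))
    (h : G.IsMultipleEdge e) : K.IsMultipleEdge e := by
  obtain ⟨f, hne, x, y, h1, h2⟩ := h
  have h3 := (hK.le.isLink_iff he).2 h1
  exact ⟨f, hne, x, y, h3, (hK.isLink_congr h3.left_mem).2 h2⟩

lemma Admissible.mem_of_simple (h : H.Admissible A) (ha : a ∈ V(H))
    (hs : ∀ e, H.Inc e a → ¬ H.IsMultipleEdge e) : Sum.inl a ∈ A := by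
  have hK := isComponent_induce ha
  exact ((h.2 _ hK).mem_of_simple a (ReflTransGen.refl : ReflTransGen H.Adj a a) fun e he hm =>
    hs e (he.mono hK.1.le) (hm.mono hK.1.le)).2

/-- This puts `H` itself into the poset, as its top. In each component the number of vertices in `A`
is even, and the edges in `A` are counted bundle by bundle. -/
lemma Admissible.isEven (h : H.Admissible A) (hV : V(H).Finite) (hE : E(H).Finite) :
    H.IsEven A := by
  classical
  intro K hK
  have hadm := h.2 K hK
  have hVK : {v ∈ V(K) | Sum.inl v ∈ A}.Finite :=
    hV.subset fun v hv => hK.1.le.vertexSet_mono hv.1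
  have hEK : {e ∈ E(K) | Sum.inr e ∈ A}.Finite :=
    hE.subset fun v hv => hK.1.le.edgeSet_mono hv.1
  have hmul : ∀ e ∈ E(K), Sum.inr e ∈ A → K.IsMultipleEdge e := fun e he heA =>
    (show H.IsMultipleEdge e by simpa using h.1 heA).of_isClosedSubgraph hK.1 he
  have hsplit : K.elements ∩ A =
      Sum.inl '' {v ∈ V(K) | Sum.inl v ∈ A} ∪ Sum.inr '' {e ∈ E(K) | Sum.inr e ∈ A} := by
    ext (a | e) <;> simp
  rw [hsplit, Set.ncard_union_eq ?_ (hVK.image _) (hEK.image _),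
    Set.ncard_image_of_injective _ Sum.inl_injective,
    Set.ncard_image_of_injective _ Sum.inr_injective]
  · refine Even.add ?_ ?_
    · have hset : {v ∈ V(K) | Sum.inl v ∈ A} = {v ∈ V(K) | Sum.inl v ∈ K.collection ∩ A} := by
        ext v
        exact ⟨fun h' => ⟨h'.1, by simpa using h'.1, h'.2⟩, fun h' => ⟨h'.1, h'.2.2⟩⟩
      rw [hset]
      exact hadm.even_vertices
    -- `par e` is the bundle of `e`; every edge in `A` is multiple, so the fibres of `par` are the
    -- even sets of `bundle_even`.
    · set par : β → Set β := fun e => {f | ∃ x y, K.IsLink e x y ∧ K.IsLink f x y} with hpar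
      rw [Set.ncard_eq_toFinset_card _ hEK,
        Finset.card_eq_sum_card_image par hEK.toFinset, even_iff_two_dvd]
      refine Finset.dvd_sum fun B hB => ?_
      obtain ⟨e, he, rfl⟩ := Finset.mem_image.1 hB
      simp only [Set.Finite.mem_toFinset, Set.mem_ofPred_eq] at he
      obtain ⟨x, y, hxy⟩ := exists_isLink_of_mem_edgeSet he.1
      have hpe : ∀ {f x y}, K.IsLink f x y → par f = {f | K.IsLink f x y} := by
        intro f x y hf
        ext g
        refine ⟨fun ⟨x', y', h1, h2⟩ => ?_, fun hg => ⟨x, y, hf, hg⟩⟩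
        rcases h1.eq_and_eq_or_eq_and_eq hf with ⟨rfl, rfl⟩ | ⟨rfl, rfl⟩
        · exact h2
        · exact h2.symm
      have hbun : K.IsBundle (par e) := by
        refine ⟨?_, x, y, hpe hxy⟩
        obtain ⟨f, hne, x', y', h1, h2⟩ := hmul e he.1 he.2
        exact ⟨e, ⟨x', y', h1, h1⟩, f, ⟨x', y', h1, h2⟩, hne.symm⟩
      have h1 := hadm.bundle_even _ hbun
      rw [← even_iff_two_dvd, ← Set.ncard_coe_finset]
      refine (congrArg (fun s : Set β => Even s.ncard) ?_).mpr h1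
      ext f
      simp only [Finset.coe_filter, Set.Finite.mem_toFinset, Set.mem_ofPred_eq, Set.mem_inter_iff,
        inr_mem_collection]
      constructor
      · rintro ⟨⟨h2, h3⟩, h4⟩
        refine ⟨?_, hmul f h2 h3, h3⟩
        rw [← h4]
        obtain ⟨x', y', h5⟩ := exists_isLink_of_mem_edgeSet h2
        exact ⟨x', y', h5, h5⟩
      · rintro ⟨⟨x', y', h2, h3⟩, h4, h5⟩
        exact ⟨⟨h3.edge_mem, h5⟩, by rw [hpe h2, hpe h3]⟩
  · rw [Set.disjoint_left]
    rintro _ ⟨a, -, rfl⟩ ⟨e, -, he⟩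
    cases he

/-- The top `H` and the empty graph as bottom make the poset bounded; the ranking comes from the
components through the isomorphism with sets. -/
theorem HasUniqueLinks.posetShellable [DecidableEq α] [G.Loopless] (hG : G.HasUniqueLinks)
    (hV : V(G).Finite) (hE : E(G).Finite) (hH : H.IsPIGraph G) (hA : H.Admissible A) :
    PosetShellable (H.EvenPoset A) := by
  classical
  have hVH := hV.subset hH.le.vertexSet_mono
  have hEH := hE.subset hH.le.edgeSet_mono
  have := Loopless.anti hH.le
  have hcol := finite_collection hVH hEH
  have hT : ∀ p, p ∈ hcol.toFinset ↔ p ∈ H.collection := fun p => hcol.mem_toFinset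
  have hA' : ∀ p, p ∈ (hcol.subset hA.1).toFinset ↔ p ∈ A := fun p => Set.Finite.mem_toFinset _
  set φ := evenPosetIso hT hA.1 hA'
  have : Finite (H.EvenPoset A) := Finite.of_injective φ φ.injective
  have hrank := (hasAtomRanking_of_compIn (fun p hp =>
    (hG.of_isPIGraph hH).hasAtomRanking_compIn hT (fun a ha h => (hA' _).2 (hA.mem_of_simple ha h))
      hp) _ ⟨subset_rfl, fun _ _ _ hq _ => hq⟩).of_orderIso φ
  let _ : BoundedOrder (H.EvenPoset A) :=
    { top := ⟨H, ⟨le_rfl, fun _ _ _ _ h => h⟩, hA.isEven hVH hEH⟩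
      le_top := fun I => I.2.1.1
      bot := ⟨⊥, ⟨bot_le, fun x hx => absurd hx (by simp)⟩, fun C hC => by
        obtain ⟨a, ha⟩ := hC.2.1
        exact absurd (hC.1.le.vertexSet_mono ha) (by simp)⟩
      bot_le := fun I => (bot_le : ⊥ ≤ I.1) }
  exact hrank.posetShellable

end Graph

/-! ### Necessity -/

section EvenSets

variable {X : Type*} {adj : X → X → Prop} {A S S' C D x y : Finset X} {p q r : X}

/-- The elements `p` and `q` are in the same component of `S`. -/
def ReachIn (adj : X → X → Prop) (S : Finset X) (p q : X) : Prop :=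
  ∀ C, ClosedIn adj S C → p ∈ C → q ∈ C

lemma ReachIn.refl : ReachIn adj S p p := fun _ _ h => h

lemma ReachIn.trans (h : ReachIn adj S p q) (h' : ReachIn adj S q r) : ReachIn adj S p r :=
  fun C hC hp => h' C hC (h C hC hp)

lemma ReachIn.of_adj (h : adj p q) (hq : q ∈ S) : ReachIn adj S p q :=
  fun _ hC hp => hC.mem hp hq h

lemma ReachIn.tail (h : ReachIn adj S p q) (h' : adj q r) (hr : r ∈ S) : ReachIn adj S p r :=
  h.trans (.of_adj h' hr)

variable [DecidableEq X]

lemma ReachIn.mono (h : ReachIn adj S p q) (hS : S ⊆ S') (hp : p ∈ S) : ReachIn adj S' p q :=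
  fun _ hC hpC => (Finset.mem_inter.1 (h _ (hC.inter hS) (Finset.mem_inter.2 ⟨hpC, hp⟩))).1

lemma EvenOn.union_of_reachIn (hs : ∀ p q, adj p q → adj q p) (hx : EvenOn adj A x)
    (hD : Disjoint x D) (hev : Even (D ∩ A).card) (hr : r ∈ D)
    (hconn : ∀ q ∈ D, ReachIn adj (x ∪ D) r q) : EvenOn adj A (x ∪ D) :=
  hx.union hs hD hev hr fun C hC hrC q hq => hconn q hq C hC hrC

/-- The number of elements of `l` in `s`. -/
lemma even_sum_of_even (hx : EvenOn adj A x) (hy : EvenOn adj A y) (hxy : x ⊆ y) {l : List X}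
    (hl : l.Nodup) (hlA : ∀ p ∈ l, p ∈ A) (hlx : ∀ p ∈ l, p ∉ x)
    (hy' : ∀ p ∈ y, p ∈ A → p ∉ x → p ∈ l) :
    Even (l.map fun p => if p ∈ y then 1 else 0).sum := by
  rw [← List.sum_toFinset _ hl, ← Finset.card_filter]
  have h1 := hx.even_sdiff hy hxy
  have h2 : l.toFinset.filter (· ∈ y) = (y \ x) ∩ A := by
    ext p
    simp only [Finset.mem_filter, List.mem_toFinset, Finset.mem_inter, Finset.mem_sdiff]
    exact ⟨fun h => ⟨⟨h.2, hlx p h.1⟩, hlA p h.1⟩, fun h => ⟨hy' p h.1.1 h.2 h.1.2, h.1.1⟩⟩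
  rw [h2]
  exact h1

/-- The variables indicate which of `u`, `v`, `e`, `e'`, `m`, `m'` belong to sets `s` and `t` with
two and four of them. Without an edge, `t` would have at most one end, hence at most three elements.
So `t` has an edge and both ends, which leaves room for at most one of `m`, `m'`. An edge in `s`
would require three elements, so `s` has no edge, at most one end, and therefore one of `m`, `m'`,
the same one as `t`. -/
lemma iff_of_six_count {su sv se se' sm sm' tu tv te te' tm tm' : ℕ}
    (hs : su + sv + se + se' + sm + sm' = 2) (ht : tu + tv + te + te' + tm + tm' = 4)
    (hm : sm ≤ tm) (hm' : sm' ≤ tm') (hu : tu ≤ 1) (hv : tv ≤ 1) (htm : tm ≤ 1) (htm' : tm' ≤ 1)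
    (h1 : se ≤ su ∧ se ≤ sv) (h2 : se' ≤ su ∧ se' ≤ sv) (h3 : te ≤ tu ∧ te ≤ tv)
    (h4 : te' ≤ tu ∧ te' ≤ tv) (h5 : su + sv ≤ 1 + se + se') (h6 : tu + tv ≤ 1 + te + te') :
    sm = 1 ∧ sm' = 0 ↔ tm = 1 ∧ tm' = 0 := by
  have i1 : te + te' ≠ 0 := by omega
  have i2 : tm + tm' ≤ 1 := by omega
  have i3 : se + se' = 0 := by omega
  omega

end EvenSets

/-! ### The obstruction with six new elements -/

namespace Graph

open Relation

variable {α β : Type*} [DecidableEq α] [DecidableEq β] {G H : Graph α β}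

/-- Intervals with six new elements of odd weight, of which four belong to a bundle, obstruct
shellability. -/
lemma not_posetShellable_of_six {A T : Finset (α ⊕ β)} {P : Type*} [PartialOrder P] [Finite P]
    (φ : P ≃o H.LegalEven A T) (x y : H.LegalEven A T) (hxy : x ≤ y)
    {u v : α} {e e' : β} {m m' : α ⊕ β}
    (he : H.IsLink e u v) (he' : H.IsLink e' u v) (hm : H.IsMultipleEdge e)
    (hnd : [Sum.inl u, Sum.inl v, Sum.inr e, Sum.inr e', m, m'].Nodup)
    (hA : ∀ p ∈ [Sum.inl u, Sum.inl v, Sum.inr e, Sum.inr e', m, m'], p ∈ A)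
    (hx : ∀ p ∈ [Sum.inl u, Sum.inl v, Sum.inr e, Sum.inr e', m, m'], p ∉ x.1)
    (hy : ∀ p ∈ y.1, p ∈ A → p ∉ x.1 → p ∈ [Sum.inl u, Sum.inl v, Sum.inr e, Sum.inr e', m, m'])
    (hyl : ∀ f, Sum.inr f ∈ y.1 → H.IsLink f u v → f = e ∨ f = e')
    (hsep : ∀ s t : H.LegalEven A T, x ≤ s → s < t → t ≤ y →
      ∃ p ∈ [Sum.inl u, Sum.inl v, Sum.inr e, Sum.inr e', m, m'], p ∈ t.1 ∧ p ∉ s.1)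
    (h1 : ∃ s t : H.LegalEven A T, x < s ∧ s < t ∧ t < y ∧ m ∈ s.1 ∧ m' ∉ s.1)
    (h2 : ∃ s t : H.LegalEven A T, x < s ∧ s < t ∧ t < y ∧ m ∉ s.1) :
    ¬ PosetShellable P := by
  refine not_posetShellable (x := φ.symm x) (y := φ.symm y)
    (fun s => m ∈ (φ s).1 ∧ m' ∉ (φ s).1) ?_ ?_ ?_
  · intro s₀ t₀ hxs₀ hst₀ hty₀
    have hxs : x < φ s₀ := φ.symm_apply_lt.1 hxs₀
    have hst : φ s₀ < φ t₀ := φ.lt_iff_lt.2 hst₀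
    have hty : φ t₀ < y := φ.lt_symm_apply.1 hty₀
    generalize φ s₀ = s at hxs hst ⊢
    generalize φ t₀ = t at hst hty ⊢
    have hxt := hxs.trans hst
    have hsy := hst.trans hty
    set n : H.LegalEven A T → α ⊕ β → ℕ := fun s p => if p ∈ s.1 then 1 else 0 with hn
    have hn1 : ∀ s p, n s p ≤ 1 := fun s p => by simp only [hn]; split_ifs <;> omega
    have hmem : ∀ s p, p ∈ s.1 ↔ n s p = 1 := fun s p => by
      by_cases h : p ∈ s.1 <;> simp [hn, h]
    have hmem' : ∀ s p, p ∉ s.1 ↔ n s p = 0 := fun s p => by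
      by_cases h : p ∈ s.1 <;> simp [hn, h]
    have hpar : ∀ s, x ≤ s → s ≤ y → Even (n s (Sum.inl u) + n s (Sum.inl v) + n s (Sum.inr e) +
        n s (Sum.inr e') + n s m + n s m') := by
      intro s hxs hsy
      have := even_sum_of_even x.2.2.2 s.2.2.2 hxs hnd hA hx fun p hp => hy p (hsy hp)
      simpa [hn, add_assoc] using this
    have hmono : ∀ s t, s ≤ t → ∀ p, n s p ≤ n t p := fun s t h p => by
      by_cases hp : p ∈ s.1
      · simp [hn, hp, h hp]
      · simp [hn, hp]
    have hlt : ∀ s t, x ≤ s → s < t → t ≤ y →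
        n s (Sum.inl u) + n s (Sum.inl v) + n s (Sum.inr e) + n s (Sum.inr e') + n s m + n s m' <
        n t (Sum.inl u) + n t (Sum.inl v) + n t (Sum.inr e) + n t (Sum.inr e') + n t m + n t m' := by
      intro s t hxs hst hty
      obtain ⟨p, hp, hpt, hps⟩ := hsep s t hxs hst hty
      have h0 : n s p = 0 := by simp [hn, hps]
      have h1 : n t p = 1 := by simp [hn, hpt]
      have := hmono s t hst.le
      have i1 := this (Sum.inl u)
      have i2 := this (Sum.inl v)
      have i3 := this (Sum.inr e)
      have i4 := this (Sum.inr e')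
      have i5 := this m
      have i6 := this m'
      simp only [List.mem_cons, List.not_mem_nil, or_false] at hp
      rcases hp with rfl | rfl | rfl | rfl | rfl | rfl <;> omega
    have hlegE : ∀ s : H.LegalEven A T, ∀ f, H.IsLink f u v →
        n s (Sum.inr f) ≤ n s (Sum.inl u) ∧ n s (Sum.inr f) ≤ n s (Sum.inl v) := by
      intro s f hf
      by_cases hfs : Sum.inr f ∈ s.1
      · simp [hn, hfs, s.2.2.1.1 f u hfs hf.inc_left, s.2.2.1.1 f v hfs hf.inc_right]
      · simp [hn, hfs]
    have hlegV : ∀ s : H.LegalEven A T, s ≤ y →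
        n s (Sum.inl u) + n s (Sum.inl v) ≤ 1 + n s (Sum.inr e) + n s (Sum.inr e') := by
      intro s hsy
      by_cases hu : Sum.inl u ∈ s.1
      · by_cases hv : Sum.inl v ∈ s.1
        · obtain ⟨f, hf, hfl⟩ := s.2.2.1.2 e u v hm he hu hv
          rcases hyl f (hsy hf) hfl with rfl | rfl <;> simp [hn, hu, hv, hf]
        · simp [hn, hu, hv]; omega
      · have := hn1 s (Sum.inl v)
        have : n s (Sum.inl u) = 0 := by simp [hn, hu]
        omega
    -- The counts strictly increase along `x < s < t < y`, are even, start at zero and are at most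
    -- six; so they are 0, 2, 4, 6.
    have a1 := hlt x s le_rfl hxs hsy.le
    have a2 := hlt s t hxs.le hst hty.le
    have a3 := hlt t y hxt.le hty le_rfl
    obtain ⟨k1, b1⟩ := hpar s hxs.le hsy.le
    obtain ⟨k2, b2⟩ := hpar t hxt.le hty.le
    obtain ⟨k3, b3⟩ := hpar x le_rfl hxy
    have c1 := hn1 y (Sum.inl u)
    have c2 := hn1 y (Sum.inl v)
    have c3 := hn1 y (Sum.inr e)
    have c4 := hn1 y (Sum.inr e')
    have c5 := hn1 y m
    have c6 := hn1 y m'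
    have d := hmono s t hst.le
    have d5 := d m
    have d6 := d m'
    have f1 := hlegE s e he
    have f2 := hlegE s e' he'
    have f3 := hlegE t e he
    have f4 := hlegE t e' he'
    have g1 := hlegV s hsy.le
    have g2 := hlegV t hty.le
    have n1 := hn1 t (Sum.inl u)
    have n2 := hn1 t (Sum.inl v)
    have n5 := hn1 t m
    have n6 := hn1 t m'
    rw [hmem' s m', hmem' t m', hmem s m, hmem t m]
    refine iff_of_six_count ?_ ?_ d5 d6 n1 n2 n5 n6 f1 f2 f3 f4 g1 g2
    · clear d5 d6 f1 f2 f3 f4 g1 g2 n1 n2 n5 n6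
      omega
    · clear d5 d6 f1 f2 f3 f4 g1 g2 n1 n2 n5 n6
      omega
  · obtain ⟨s, t, h1, h2, h3, h4, h5⟩ := h1
    exact ⟨φ.symm s, φ.symm t, φ.symm.lt_iff_lt.2 h1, φ.symm.lt_iff_lt.2 h2, φ.symm.lt_iff_lt.2 h3,
      by simpa using h4, by simpa using h5⟩
  · obtain ⟨s, t, h1, h2, h3, h4⟩ := h2
    exact ⟨φ.symm s, φ.symm t, φ.symm.lt_iff_lt.2 h1, φ.symm.lt_iff_lt.2 h2, φ.symm.lt_iff_lt.2 h3,
      fun h => h4 (by simpa using h.1)⟩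

end Graph

/-! ### PI-graphs with prescribed bundles and their admissible collections -/

namespace Graph

open Relation

variable {α β : Type*} {G H : Graph α β}

/-- Supplies the single edge that survives when a bundle is replaced. -/
lemma exists_representative (G : Graph α β) : ∃ rep : β → β,
    (∀ e x y, G.IsLink e x y → G.IsLink (rep e) x y) ∧
      ∀ e f x y, G.IsLink e x y → G.IsLink f x y → rep e = rep f := by
  classical
  set par : β → Set β := fun e => {f | ∃ x y, G.IsLink e x y ∧ G.IsLink f x y} with hpar
  have hpe : ∀ {f x y}, G.IsLink f x y → par f = {f | G.IsLink f x y} := by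
    intro f x y hf
    ext g
    refine ⟨fun ⟨x', y', h1, h2⟩ => ?_, fun hg => ⟨x, y, hf, hg⟩⟩
    rcases h1.eq_and_eq_or_eq_and_eq hf with ⟨rfl, rfl⟩ | ⟨rfl, rfl⟩
    · exact h2
    · exact h2.symm
  -- The chosen function is constant on a nonempty class; its argument is only there to provide a
  -- value when the class is empty.
  have hch : ∀ B : Set β, ∃ f : β → β, B.Nonempty → ∀ e, f e ∈ B ∧ ∀ e', f e = f e' := by
    intro B
    by_cases hB : B.Nonempty
    · obtain ⟨b, hb⟩ := hB
      exact ⟨fun _ => b, fun _ _ => ⟨hb, fun _ => rfl⟩⟩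
    · exact ⟨id, fun h => absurd h hB⟩
  choose c hc using hch
  have hmem : ∀ {e x y}, G.IsLink e x y → c (par e) e ∈ par e ∧ ∀ e', c (par e) e = c (par e) e' :=
    fun {e x y} h => hc (par e) ⟨e, x, y, h, h⟩ e
  refine ⟨fun e => c (par e) e, fun e x y h => ?_, fun e f x y h h' => ?_⟩
  · have := (hmem h).1
    rw [hpe h] at this
    simpa [hpe h] using this
  · show c (par e) e = c (par f) f
    rw [hpe h', ← hpe h]
    exact (hmem h).2 f

/-- The PI-graph on the vertex set `U` that keeps exactly the bundles in `keep`. -/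
lemma exists_isPIGraph {U : Set α} (hU : U ⊆ V(G)) (keep : β → Prop)
    (hkeep : ∀ e f x y, G.IsLink e x y → G.IsLink f x y → keep e → keep f) :
    ∃ H : Graph α β, H.IsPIGraph G ∧ V(H) = U ∧
      (∀ e x y, x ∈ U → y ∈ U → G.IsLink e x y → keep e → H.IsLink e x y) ∧
      ∀ e, H.IsMultipleEdge e → keep e := by
  obtain ⟨rep, hr1, hr2⟩ := exists_representative G
  let K : Graph α β :=
    { vertexSet := V(G)
      IsLink := fun e x y => G.IsLink e x y ∧ (keep e ∨ rep e = e)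
      isLink_symm := fun _ _ => ⟨fun _ _ h => ⟨h.1.symm, h.2⟩⟩
      eq_or_eq_of_isLink_of_isLink := fun _ _ _ _ _ h h' => h.1.left_eq_or_eq h'.1
      left_mem_of_isLink := fun _ _ _ h => h.1.left_mem }
  have hK : K.IsPartialUnderlying G := by
    refine ⟨⟨⟨subset_rfl, fun _ _ _ h => h.1⟩, rfl⟩, fun x y ⟨e, he⟩ => ?_⟩
    by_cases hke : keep e
    · exact Or.inl fun f hf => ⟨hf, Or.inl (hkeep e f x y he hf hke)⟩
    · refine Or.inr ⟨rep e, ⟨hr1 e x y he, Or.inr (hr2 _ _ x y (hr1 e x y he) he)⟩, ?_⟩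
      rintro f ⟨hf, hf' | hf'⟩
      · exact absurd (hkeep f e x y hf he hf') hke
      · rw [← hf', hr2 f e x y hf he]
  refine ⟨K.induce U, ⟨K, hK, ⟨induce_le hU, fun e x y h hx hy => ⟨h, hx, hy⟩⟩⟩, rfl,
    fun e x y hx hy h hk => ⟨⟨h, Or.inl hk⟩, hx, hy⟩, ?_⟩
  rintro e ⟨f, hne, x, y, ⟨⟨h1, h2⟩, -⟩, ⟨⟨h3, h4⟩, -⟩⟩
  rcases h2 with h2 | h2
  · exact h2
  · rcases h4 with h4 | h4
    · exact hkeep f e x y h3 h1 h4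
    · exact absurd (by rw [← h2, ← h4, hr2 e f x y h1 h3]) hne

/-- Admissibility from evenness of closed vertex sets. -/
lemma admissible_of {A : Set (α ⊕ β)} (hA : A ⊆ H.collection)
    (hev : ∀ Z ⊆ V(H), (∀ x ∈ Z, ∀ y, H.Adj x y → y ∈ Z) → Even {z ∈ Z | Sum.inl z ∈ A}.ncard)
    (hs : ∀ z ∈ V(H), (∀ e, H.Inc e z → ¬ H.IsMultipleEdge e) → Sum.inl z ∈ A)
    (hb : ∀ e x y, H.IsMultipleEdge e → H.IsLink e x y →
      {f | H.IsLink f x y ∧ Sum.inr f ∈ A}.Nonempty ∧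
        Even {f | H.IsLink f x y ∧ Sum.inr f ∈ A}.ncard) : H.Admissible A := by
  refine ⟨hA, fun C hC => ?_⟩
  have hmul : ∀ {e}, e ∈ E(C) → H.IsMultipleEdge e → C.IsMultipleEdge e := fun he hm =>
    hm.of_isClosedSubgraph hC.1 he
  have hbun : ∀ B, C.IsBundle B → ∃ e x y, H.IsMultipleEdge e ∧ H.IsLink e x y ∧
      {e ∈ B | Sum.inr e ∈ C.collection ∩ A} = {f | H.IsLink f x y ∧ Sum.inr f ∈ A} := by
    rintro B ⟨⟨e, he, f, hf, hne⟩, x, y, rfl⟩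
    have he' : C.IsLink e x y := he
    have hf' : C.IsLink f x y := hf
    have hCH : ∀ g, C.IsLink g x y ↔ H.IsLink g x y := fun g => hC.1.isLink_congr he'.left_mem
    refine ⟨e, x, y, ⟨f, hne.symm, x, y, (hCH _).1 he', (hCH _).1 hf'⟩, (hCH _).1 he', ?_⟩
    ext g
    constructor
    · rintro ⟨h1, -, h2⟩
      exact ⟨(hCH g).1 h1, h2⟩
    · rintro ⟨h1, h2⟩
      exact ⟨(hCH g).2 h1, by simpa using hmul ((hCH g).2 h1).edge_mem (by simpa using hA h2), h2⟩
  refine ⟨Set.inter_subset_left, ?_, fun v hv h => ?_, fun B hB => ?_, fun B hB => ?_⟩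
  · have h1 := hev V(C) hC.1.le.vertexSet_mono fun x hx y hxy => (hC.1.mem_iff_of_adj hxy).1 hx
    have hset : {v ∈ V(C) | Sum.inl v ∈ C.collection ∩ A} = {z ∈ V(C) | Sum.inl z ∈ A} := by
      ext v
      exact ⟨fun h => ⟨h.1, h.2.2⟩, fun h => ⟨h.1, by simpa using h.1, h.2⟩⟩
    rw [hset]
    exact h1
  · refine ⟨by simpa using hv, hs v (hC.1.le.vertexSet_mono hv) fun e he hm => ?_⟩
    have he' := (hC.1.inc_congr hv).2 he
    exact h e he' (hmul he'.edge_mem hm)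
  · obtain ⟨e, x, y, h1, h2, h3⟩ := hbun B hB
    rw [h3]
    exact (hb e x y h1 h2).1
  · obtain ⟨e, x, y, h1, h2, h3⟩ := hbun B hB
    rw [h3]
    exact (hb e x y h1 h2).2

/-- A PI-graph with at most two bundles `u v` and `a b`. -/
structure TwoBundles (G H : Graph α β) (U : Finset α) (u v a b : α) (e e' g g' : β) : Prop where
  isPIGraph : H.IsPIGraph G
  vertexSet : V(H) = U
  he : H.IsLink e u v
  he' : H.IsLink e' u v
  hg : H.IsLink g a b
  hg' : H.IsLink g' a b
  ne : e ≠ e'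
  ne' : g ≠ g'
  mult : ∀ f, H.IsMultipleEdge f → H.IsLink f u v ∨ H.IsLink f a b
  cross : ∀ f, f = e ∨ f = e' ∨ f = g ∨ f = g' →
    (H.IsLink f u v → f = e ∨ f = e') ∧ (H.IsLink f a b → f = g ∨ f = g')

lemma exists_twoBundles {U : Finset α} (hU : ∀ z ∈ U, z ∈ V(G)) {u v a b : α} {e e' g g' : β}
    (hu : u ∈ U) (hv : v ∈ U) (ha : a ∈ U) (hb : b ∈ U) (he : G.IsLink e u v)
    (he' : G.IsLink e' u v) (hg : G.IsLink g a b) (hg' : G.IsLink g' a b) (ne : e ≠ e')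
    (ne' : g ≠ g') (h : (g = e ∧ g' = e') ∨ ¬ G.IsLink e a b) :
    ∃ H, TwoBundles G H U u v a b e e' g g' := by
  obtain ⟨H, h1, h2, h3, h4⟩ := exists_isPIGraph (G := G) (U := (U : Set α)) (fun z hz => hU z hz)
    (fun f => G.IsLink f u v ∨ G.IsLink f a b) (fun e f x y he hf h => by
      refine h.imp (fun h => ?_) fun h => ?_
      · rcases h.eq_and_eq_or_eq_and_eq he with ⟨rfl, rfl⟩ | ⟨rfl, rfl⟩
        · exact hf
        · exact hf.symm
      · rcases h.eq_and_eq_or_eq_and_eq he with ⟨rfl, rfl⟩ | ⟨rfl, rfl⟩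
        · exact hf
        · exact hf.symm)
  have hle := h1.le
  refine ⟨H, h1, h2, h3 _ _ _ hu hv he (Or.inl he), h3 _ _ _ hu hv he' (Or.inl he'),
    h3 _ _ _ ha hb hg (Or.inr hg), h3 _ _ _ ha hb hg' (Or.inr hg'), ne, ne', fun f hf => ?_, ?_⟩
  · exact (h4 f hf).imp (fun h => (hle.isLink_iff hf.mem).2 h) fun h => (hle.isLink_iff hf.mem).2 h
  · have hbad : ∀ f, G.IsLink f u v → G.IsLink f a b → G.IsLink e a b := by
      intro f h5 h6
      rcases h5.eq_and_eq_or_eq_and_eq h6 with ⟨rfl, rfl⟩ | ⟨rfl, rfl⟩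
      · exact he
      · exact he.symm
    rcases h with ⟨rfl, rfl⟩ | h
    · exact fun f hf => ⟨fun _ => by tauto, fun _ => by tauto⟩
    · rintro f (rfl | rfl | rfl | rfl)
      · exact ⟨fun _ => Or.inl rfl, fun hf => absurd (hbad _ he (hf.mono hle)) h⟩
      · exact ⟨fun _ => Or.inr rfl, fun hf => absurd (hbad _ he' (hf.mono hle)) h⟩
      · exact ⟨fun hf => absurd (hbad _ (hf.mono hle) hg) h, fun _ => Or.inl rfl⟩
      · exact ⟨fun hf => absurd (hbad _ (hf.mono hle) hg') h, fun _ => Or.inr rfl⟩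

namespace TwoBundles

variable {U : Finset α} {u v a b : α} {e e' g g' : β}

lemma mult_left (h : TwoBundles G H U u v a b e e' g g') : H.IsMultipleEdge e :=
  ⟨e', h.ne.symm, u, v, h.he, h.he'⟩

lemma mult_right (h : TwoBundles G H U u v a b e e' g g') : H.IsMultipleEdge g :=
  ⟨g', h.ne'.symm, a, b, h.hg, h.hg'⟩

lemma adj (h : TwoBundles G H U u v a b e e' g g') {x y : α} (hx : x ∈ U) (hy : y ∈ U)
    (hxy : G.Adj x y) : H.Adj x y :=
  h.isPIGraph.adj (h.vertexSet ▸ hx) (h.vertexSet ▸ hy) hxy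

lemma legalSet (h : TwoBundles G H U u v a b e e' g g') {S : Finset (α ⊕ β)}
    (hS : ∀ f, Sum.inr f ∈ S → (f = e ∨ f = e') ∧ Sum.inl u ∈ S ∧ Sum.inl v ∈ S ∨
      (f = g ∨ f = g') ∧ Sum.inl a ∈ S ∧ Sum.inl b ∈ S)
    (huv : Sum.inl u ∈ S → Sum.inl v ∈ S → Sum.inr e ∈ S ∨ Sum.inr e' ∈ S)
    (hab : Sum.inl a ∈ S → Sum.inl b ∈ S → Sum.inr g ∈ S ∨ Sum.inr g' ∈ S) : H.LegalSet S := by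
  refine ⟨fun f z hf hz => ?_, fun f z w hm hf hz hw => ?_⟩
  · have key : ∀ {x y : α}, H.IsLink f x y → Sum.inl x ∈ S → Sum.inl y ∈ S → Sum.inl z ∈ S := by
      intro x y hxy hx hy
      rcases hz.eq_or_eq_of_isLink hxy with rfl | rfl <;> assumption
    rcases hS f hf with ⟨rfl | rfl, h1, h2⟩ | ⟨rfl | rfl, h1, h2⟩
    · exact key h.he h1 h2
    · exact key h.he' h1 h2
    · exact key h.hg h1 h2
    · exact key h.hg' h1 h2
  · have key : ∀ {x y : α} {d d' : β}, H.IsLink f x y → H.IsLink d x y → H.IsLink d' x y →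
        (Sum.inl x ∈ S → Sum.inl y ∈ S → Sum.inr d ∈ S ∨ Sum.inr d' ∈ S) →
        ∃ f, Sum.inr f ∈ S ∧ H.IsLink f z w := by
      intro x y d d' hxy hd hd' hS
      rcases hf.eq_and_eq_or_eq_and_eq hxy with ⟨rfl, rfl⟩ | ⟨rfl, rfl⟩
      · rcases hS hz hw with h | h
        · exact ⟨_, h, hd⟩
        · exact ⟨_, h, hd'⟩
      · rcases hS hw hz with h | h
        · exact ⟨_, h, hd.symm⟩
        · exact ⟨_, h, hd'.symm⟩
    rcases h.mult f hm with h1 | h1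
    · exact key h1 h.he h.he' huv
    · exact key h1 h.hg h.hg' hab

variable [DecidableEq α] [DecidableEq β]

/-- The admissible collection with vertices `W` and two edges of each bundle. -/
def weights (W : Finset α) (e e' g g' : β) : Finset (α ⊕ β) :=
  W.map Function.Embedding.inl ∪ {Sum.inr e, Sum.inr e', Sum.inr g, Sum.inr g'}

@[simp] lemma inl_mem_weights {W : Finset α} {z : α} :
    Sum.inl z ∈ weights W e e' g g' ↔ z ∈ W := by simp [weights]

@[simp] lemma inr_mem_weights {W : Finset α} {f : β} :
    Sum.inr f ∈ weights W e e' g g' ↔ f = e ∨ f = e' ∨ f = g ∨ f = g' := by simp [weights]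

/-- With two edges of each bundle in the collection, the bundle conditions are automatic. Vertices
may be left out only at the ends of a bundle, so what remains is evenness of the vertices in each
component. -/
lemma admissible (h : TwoBundles G H U u v a b e e' g g') {W : Finset α} (hW : W ⊆ U)
    (hUW : ∀ z ∈ U, z ∉ W → z = u ∨ z = v ∨ z = a ∨ z = b)
    (hev : EvenOn H.elemAdj (weights W e e' g g') (U.map Function.Embedding.inl)) :
    H.Admissible (weights W e e' g g' : Finset (α ⊕ β)) := by
  classical
  have hmul : ∀ f, f = e ∨ f = e' ∨ f = g ∨ f = g' → H.IsMultipleEdge f := by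
    rintro f (rfl | rfl | rfl | rfl)
    · exact h.mult_left
    · exact h.mult_left.of_isLink h.he h.he'
    · exact h.mult_right
    · exact h.mult_right.of_isLink h.hg h.hg'
  refine admissible_of ?_ ?_ ?_ ?_
  · rintro (z | f) hp
    · simpa [h.vertexSet] using hW (by simpa using hp)
    · simpa using hmul f (by simpa using hp)
  · intro Z hZ hcl
    have hZf : (Z : Set α).Finite := (h.vertexSet ▸ U.finite_toSet : V(H).Finite).subset hZ
    have h1 := hev (hZf.toFinset.map Function.Embedding.inl) ⟨?_, ?_⟩
    · have hset : hZf.toFinset.map Function.Embedding.inl ∩ weights W e e' g g' =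
          (hZf.toFinset ∩ W).map (Function.Embedding.inl : α ↪ α ⊕ β) := by
        ext (z | f) <;> simp
      rw [hset, Finset.card_map, ← Set.ncard_coe_finset] at h1
      have hset' : {z ∈ Z | Sum.inl z ∈ ((weights W e e' g g' : Finset (α ⊕ β)) : Set (α ⊕ β))} =
          ((hZf.toFinset ∩ W : Finset α) : Set α) := by
        ext z
        simp
      rw [hset']
      exact h1
    · intro p hp
      simp only [Finset.mem_map, Set.Finite.mem_toFinset] at hp ⊢
      obtain ⟨z, hz, rfl⟩ := hp
      exact ⟨z, by simpa [h.vertexSet] using hZ hz, rfl⟩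
    · intro p hp q hq hpq
      simp only [Finset.mem_map, Set.Finite.mem_toFinset] at hp hq ⊢
      obtain ⟨z, hz, rfl⟩ := hp
      obtain ⟨w, hw, rfl⟩ := hq
      exact ⟨w, hcl z hz w hpq, rfl⟩
  · intro z hz hs
    by_contra hzW
    rcases hUW z (by simpa [h.vertexSet] using hz) (by simpa using hzW) with rfl | rfl | rfl | rfl
    · exact hs e h.he.inc_left h.mult_left
    · exact hs e h.he.inc_right h.mult_left
    · exact hs g h.hg.inc_left h.mult_right
    · exact hs g h.hg.inc_right h.mult_right
  · intro f x y hm hf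
    have key : ∀ {x' y' : α} {d d' : β}, H.IsLink f x' y' → H.IsLink d x' y' → H.IsLink d' x' y' →
        d ≠ d' → (d = e ∧ d' = e' ∨ d = g ∧ d' = g') →
        (∀ f, f = e ∨ f = e' ∨ f = g ∨ f = g' → H.IsLink f x' y' → f = d ∨ f = d') →
        {f | H.IsLink f x y ∧ Sum.inr f ∈ ((weights W e e' g g' : Finset (α ⊕ β)) :
          Set (α ⊕ β))} = {d, d'} := by
      intro x' y' d d' h1 hd hd' hne hdd h2
      have hxy : ∀ f, H.IsLink f x y ↔ H.IsLink f x' y' := by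
        rcases hf.eq_and_eq_or_eq_and_eq h1 with ⟨rfl, rfl⟩ | ⟨rfl, rfl⟩
        · exact fun f => Iff.rfl
        · exact fun f => isLink_comm
      ext k
      simp only [Set.mem_ofPred_eq, hxy, Finset.mem_coe, inr_mem_weights, Set.mem_insert_iff,
        Set.mem_singleton_iff]
      constructor
      · exact fun h => h2 k h.2 h.1
      · rintro (rfl | rfl)
        · exact ⟨hd, by tauto⟩
        · exact ⟨hd', by tauto⟩
    rcases h.mult f hm with h1 | h1
    · rw [key h1 h.he h.he' h.ne (Or.inl ⟨rfl, rfl⟩) fun f hf => (h.cross f hf).1,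
        Set.ncard_pair h.ne]
      exact ⟨⟨e, by simp⟩, even_two⟩
    · rw [key h1 h.hg h.hg' h.ne' (Or.inr ⟨rfl, rfl⟩) fun f hf => (h.cross f hf).2,
        Set.ncard_pair h.ne']
      exact ⟨⟨g, by simp⟩, even_two⟩

end TwoBundles

end Graph

/-! ### The interval that obstructs shellability -/

namespace Graph

open Relation

variable {α β : Type*} [DecidableEq α] [DecidableEq β] {G H : Graph α β}

namespace TwoBundles

variable {U W : Finset α} {u v a b : α} {e e' g g' : β} {x N : Finset (α ⊕ β)} {m m' ρ ρ' : α ⊕ β}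

/-- `l` lists the new elements of odd weight and `N` contains vertices needed for legality or
connection. All of them lie in the component of `r`, so only the parity of `l` matters. -/
lemma evenOn_union {A : Finset (α ⊕ β)} (hx : EvenOn H.elemAdj A x) {l : List (α ⊕ β)}
    (hl : l.Nodup) (hlA : ∀ p ∈ l, p ∈ A) (hev : Even l.length) (hlx : ∀ p ∈ l, p ∉ x)
    (hNx : ∀ p ∈ N, p ∉ x) (hN : ∀ p ∈ N, p ∈ A → p ∈ l) {r : α ⊕ β} (hr : r ∈ l)
    (hlr : ∀ q ∈ l, ReachIn H.elemAdj (x ∪ (l.toFinset ∪ N)) r q)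
    (hNr : ∀ q ∈ N, ReachIn H.elemAdj (x ∪ (l.toFinset ∪ N)) r q) :
    EvenOn H.elemAdj A (x ∪ (l.toFinset ∪ N)) := by
  refine hx.union_of_reachIn H.elemAdj_symm ?_ ?_ (r := r) (by simp [hr]) ?_
  · rw [Finset.disjoint_right]
    intro p hp
    rcases Finset.mem_union.1 hp with hp | hp
    · exact hlx p (by simpa using hp)
    · exact hNx p hp
  · have : (l.toFinset ∪ N) ∩ A = l.toFinset := by
      ext p
      simp only [Finset.mem_inter, Finset.mem_union, List.mem_toFinset]
      exact ⟨fun h => h.1.elim id fun h' => hN p h' h.2, fun h => ⟨Or.inl h, hlA p h⟩⟩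
    rw [this, List.toFinset_card_of_nodup hl]
    exact hev
  · intro q hq
    rcases Finset.mem_union.1 hq with hq | hq
    · exact hlr q (by simpa using hq)
    · exact hNr q hq

/-- The obstruction to shellability, in terms of vertices and edges. -/
theorem not_posetShellable (h : TwoBundles G H U u v a b e e' g g') (hE : E(G).Finite) (hW : W ⊆ U)
    (hUW : ∀ z ∈ U, z ∉ W → z = u ∨ z = v ∨ z = a ∨ z = b)
    (hU : EvenOn H.elemAdj (weights W e e' g g') (U.map Function.Embedding.inl))
    (hx : EvenOn H.elemAdj (weights W e e' g g') x)
    (hxU : ∀ p ∈ x, ∃ z ∈ U, p = Sum.inl z) (hNU : ∀ p ∈ N, ∃ z ∈ U, p = Sum.inl z)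
    (huW : u ∈ W) (hvW : v ∈ W) (hm : m ∈ weights W e e' g g') (hm' : m' ∈ weights W e e' g g')
    (hρ : ρ = Sum.inl u ∨ ρ = Sum.inl v) (hρ' : ρ' = Sum.inl u ∨ ρ' = Sum.inl v)
    (hnd : [Sum.inl u, Sum.inl v, Sum.inr e, Sum.inr e', m, m'].Nodup)
    (hux : Sum.inl u ∉ x) (hvx : Sum.inl v ∉ x) (hmx : m ∉ x) (hmx' : m' ∉ x)
    (hNx : ∀ p ∈ N, p ∉ x)
    (hN : ∀ p ∈ N, p ∈ weights W e e' g g' → p = ρ ∧ p = ρ' ∧ p = Sum.inl u)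
    (hr : ∀ S, x ⊆ S → N ⊆ S → ρ ∈ S → m ∈ S →
      ReachIn H.elemAdj S ρ m ∧ ∀ q ∈ N, ReachIn H.elemAdj S ρ q)
    (hr' : ∀ S, x ⊆ S → N ⊆ S → ρ' ∈ S → m' ∈ S →
      ReachIn H.elemAdj S ρ' m' ∧ ∀ q ∈ N, ReachIn H.elemAdj S ρ' q)
    (hNm : ∀ S, H.LegalSet S → x ⊆ S →
      S ⊆ x ∪ ([Sum.inl u, Sum.inl v, Sum.inr e, Sum.inr e', m, m'].toFinset ∪ N) →
      ∀ p ∈ N, p ∈ S ↔ m ∈ S ∨ m' ∈ S)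
    (hl0 : H.LegalSet x) (hl1 : H.LegalSet (x ∪ ([ρ, m].toFinset ∪ N)))
    (hl2 : H.LegalSet (x ∪ ([ρ', m'].toFinset ∪ N)))
    (hl3 : H.LegalSet (x ∪ ([Sum.inl u, Sum.inl v, Sum.inr e, m].toFinset ∪ N)))
    (hl4 : H.LegalSet (x ∪ ([Sum.inl u, Sum.inl v, Sum.inr e, m'].toFinset ∪ N)))
    (hl5 : H.LegalSet (x ∪ ([Sum.inl u, Sum.inl v, Sum.inr e, Sum.inr e', m, m'].toFinset ∪ N))) :
    ∃ p ∈ G.admissiblePairs, ¬ PosetShellable (p.1.EvenPoset p.2) := by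
  refine ⟨(H, (weights W e e' g g' : Finset (α ⊕ β))),
    ⟨h.isPIGraph, h.admissible hW hUW hU⟩, ?_⟩
  have hA := h.admissible hW hUW hU
  set A := weights W e e' g g' with hAdef
  have hcol : H.collection.Finite := finite_collection (by rw [h.vertexSet]; exact U.finite_toSet)
    (hE.subset h.isPIGraph.le.edgeSet_mono)
  have hT : ∀ p, p ∈ hcol.toFinset ↔ p ∈ H.collection := fun p => hcol.mem_toFinset
  set T := hcol.toFinset with hTdef
  set φ := evenPosetIso (A' := A) hT hA.1 fun p => Finset.mem_coe.symm
  have : Finite (H.EvenPoset (A : Set (α ⊕ β))) := Finite.of_injective φ φ.injective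
  have hUT : ∀ z ∈ U, Sum.inl z ∈ T := fun z hz => by
    rw [hT, inl_mem_collection, h.vertexSet]
    exact hz
  have hAT : ∀ p ∈ A, p ∈ T := fun p hp => (hT p).2 (hA.1 hp)
  have huA : Sum.inl u ∈ A := by simpa [hAdef] using huW
  have hvA : Sum.inl v ∈ A := by simpa [hAdef] using hvW
  have heA : Sum.inr e ∈ A := by simp [hAdef]
  have heA' : Sum.inr e' ∈ A := by simp [hAdef]
  have hrx : ∀ f, Sum.inr f ∉ x := fun f hf => by
    obtain ⟨z, _, hz⟩ := hxU _ hf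
    cases hz
  have hrN : ∀ f, Sum.inr f ∉ N := fun f hf => by
    obtain ⟨z, _, hz⟩ := hNU _ hf
    cases hz
  simp only [List.nodup_cons, List.mem_cons, List.not_mem_nil, or_false, not_or, List.nodup_nil,
    not_false_eq_true, and_true] at hnd
  obtain ⟨⟨h12, h13, h14, h15, h16⟩, ⟨h23, h24, h25, h26⟩, ⟨h34, h35, h36⟩, ⟨h45, h46⟩, h56⟩ := hnd
  have huv : u ≠ v := fun h => h12 (congrArg Sum.inl h)
  have hρm : ρ ≠ m ∧ ρ ≠ m' ∧ ρ ≠ Sum.inr e := by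
    rcases hρ with rfl | rfl <;> exact ⟨by assumption, by assumption, by simp⟩
  have hρm' : ρ' ≠ m ∧ ρ' ≠ m' ∧ ρ' ≠ Sum.inr e := by
    rcases hρ' with rfl | rfl <;> exact ⟨by assumption, by assumption, by simp⟩
  have hρx : ρ ∉ x := by rcases hρ with rfl | rfl <;> assumption
  have hρx' : ρ' ∉ x := by rcases hρ' with rfl | rfl <;> assumption
  have hρA : ρ ∈ A := by rcases hρ with rfl | rfl <;> assumption
  have hρA' : ρ' ∈ A := by rcases hρ' with rfl | rfl <;> assumption
  have hmN : m ∉ N := fun hmN => h15 (hN m hmN hm).2.2.symm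
  have hmN' : m' ∉ N := fun hmN => h16 (hN m' hmN hm').2.2.symm
  have hmk : ∀ l : List (α ⊕ β), (∀ p ∈ l, p ∈ A) → x ∪ (l.toFinset ∪ N) ⊆ T := by
    intro l hl p hp
    simp only [Finset.mem_union, List.mem_toFinset] at hp
    rcases hp with hp | hp | hp
    · obtain ⟨z, hz, rfl⟩ := hxU p hp
      exact hUT z hz
    · exact hAT p (hl p hp)
    · obtain ⟨z, hz, rfl⟩ := hNU p hp
      exact hUT z hz
  -- the ends and edges of the bundle are in one component
  have hends : ∀ S, Sum.inl u ∈ S → Sum.inl v ∈ S → Sum.inr e ∈ S → ∀ {ρ},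
      (ρ = Sum.inl u ∨ ρ = Sum.inl v) → ∀ p,
      (p = Sum.inl u ∨ p = Sum.inl v ∨ p = Sum.inr e ∨ p = Sum.inr e' ∧ Sum.inr e' ∈ S) →
      ReachIn H.elemAdj S ρ p := by
    intro S hu hv he ρ hρ p hp
    have hre : ReachIn H.elemAdj S ρ (Sum.inr e) := by
      rcases hρ with rfl | rfl
      · exact .of_adj h.he.inc_left he
      · exact .of_adj h.he.inc_right he
    have hru : ReachIn H.elemAdj S ρ (Sum.inl u) := hre.tail h.he.inc_left hu
    rcases hp with rfl | rfl | rfl | ⟨rfl, he'⟩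
    · exact hru
    · exact hre.tail h.he.inc_right hv
    · exact hre
    · exact hru.tail h.he'.inc_left he'
  have hs : ∀ {ρ m}, ρ ∈ A → m ∈ A → ρ ≠ m → ρ ∉ x → m ∉ x →
      (∀ p ∈ N, p ∈ A → p = ρ) →
      (∀ S, x ⊆ S → N ⊆ S → ρ ∈ S → m ∈ S →
        ReachIn H.elemAdj S ρ m ∧ ∀ q ∈ N, ReachIn H.elemAdj S ρ q) →
      EvenOn H.elemAdj A (x ∪ ([ρ, m].toFinset ∪ N)) := by
    intro ρ m hρA hmA hne hρx hmx hN hr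
    obtain ⟨r1, r2⟩ := hr (x ∪ ([ρ, m].toFinset ∪ N)) Finset.subset_union_left
      (Finset.subset_union_right.trans Finset.subset_union_right) (by simp) (by simp)
    refine evenOn_union hx (by simp [hne]) (by simp [hρA, hmA]) ⟨1, rfl⟩ (by simp [hρx, hmx]) hNx
      (fun p hp hpA => by simp [hN p hp hpA]) (r := ρ) (by simp) ?_ r2
    intro q hq
    simp only [List.mem_cons, List.not_mem_nil, or_false] at hq
    rcases hq with rfl | rfl
    · exact .refl
    · exact r1
  have ht : ∀ {ρ m}, (ρ = Sum.inl u ∨ ρ = Sum.inl v) → m ∈ A → Sum.inl u ≠ m → Sum.inl v ≠ m →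
      Sum.inr e ≠ m → m ∉ x → (∀ p ∈ N, p ∈ A → p = Sum.inl u) →
      (∀ S, x ⊆ S → N ⊆ S → ρ ∈ S → m ∈ S →
        ReachIn H.elemAdj S ρ m ∧ ∀ q ∈ N, ReachIn H.elemAdj S ρ q) →
      EvenOn H.elemAdj A (x ∪ ([Sum.inl u, Sum.inl v, Sum.inr e, m].toFinset ∪ N)) := by
    intro ρ m hρ hmA n1 n2 n3 hmx hN hr
    obtain ⟨r1, r2⟩ := hr (x ∪ ([Sum.inl u, Sum.inl v, Sum.inr e, m].toFinset ∪ N))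
      Finset.subset_union_left (Finset.subset_union_right.trans Finset.subset_union_right)
      (by rcases hρ with rfl | rfl <;> simp) (by simp)
    refine evenOn_union hx (by simp [n1, n2, n3, huv])
      (by simp [hmA, huA, hvA, heA]) ⟨2, rfl⟩
      (by simp [hux, hvx, hmx, hrx]) hNx (fun p hp hpA => by simp [hN p hp hpA]) (r := ρ)
      (by rcases hρ with rfl | rfl <;> simp) ?_ r2
    have := hends (x ∪ ([Sum.inl u, Sum.inl v, Sum.inr e, m].toFinset ∪ N)) (by simp) (by simp)
      (by simp) hρ
    intro q hq
    simp only [List.mem_cons, List.not_mem_nil, or_false] at hq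
    rcases hq with rfl | rfl | rfl | rfl
    · exact this _ (by simp)
    · exact this _ (by simp)
    · exact this _ (by simp)
    · exact r1
  have hsix : ∀ p ∈ [Sum.inl u, Sum.inl v, Sum.inr e, Sum.inr e', m, m'], p ∈ A := by
    simp [huA, hvA, heA, heA', hm, hm']
  have hsixx : ∀ p ∈ [Sum.inl u, Sum.inl v, Sum.inr e, Sum.inr e', m, m'], p ∉ x := by
    simp [hux, hvx, hmx, hmx', hrx]
  have hnd' : [Sum.inl u, Sum.inl v, Sum.inr e, Sum.inr e', m, m'].Nodup := by
    simp only [List.nodup_cons, List.mem_cons, List.not_mem_nil, or_false, not_or, List.nodup_nil,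
      not_false_eq_true, and_true]
    exact ⟨⟨h12, h13, h14, h15, h16⟩, ⟨h23, h24, h25, h26⟩, ⟨h34, h35, h36⟩, ⟨h45, h46⟩, h56⟩
  have hy : EvenOn H.elemAdj A
      (x ∪ ([Sum.inl u, Sum.inl v, Sum.inr e, Sum.inr e', m, m'].toFinset ∪ N)) := by
    set S := x ∪ ([Sum.inl u, Sum.inl v, Sum.inr e, Sum.inr e', m, m'].toFinset ∪ N) with hS
    have hNS : N ⊆ S := Finset.subset_union_right.trans Finset.subset_union_right
    obtain ⟨r1, r2⟩ := hr S Finset.subset_union_left hNS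
      (by rcases hρ with rfl | rfl <;> simp [hS]) (by simp [hS])
    obtain ⟨r3, -⟩ := hr' S Finset.subset_union_left hNS
      (by rcases hρ' with rfl | rfl <;> simp [hS]) (by simp [hS])
    have := hends S (by simp [hS]) (by simp [hS]) (by simp [hS]) hρ
    refine evenOn_union hx hnd' hsix ⟨3, rfl⟩ hsixx hNx
      (fun p hp hpA => by simp [(hN p hp hpA).2.2]) (r := ρ)
      (by rcases hρ with rfl | rfl <;> simp) ?_ r2
    rw [← hS]
    intro q hq
    simp only [List.mem_cons, List.not_mem_nil, or_false] at hq
    rcases hq with rfl | rfl | rfl | rfl | rfl | rfl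
    · exact this _ (by simp)
    · exact this _ (by simp)
    · exact this _ (by simp)
    · exact this _ (by simp [hS])
    · exact r1
    · refine (this ρ' ?_).trans r3
      rcases hρ' with rfl | rfl <;> simp
  have hmkl : ∀ l : List (α ⊕ β), (∀ p ∈ l, p ∈ A) → ∀ p, p ∈ x ∪ (l.toFinset ∪ N) ↔
      p ∈ x ∨ p ∈ l ∨ p ∈ N := fun l _ p => by simp
  -- The interval runs from `X₀` to `Y`, which adds all six elements and `N`. The chains `S₁ < T₁`
  -- and `S₂ < T₂` inside it start with an end of the bundle joined to `m` and to `m'`,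
  -- respectively, and then add the other end and an edge.
  let X₀ : H.LegalEven A T := ⟨x, fun p hp => by
    obtain ⟨z, hz, rfl⟩ := hxU p hp
    exact hUT z hz, hl0, hx⟩
  let Y : H.LegalEven A T := ⟨_, hmk _ hsix, hl5, hy⟩
  let S₁ : H.LegalEven A T := ⟨_, hmk [ρ, m] (by simp [hρA, hm]), hl1,
    hs hρA hm hρm.1 hρx hmx (fun p hp hpA => (hN p hp hpA).1) hr⟩
  let S₂ : H.LegalEven A T := ⟨_, hmk [ρ', m'] (by simp [hρA', hm']), hl2,
    hs hρA' hm' hρm'.2.1 hρx' hmx' (fun p hp hpA => (hN p hp hpA).2.1) hr'⟩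
  let T₁ : H.LegalEven A T := ⟨_, hmk [Sum.inl u, Sum.inl v, Sum.inr e, m]
    (by simp [huA, hvA, heA, hm]), hl3,
    ht hρ hm h15 h25 h35 hmx (fun p hp hpA => (hN p hp hpA).2.2) hr⟩
  let T₂ : H.LegalEven A T := ⟨_, hmk [Sum.inl u, Sum.inl v, Sum.inr e, m']
    (by simp [huA, hvA, heA, hm']), hl4,
    ht hρ' hm' h16 h26 h36 hmx' (fun p hp hpA => (hN p hp hpA).2.2) hr'⟩
  have hlt : ∀ {S S' : H.LegalEven A T}, S.1 ⊆ S'.1 → ∀ p, p ∈ S'.1 → p ∉ S.1 → S < S' :=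
    fun h p hp hp' => lt_of_le_of_ne h fun hE => hp' (hE ▸ hp)
  have hun : ∀ {l l' : List (α ⊕ β)}, l ⊆ l' →
      x ∪ (l.toFinset ∪ N) ⊆ x ∪ (l'.toFinset ∪ N) := fun {l l'} hll =>
    Finset.union_subset_union_right (Finset.union_subset_union_left fun p hp => by
      rw [List.mem_toFinset] at hp ⊢
      exact hll hp)
  have hXS : ∀ l : List (α ⊕ β), x ⊆ x ∪ (l.toFinset ∪ N) := fun l => Finset.subset_union_left
  refine not_posetShellable_of_six φ X₀ Y (hXS _) h.he h.he' h.mult_left hnd' hsix hsixx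
    ?_ ?_ ?_ ⟨S₁, T₁, hlt (hXS _) ρ ?_ ?_, hlt (hun ?_) (Sum.inr e) ?_ ?_,
      hlt (hun ?_) (Sum.inr e') ?_ ?_, ?_, ?_⟩
    ⟨S₂, T₂, hlt (hXS _) ρ' ?_ ?_, hlt (hun ?_) (Sum.inr e) ?_ ?_,
      hlt (hun ?_) (Sum.inr e') ?_ ?_, ?_⟩
  · intro p hp hpA hpx
    rcases (hmkl _ hsix p).1 hp with hp | hp | hp
    · exact absurd hp hpx
    · exact hp
    · simp [(hN p hp hpA).2.2]
  · intro f hf hfl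
    rcases (hmkl _ hsix _).1 hf with hf | hf | hf
    · exact absurd hf (hrx f)
    · exact (h.cross f (by simpa [hAdef] using hsix _ hf)).1 hfl
    · exact absurd hf (hrN f)
  -- The members of `N` are present exactly when `m` or `m'` is, so a strict inclusion is always
  -- visible on the six elements.
  · intro s t hxs hst hty
    by_contra hcon
    push Not at hcon
    refine hst.not_ge fun p hp => ?_
    rcases (hmkl _ hsix p).1 (hty hp) with hpx | hp6 | hpN
    · exact hxs hpx
    · exact hcon p hp6 hp
    · have h1 := hNm t.1 t.2.2.1 (hxs.trans hst.le) hty p hpN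
      have h2 := hNm s.1 s.2.2.1 hxs (hst.le.trans hty) p hpN
      rw [h2]
      exact (h1.1 hp).imp (fun h => hcon m (by simp) h) fun h => hcon m' (by simp) h
  · simp [S₁]
  · exact hρx
  · rcases hρ with rfl | rfl <;> simp
  · simp [T₁]
  · simp [S₁, hrx, hrN, hρm.2.2.symm, h35]
  · intro p hp
    simp only [List.mem_cons, List.not_mem_nil, or_false] at hp
    rcases hp with rfl | rfl | rfl | rfl <;> simp
  · simp [Y]
  · simp [T₁, hrx, hrN, h45, Ne.symm (fun h => h34 (congrArg Sum.inr h) : e ≠ e')]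
  · simp [S₁]
  · simp [S₁, hmx', hmN', hρm.2.1.symm, Ne.symm h56]
  · simp [S₂]
  · exact hρx'
  · rcases hρ' with rfl | rfl <;> simp
  · simp [T₂]
  · simp [S₂, hrx, hrN, hρm'.2.2.symm, h36]
  · intro p hp
    simp only [List.mem_cons, List.not_mem_nil, or_false] at hp
    rcases hp with rfl | rfl | rfl | rfl <;> simp
  · simp [Y]
  · simp [T₂, hrx, hrN, h46, Ne.symm (fun h => h34 (congrArg Sum.inr h) : e ≠ e')]
  · simp [S₂, hmx, hmN, hρm'.1.symm, h56]

end TwoBundles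

end Graph

/-! ### Connected sets of vertices -/

section EvenSets

variable {X : Type*} {adj : X → X → Prop}

/-- `W` has at most one component. -/
def ConnectedIn (adj : X → X → Prop) (W : Finset X) : Prop :=
  ∀ C, ClosedIn adj W C → C = ∅ ∨ C = W

lemma connectedIn_singleton (z : X) : ConnectedIn adj {z} :=
  fun _ hC => Finset.subset_singleton_iff.1 hC.1

lemma ConnectedIn.insert [DecidableEq X] (hs : ∀ p q, adj p q → adj q p) {W : Finset X} (hW : ConnectedIn adj W)
    {y z : X} (hy : y ∈ W) (hyz : adj y z) : ConnectedIn adj (insert z W) := by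
  intro C hC
  have hyS : y ∈ Insert.insert z W := Finset.mem_insert_of_mem hy
  rcases hW _ (hC.inter (Finset.subset_insert z W)) with h | h
  · left
    by_contra hne
    obtain ⟨p, hp⟩ := Finset.nonempty_iff_ne_empty.2 hne
    have hyC : y ∉ C := fun hyC => by
      have : y ∈ C ∩ W := Finset.mem_inter.2 ⟨hyC, hy⟩
      simp [h] at this
    rcases Finset.mem_insert.1 (hC.1 hp) with rfl | hpW
    · exact hyC (hC.mem hp hyS (hs _ _ hyz))
    · have : p ∈ C ∩ W := Finset.mem_inter.2 ⟨hp, hpW⟩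
      simp [h] at this
  · right
    have hWC : W ⊆ C := Finset.inter_eq_right.1 h
    exact hC.1.antisymm (Finset.insert_subset (hC.mem (hWC hy) (by simp) hyz) hWC)

lemma ConnectedIn.reachIn {W : Finset X} (hW : ConnectedIn adj W) {y z : X} (hy : y ∈ W)
    (hz : z ∈ W) : ReachIn adj W y z := by
  intro C hC hyC
  rcases hW C hC with rfl | rfl
  · simp at hyC
  · exact hz

end EvenSets

/-! ### Violations of unique links obstruct shellability -/

namespace Graph

open Relation

section

variable {α β : Type*} {G : Graph α β}

/-- The second edge of a bundle. -/
lemma IsMultipleEdge.exists_ne {e : β} {a b : α} (h : G.IsMultipleEdge e) (he : G.IsLink e a b) :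
    ∃ e', e ≠ e' ∧ G.IsLink e' a b := by
  obtain ⟨e', hne, x, y, h1, h2⟩ := h
  rcases he.eq_and_eq_or_eq_and_eq h1 with ⟨rfl, rfl⟩ | ⟨rfl, rfl⟩
  · exact ⟨e', hne.symm, h2⟩
  · exact ⟨e', hne.symm, h2.symm⟩

/-- A shortest connection between two disjoint sets of vertices in the same component. -/
lemma exists_connectedIn [DecidableEq α] {P Q : α → Prop} (hPQ : ∀ z, P z → ¬ Q z) {p q : α} (hp : P p) (hq : Q q)
    (hpq : ReflTransGen G.Adj p q) :
    ∃ r s, ∃ W : Finset α, P r ∧ Q s ∧ (∀ z ∈ W, ¬ P z ∧ ¬ Q z ∧ z ∈ V(G)) ∧ ConnectedIn G.Adj W ∧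
      (W = ∅ ∧ G.Adj r s ∨ (∃ w ∈ W, G.Adj r w) ∧ ∃ w ∈ W, G.Adj w s) := by
  by_contra hcon
  -- Along a walk from `p` a connected set attached to `P` is grown and started afresh after each
  -- visit to `P`. The first entrance into `Q` would be a connection.
  have key : ∀ y, ReflTransGen G.Adj p y → P y ∨ ∃ W : Finset α, y ∈ W ∧
      (∀ z ∈ W, ¬ P z ∧ ¬ Q z ∧ z ∈ V(G)) ∧ ConnectedIn G.Adj W ∧ ∃ r, P r ∧ ∃ w ∈ W, G.Adj r w := by
    intro y hy
    induction hy with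
    | refl => exact Or.inl hp
    | @tail y z _ hyz ih =>
      by_cases hPz : P z
      · exact Or.inl hPz
      right
      rcases ih with hPy | ⟨W, hyW, hW, hc, r, hr, w, hw, hrw⟩
      · by_cases hQz : Q z
        · exact absurd ⟨y, z, ∅, hPy, hQz, by simp,
            fun C hC => Or.inl (Finset.subset_empty.1 hC.1), Or.inl ⟨rfl, hyz⟩⟩ hcon
        · exact ⟨{z}, by simp, by simpa using ⟨hPz, hQz, hyz.right_mem⟩, connectedIn_singleton z, y,
            hPy, z, by simp, hyz⟩
      · by_cases hQz : Q z
        · exact absurd ⟨r, z, W, hr, hQz, hW, hc, Or.inr ⟨⟨w, hw, hrw⟩, y, hyW, hyz⟩⟩ hcon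
        · refine ⟨insert z W, by simp, ?_, hc.insert (fun _ _ h => h.symm) hyW hyz, r, hr, w,
            by simp [hw], hrw⟩
          intro z' hz'
          rcases Finset.mem_insert.1 hz' with rfl | hz'
          · exact ⟨hPz, hQz, hyz.right_mem⟩
          · exact hW z' hz'
  rcases key q hpq with h | ⟨W, hqW, hW, -⟩
  · exact hPQ q h hq
  · exact (hW q hqW).2.1 hq

end

variable {α β : Type*} [DecidableEq α] [DecidableEq β] {G H : Graph α β}

namespace TwoBundles

variable {U : Finset α} {u v a b : α} {e e' g g' : β}

lemma reachIn (h : TwoBundles G H U u v a b e e' g g') {Z : Finset α} (hZ : Z ⊆ U)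
    {S : Finset (α ⊕ β)} (hZS : ∀ z ∈ Z, Sum.inl z ∈ S) {p q : α} (hp : p ∈ Z)
    (hpq : ReachIn G.Adj Z p q) : ReachIn H.elemAdj S (Sum.inl p) (Sum.inl q) := by
  intro C hC hpC
  have := hpq (Z.filter fun z => Sum.inl z ∈ C) ⟨Finset.filter_subset _ _, fun x hx y hy hxy => ?_⟩
    (by simp [hp, hpC])
  · exact (Finset.mem_filter.1 this).2
  · simp only [Finset.mem_filter] at hx ⊢
    exact ⟨hy, hC.mem hx.2 (hZS y hy) (h.adj (hZ hx.1) (hZ hy) hxy)⟩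

lemma evenOn_map (h : TwoBundles G H U u v a b e e' g g') {Z Y : Finset α} (hZ : Z ⊆ U)
    (hev : ∀ C, ClosedIn G.Adj Z C → Even (C ∩ Y).card) :
    EvenOn H.elemAdj (weights Y e e' g g') (Z.map Function.Embedding.inl) := by
  intro C hC
  have := hev (Z.filter fun z => Sum.inl z ∈ C) ⟨Finset.filter_subset _ _, fun x hx y hy hxy => ?_⟩
  · have hset : C ∩ weights Y e e' g g' =
        ((Z.filter fun z => Sum.inl z ∈ C) ∩ Y).map (Function.Embedding.inl : α ↪ α ⊕ β) := by
      ext (z | f)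
      · simp only [Finset.mem_inter, inl_mem_weights, Finset.mem_map, Finset.mem_filter,
          Function.Embedding.inl_apply, Sum.inl.injEq, exists_eq_right]
        have : Sum.inl z ∈ C → z ∈ Z := fun hz => by simpa using hC.1 hz
        tauto
      · have : Sum.inr f ∉ C := fun hf => by simpa using hC.1 hf
        simp [this]
    rw [hset, Finset.card_map]
    exact this
  · simp only [Finset.mem_filter] at hx ⊢
    exact ⟨hy, hC.mem hx.2 (by simpa using hy) (h.adj (hZ hx.1) (hZ hy) hxy)⟩

end TwoBundles

open TwoBundles

/-- Two distinct bundles that are connected through a suitable set of vertices obstruct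
shellability. -/
lemma exists_not_posetShellable_of_two_bundles (hE : E(G).Finite) {u v s t : α} {e e' g g' : β}
    (he : G.IsLink e u v) (he' : G.IsLink e' u v) (hg : G.IsLink g s t) (hg' : G.IsLink g' s t)
    (ne : e ≠ e') (ne' : g ≠ g') (hes : ¬ G.IsLink e s t) {X Y : Finset α} (hX : ∀ z ∈ X, z ∈ V(G))
    (hs : s ∈ X) (hu : u ∉ X) (hv : v ∉ X) (ht : t ∉ X) (huv : u ≠ v) (hvt : v ≠ t)
    (hYX : ∀ z ∈ Y, z = u ∨ z = v ∨ z ∈ X) (huY : u ∈ Y) (hvY : v ∈ Y)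
    (hXY : ∀ z ∈ X, z ∉ Y → z = s) (hev : ∀ C, ClosedIn G.Adj X C → Even (C ∩ Y).card)
    (hr : ReachIn G.Adj (insert u (insert t X)) u t) :
    ∃ p ∈ G.admissiblePairs, ¬ PosetShellable (p.1.EvenPoset p.2) := by
  set U : Finset α := X ∪ {u, v, t} with hUdef
  obtain ⟨H, h⟩ := exists_twoBundles (G := G) (U := U) (e := e) (e' := e') (g := g)
    (u := u) (v := v) (a := s) (b := t) (g' := g') (fun z hz => by
      simp only [hUdef, Finset.mem_union, Finset.mem_insert, Finset.mem_singleton] at hz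
      rcases hz with hz | rfl | rfl | rfl
      · exact hX z hz
      · exact he.left_mem
      · exact he.right_mem
      · exact hg.right_mem) (by simp [hUdef]) (by simp [hUdef]) (by simp [hUdef, hs])
      (by simp [hUdef]) he he' hg hg' ne ne' (Or.inr hes)
  have hes' : ¬ G.IsLink e' s t := fun h' => hes <| by
    rcases he'.eq_and_eq_or_eq_and_eq h' with ⟨rfl, rfl⟩ | ⟨rfl, rfl⟩
    · exact he
    · exact he.symm
  have n1 : e ≠ g := fun h => hes (h ▸ hg)
  have n2 : e ≠ g' := fun h => hes (h ▸ hg')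
  have n3 : e' ≠ g := fun h => hes' (h ▸ hg)
  have n4 : e' ≠ g' := fun h => hes' (h ▸ hg')
  have hXU : X ⊆ U := Finset.subset_union_left
  have hYt : t ∈ Y → t = u := fun htY => by
    rcases hYX t htY with h | h | h
    · exact h
    · exact absurd h.symm hvt
    · exact absurd h ht
  have hreach : ∀ S : Finset (α ⊕ β), X.map Function.Embedding.inl ⊆ S → Sum.inl u ∈ S →
      Sum.inl t ∈ S → ReachIn H.elemAdj S (Sum.inl u) (Sum.inl t) := by
    intro S hXS huS htS
    refine h.reachIn (Z := insert u (insert t X)) ?_ ?_ (by simp) hr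
    · intro z hz
      simp only [Finset.mem_insert, hUdef, Finset.mem_union, Finset.mem_singleton] at hz ⊢
      tauto
    · intro z hz
      simp only [Finset.mem_insert] at hz
      rcases hz with rfl | rfl | hz
      · exact huS
      · exact htS
      · exact hXS (by simpa using hz)
  have hx := h.evenOn_map hXU hev
  have hUeq : U.map Function.Embedding.inl = X.map Function.Embedding.inl ∪
      ({u, v, t} : Finset α).map (Function.Embedding.inl : α ↪ α ⊕ β) := by
    rw [hUdef, Finset.map_union]
  have hgr : ∀ k : β, (k = g ∨ k = g') → ∀ S : Finset (α ⊕ β), X.map Function.Embedding.inl ⊆ S →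
      {Sum.inl t} ⊆ S → Sum.inl u ∈ S → Sum.inr k ∈ S →
      ReachIn H.elemAdj S (Sum.inl u) (Sum.inr k) ∧
        ∀ q ∈ ({Sum.inl t} : Finset (α ⊕ β)), ReachIn H.elemAdj S (Sum.inl u) q := by
    intro k hk S hXS hN hu hkS
    have htS : Sum.inl t ∈ S := by simpa using hN
    have := hreach S hXS hu htS
    refine ⟨this.tail ?_ hkS, by simpa using this⟩
    rcases hk with rfl | rfl
    · exact h.hg.inc_right
    · exact h.hg'.inc_right
  -- The roles of `m`, `m'` are played by two edges of the second bundle. Its end `s` is already in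
  -- `X`, so its other end `t` is present exactly when one of these edges is; `t` has even weight
  -- unless it coincides with `u`.
  refine TwoBundles.not_posetShellable (N := {Sum.inl t}) (m := Sum.inr g) (m' := Sum.inr g')
    (ρ := Sum.inl u) (ρ' := Sum.inl u) h hE (W := Y) ?_ ?_ ?_ hx ?_ ?_ huY hvY (by simp) (by simp)
    (Or.inl rfl) (Or.inl rfl) (by simp [huv, ne, ne', n1, n2, n3, n4]) (by simpa using hu)
    (by simpa using hv) (by simp) (by simp) (by simpa using ht) ?_ (hgr g (Or.inl rfl))
    (hgr g' (Or.inr rfl)) ?_ ?_ ?_ ?_ ?_ ?_ ?_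
  · intro z hz
    simp only [Finset.mem_insert, hUdef, Finset.mem_union, Finset.mem_singleton]
    have := hYX z hz
    tauto
  · intro z hz hzY
    simp only [Finset.mem_insert, hUdef, Finset.mem_union, Finset.mem_singleton] at hz
    have := fun h => hXY z h hzY
    tauto
  · rw [hUeq]
    refine hx.union_of_reachIn H.elemAdj_symm ?_ ?_ (r := Sum.inl u) (by simp) ?_
    · rw [Finset.disjoint_right]
      intro p hp
      simp only [Finset.mem_map, Finset.mem_insert, Finset.mem_singleton] at hp
      obtain ⟨z, rfl | rfl | rfl, rfl⟩ := hp <;> simpa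
    · have : ({u, v, t} : Finset α).map (Function.Embedding.inl : α ↪ α ⊕ β) ∩
          weights Y e e' g g' = {Sum.inl u, Sum.inl v} := by
        ext (z | f)
        · simp only [Finset.mem_inter, Finset.mem_map, Finset.mem_insert, Finset.mem_singleton,
            Function.Embedding.inl_apply, Sum.inl.injEq, exists_eq_right, inl_mem_weights]
          constructor
          · rintro ⟨rfl | rfl | rfl, hz⟩
            · exact Or.inl rfl
            · exact Or.inr rfl
            · exact Or.inl (hYt hz)
          · rintro (rfl | rfl)
            · exact ⟨Or.inl rfl, huY⟩
            · exact ⟨Or.inr (Or.inl rfl), hvY⟩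
        · simp
      rw [this, Finset.card_pair (by simpa using huv)]
      exact ⟨1, rfl⟩
    · intro q hq
      simp only [Finset.mem_map, Finset.mem_insert, Finset.mem_singleton] at hq
      obtain ⟨z, rfl | rfl | rfl, rfl⟩ := hq
      · exact .refl
      · exact .of_adj (show H.Adj u z from ⟨e, h.he⟩) (by simp)
      · exact hreach _ Finset.subset_union_left (by simp) (by simp)
  · intro p hp
    obtain ⟨z, hz, rfl⟩ := Finset.mem_map.1 hp
    exact ⟨z, hXU hz, rfl⟩
  · intro p hp
    exact ⟨t, by simp [hUdef], by simpa using hp⟩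
  · intro p hp hpY
    rw [Finset.mem_singleton] at hp
    subst hp
    have := hYt (by simpa using hpY)
    simp [this]
  · intro S hS hXS hSsub p hp
    rw [Finset.mem_singleton] at hp
    subst hp
    constructor
    · intro htS
      obtain ⟨f, hf, hfl⟩ := hS.2 g s t h.mult_right h.hg (hXS (by simpa using hs)) htS
      have := hSsub hf
      simp only [Finset.mem_union, Finset.mem_map, List.mem_toFinset, List.mem_cons,
        Function.Embedding.inl_apply, reduceCtorEq, and_false, exists_false, Sum.inr.injEq,
        false_or, List.not_mem_nil, or_false, Finset.mem_singleton] at this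
      have hfl' := hfl.mono h.isPIGraph.le
      rcases this with rfl | rfl | rfl | rfl
      · exact absurd hfl' hes
      · exact absurd hfl' hes'
      · exact Or.inl hf
      · exact Or.inr hf
    · rintro (hgS | hgS)
      · exact hS.1 g t hgS h.hg.inc_right
      · exact hS.1 g' t hgS h.hg'.inc_right
  · exact h.legalSet (by simp) (by simp [hu]) (by simp [ht])
  · exact h.legalSet (by simp [hs]) (by simp [huv.symm, hv, hvt]) (by simp)
  · exact h.legalSet (by simp [hs]) (by simp [huv.symm, hv, hvt]) (by simp)
  · exact h.legalSet (by simp [hs]) (by simp) (by simp)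
  · exact h.legalSet (by simp [hs]) (by simp) (by simp)
  · exact h.legalSet (by simp [hs]) (by simp) (by simp)

/-- Two bundles that share one vertex obstruct shellability. -/
lemma exists_not_posetShellable_of_shared [G.Loopless] (hE : E(G).Finite) {u v b : α}
    {e e' g g' : β} (he : G.IsLink e u v) (he' : G.IsLink e' u v) (hg : G.IsLink g u b)
    (hg' : G.IsLink g' u b) (ne : e ≠ e') (ne' : g ≠ g') (hvb : v ≠ b) :
    ∃ p ∈ G.admissiblePairs, ¬ PosetShellable (p.1.EvenPoset p.2) := by
  have huv : u ≠ v := he.adj.ne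
  have hub : u ≠ b := hg.adj.ne
  -- Here `s = b` and `t = u`. The vertex `b` may be given even weight because it is an end of a
  -- bundle.
  refine exists_not_posetShellable_of_two_bundles hE (X := {b}) (Y := {u, v}) he he' hg.symm
    hg'.symm ne ne' ?_ (by simpa using hg.right_mem) (by simp) (by simpa using hub)
    (by simpa using hvb) (by simpa using hub) huv huv.symm (by simp) (by simp) (by simp)
    (by simp) (fun C hC => ?_) .refl
  · intro h
    rcases he.eq_and_eq_or_eq_and_eq h with ⟨h1, -⟩ | ⟨-, h1⟩
    · exact hub h1
    · exact hvb h1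
  · have : C ∩ {u, v} = ∅ := by
      ext z
      simp only [Finset.mem_inter, Finset.mem_insert, Finset.mem_singleton, Finset.notMem_empty,
        iff_false, not_and, not_or]
      intro hz
      have := Finset.mem_singleton.1 (hC.1 hz)
      subst this
      exact ⟨hub.symm, hvb.symm⟩
    simp [this]

/-- Two disjoint bundles in the same component obstruct shellability. -/
lemma exists_not_posetShellable_of_disjoint [G.Loopless] (hE : E(G).Finite) {u v a b : α}
    {e e' g g' : β} (he : G.IsLink e u v) (he' : G.IsLink e' u v) (hg : G.IsLink g a b)
    (hg' : G.IsLink g' a b) (ne : e ≠ e') (ne' : g ≠ g')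
    (hd : ∀ z, z = u ∨ z = v → ¬ (z = a ∨ z = b)) (hua : ReflTransGen G.Adj u a) :
    ∃ p ∈ G.admissiblePairs, ¬ PosetShellable (p.1.EvenPoset p.2) := by
  obtain ⟨r, q, W, hr, hq, hW, hc, hadj⟩ := exists_connectedIn hd (Or.inl rfl) (Or.inl rfl) hua
  clear hua
  wlog hru : r = u generalizing u v
  · exact this he.symm he'.symm (fun z hz => hd z hz.symm) hr.symm
      (fun z hz => ⟨fun h => (hW z hz).1 h.symm, (hW z hz).2⟩) (hr.resolve_left hru)
  wlog hqa : q = a generalizing a b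
  · exact this hg.symm hg'.symm hq.symm (fun z hz h => hd z hz h.symm)
      (fun z hz => ⟨(hW z hz).1, fun h => (hW z hz).2.1 h.symm, (hW z hz).2.2⟩)
      (hq.resolve_left hqa)
  subst hru hqa
  clear hr hq
  have hrv : r ≠ v := he.adj.ne
  have hqb : q ≠ b := hg.adj.ne
  have hrq : r ≠ q ∧ r ≠ b := by simpa using hd r (Or.inl rfl)
  have hvq : v ≠ q ∧ v ≠ b := by simpa using hd v (Or.inr rfl)
  have hWr : r ∉ W := fun h => (hW r h).1 (Or.inl rfl)
  have hWv : v ∉ W := fun h => (hW v h).1 (Or.inr rfl)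
  have hWq : q ∉ W := fun h => (hW q h).2.1 (Or.inl rfl)
  have hWb : b ∉ W := fun h => (hW b h).2.1 (Or.inr rfl)
  have hlink : ¬ G.IsLink e q b := fun h => by
    rcases he.eq_and_eq_or_eq_and_eq h with ⟨h1, -⟩ | ⟨h1, -⟩
    · exact hrq.1 h1
    · exact hrq.2 h1
  have hreach : ∀ Z : Finset α, W ⊆ Z → q ∈ Z → ReachIn G.Adj Z r q := by
    intro Z hWZ hqZ
    rcases hadj with ⟨-, h⟩ | ⟨⟨w, hw, h⟩, w', hw', h'⟩
    · exact .of_adj h hqZ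
    · exact (ReachIn.of_adj h (hWZ hw)).trans <| ((hc.reachIn hw hw').mono hWZ hw).tail h' hqZ
  -- The starting set must be even. For even `W` the far end `b` is added with even weight and `q`
  -- comes in with the second bundle. For odd `W` the near end `q` is added with odd weight and the
  -- roles of `q` and `b` are exchanged.
  rcases Nat.even_or_odd W.card with hev | hodd
  · refine exists_not_posetShellable_of_two_bundles hE (X := insert b W)
      (Y := insert r (insert v W)) he he' hg.symm hg'.symm ne ne' (fun h => hlink h.symm) ?_
      (by simp) (by simp [hrq.2, hWr]) (by simp [hvq.2, hWv]) (by simp [hqb, hWq]) hrv hvq.1 ?_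
      (by simp) (by simp) ?_ ?_ (hreach _ (by intro; simp; tauto) (by simp))
    · intro z hz
      rcases Finset.mem_insert.1 hz with rfl | hz
      · exact hg.right_mem
      · exact (hW z hz).2.2
    · intro z hz
      simp only [Finset.mem_insert] at hz ⊢
      tauto
    · intro z hz hz'
      simp only [Finset.mem_insert] at hz hz'
      tauto
    · intro C hC
      have hset : C ∩ insert r (insert v W) = C ∩ W := by
        ext z
        simp only [Finset.mem_inter, Finset.mem_insert]
        have : z ∈ C → z = b ∨ z ∈ W := fun h => Finset.mem_insert.1 (hC.1 h)
        have h1 : z = b → z ≠ r ∧ z ≠ v := by rintro rfl; exact ⟨hrq.2.symm, hvq.2.symm⟩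
        have h2 : z ∈ W → z ≠ r ∧ z ≠ v := fun h => by simpa using (hW z h).1
        tauto
      rw [hset]
      rcases hc _ (hC.inter (Finset.subset_insert b W)) with h | h <;> simp [h, hev]
  · have hne : W ≠ ∅ := by rintro rfl; simp at hodd
    obtain ⟨-, w, hw, hwq⟩ := hadj.resolve_left fun h => hne h.1
    refine exists_not_posetShellable_of_two_bundles hE (X := insert q W)
      (Y := insert r (insert v (insert q W))) he he' hg hg' ne ne' hlink ?_
      (by simp) (by simp [hrq.1, hWr]) (by simp [hvq.1, hWv]) (by simp [hqb.symm, hWb]) hrv hvq.2 ?_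
      (by simp) (by simp) ?_ ?_
      ((hreach _ (by intro; simp; tauto) (by simp)).tail hg.adj (by simp))
    · intro z hz
      rcases Finset.mem_insert.1 hz with rfl | hz
      · exact hg.left_mem
      · exact (hW z hz).2.2
    · intro z hz
      simp only [Finset.mem_insert] at hz ⊢
      tauto
    · intro z hz hz'
      simp only [Finset.mem_insert] at hz hz'
      tauto
    · intro C hC
      have hset : C ∩ insert r (insert v (insert q W)) = C := by
        refine Finset.inter_eq_left.2 fun z hz => ?_
        have := hC.1 hz
        simp only [Finset.mem_insert] at this ⊢
        tauto
      rw [hset]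
      rcases (hc.insert (fun _ _ h => h.symm) hw hwq) C hC with h | h
      · simp [h]
      · rw [h, Finset.card_insert_of_notMem hWq]
        exact hodd.add_one

/-- Two vertices linked to a bundle over the same set of vertices with even components obstruct
shellability. -/
lemma exists_not_posetShellable_of_linkedOver [G.Loopless] (hE : E(G).Finite) {u v r r' c c' : α}
    {e e' : β} (he : G.IsLink e u v) (he' : G.IsLink e' u v) (ne : e ≠ e') {W : Finset α}
    (hW : ∀ w ∈ W, w ∈ V(G)) (hu : u ∉ W) (hv : v ∉ W)
    (hev : ∀ C, ClosedIn G.Adj W C → Even C.card) (hr : r = u ∨ r = v) (hr' : r' = u ∨ r' = v)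
    (hc : c ∉ W) (hc' : c' ∉ W) (hcu : c ≠ u) (hcv : c ≠ v) (hcu' : c' ≠ u) (hcv' : c' ≠ v)
    (hl : LinkedOver G.Adj W r c) (hl' : LinkedOver G.Adj W r' c') (hcc : c ≠ c') :
    ∃ p ∈ G.admissiblePairs, ¬ PosetShellable (p.1.EvenPoset p.2) := by
  have huv : u ≠ v := he.adj.ne
  have hlV : ∀ {r c}, LinkedOver G.Adj W r c → c ∈ V(G) := by
    rintro r c ⟨z, -, hz⟩
    exact hz.right_mem
  set U : Finset α := W ∪ {u, v, c, c'} with hUdef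
  obtain ⟨H, h⟩ := exists_twoBundles (G := G) (U := U) (fun z hz => by
      simp only [hUdef, Finset.mem_union, Finset.mem_insert, Finset.mem_singleton] at hz
      rcases hz with hz | rfl | rfl | rfl | rfl
      · exact hW z hz
      · exact he.left_mem
      · exact he.right_mem
      · exact hlV hl
      · exact hlV hl') (by simp [hUdef]) (by simp [hUdef]) (by simp [hUdef])
      (by simp [hUdef]) he he' he he' ne ne (Or.inl ⟨rfl, rfl⟩)
  have hWU : W ⊆ U := Finset.subset_union_left
  have hreach : ∀ {r c}, (r = u ∨ r = v) → c ∈ U → LinkedOver G.Adj W r c →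
      ∀ S : Finset (α ⊕ β), W.map Function.Embedding.inl ⊆ S → ∅ ⊆ S → Sum.inl r ∈ S →
      Sum.inl c ∈ S → ReachIn H.elemAdj S (Sum.inl r) (Sum.inl c) ∧
        ∀ q ∈ (∅ : Finset (α ⊕ β)), ReachIn H.elemAdj S (Sum.inl r) q := by
    intro r c hr hcU hl S hWS _ hrS hcS
    refine ⟨h.reachIn (Z := insert c (insert r W)) ?_ ?_ (by simp)
      fun C hC hrC => hl.mem hC (Finset.subset_insert _ _) (by simp) hrC, by simp⟩
    · intro z hz
      simp only [Finset.mem_insert] at hz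
      rcases hz with rfl | rfl | hz
      · exact hcU
      · rcases hr with rfl | rfl <;> simp [hUdef]
      · exact hWU hz
    · intro z hz
      simp only [Finset.mem_insert] at hz
      rcases hz with rfl | rfl | hz
      · exact hcS
      · exact hrS
      · exact hWS (by simpa using hz)
  have hrc := hreach hr (by simp [hUdef]) hl
  have hrc' := hreach hr' (by simp [hUdef]) hl'
  have hx : EvenOn H.elemAdj (weights U e e' e e') (W.map Function.Embedding.inl) :=
    h.evenOn_map hWU fun C hC => by
      rw [Finset.inter_eq_left.2 (hC.1.trans hWU)]
      exact hev C hC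
  -- Now the two linked vertices are `m` and `m'`, all vertices have odd weight, and the second
  -- bundle of `TwoBundles` is the first one again.
  refine TwoBundles.not_posetShellable (N := ∅) (m := Sum.inl c) (m' := Sum.inl c')
    (ρ := Sum.inl r) (ρ' := Sum.inl r') h hE (W := U) subset_rfl (fun z hz hz' => absurd hz hz') ?_
    hx ?_ (by simp) (by simp [hUdef]) (by simp [hUdef]) (by simp [hUdef]) (by simp [hUdef])
    (by simpa using hr) (by simpa using hr')
    (by simp [huv, ne, hcu.symm, hcv.symm, hcu'.symm, hcv'.symm, hcc]) (by simpa using hu)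
    (by simpa using hv) (by simpa using hc) (by simpa using hc') (by simp) (by simp) hrc hrc'
    (by simp) ?_ ?_ ?_ ?_ ?_ ?_
  · rw [hUdef, Finset.map_union, ← hUdef]
    refine hx.union_of_reachIn H.elemAdj_symm ?_ ?_ (r := Sum.inl u) (by simp) ?_
    · rw [Finset.disjoint_right]
      intro p hp
      simp only [Finset.mem_map, Finset.mem_insert, Finset.mem_singleton] at hp
      obtain ⟨z, rfl | rfl | rfl | rfl, rfl⟩ := hp <;> simpa
    · have : ({u, v, c, c'} : Finset α).map (Function.Embedding.inl : α ↪ α ⊕ β) ∩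
          weights U e e' e e' = ({u, v, c, c'} : Finset α).map Function.Embedding.inl := by
        refine Finset.inter_eq_left.2 fun p hp => ?_
        obtain ⟨z, hz, rfl⟩ := Finset.mem_map.1 hp
        exact inl_mem_weights.2 (Finset.mem_union_right W hz)
      rw [this, Finset.card_map]
      rw [Finset.card_insert_of_notMem (by simp [huv, hcu.symm, hcu'.symm]),
        Finset.card_insert_of_notMem (by simp [hcv.symm, hcv'.symm]), Finset.card_pair hcc]
      exact ⟨2, rfl⟩
    · set S : Finset (α ⊕ β) := W.map Function.Embedding.inl ∪
        ({u, v, c, c'} : Finset α).map (Function.Embedding.inl : α ↪ α ⊕ β) with hS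
      have huv' : ∀ z, (z = u ∨ z = v) → ReachIn H.elemAdj S (Sum.inl u) (Sum.inl z) := by
        rintro z (rfl | rfl)
        · exact .refl
        · exact .of_adj (show H.Adj u z from ⟨e, h.he⟩) (by simp [hS])
      intro q hq
      simp only [Finset.mem_map, Finset.mem_insert, Finset.mem_singleton] at hq
      obtain ⟨z, rfl | rfl | rfl | rfl, rfl⟩ := hq
      · exact .refl
      · exact huv' _ (Or.inr rfl)
      · exact (huv' r hr).trans (hrc S Finset.subset_union_left (by simp)
          (by rcases hr with rfl | rfl <;> simp [hS]) (by simp [hS])).1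
      · exact (huv' r' hr').trans (hrc' S Finset.subset_union_left (by simp)
          (by rcases hr' with rfl | rfl <;> simp [hS]) (by simp [hS])).1
  · intro p hp
    obtain ⟨z, hz, rfl⟩ := Finset.mem_map.1 hp
    exact ⟨z, hWU hz, rfl⟩
  · exact h.legalSet (by simp) (by simp [hu]) (by simp [hu])
  · have : ∀ hs : Sum.inl u ∈ W.map Function.Embedding.inl ∪
        ([Sum.inl r, Sum.inl c].toFinset ∪ (∅ : Finset (α ⊕ β))), Sum.inl v ∉
        W.map Function.Embedding.inl ∪
        ([Sum.inl r, Sum.inl c].toFinset ∪ (∅ : Finset (α ⊕ β))) := by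
      rcases hr with rfl | rfl <;> simp [hu, hv, huv, huv.symm, hcu.symm, hcv.symm]
    exact h.legalSet (by simp) (fun h1 h2 => absurd h2 (this h1)) fun h1 h2 => absurd h2 (this h1)
  · have : ∀ hs : Sum.inl u ∈ W.map Function.Embedding.inl ∪
        ([Sum.inl r', Sum.inl c'].toFinset ∪ (∅ : Finset (α ⊕ β))), Sum.inl v ∉
        W.map Function.Embedding.inl ∪
        ([Sum.inl r', Sum.inl c'].toFinset ∪ (∅ : Finset (α ⊕ β))) := by
      rcases hr' with rfl | rfl <;> simp [hu, hv, huv, huv.symm, hcu'.symm, hcv'.symm]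
    exact h.legalSet (by simp) (fun h1 h2 => absurd h2 (this h1)) fun h1 h2 => absurd h2 (this h1)
  · exact h.legalSet (by simp) (by simp) (by simp)
  · exact h.legalSet (by simp) (by simp) (by simp)
  · exact h.legalSet (by simp) (by simp) (by simp)

/-- Two distinct bundles in one component share exactly one vertex or are disjoint, and both
configurations are obstructions; so are two vertices linked to one bundle. -/
theorem hasUniqueLinks_of_posetShellable [G.Loopless] (hE : E(G).Finite)
    (h : ∀ p ∈ G.admissiblePairs, PosetShellable (p.1.EvenPoset p.2)) : G.HasUniqueLinks := by
  have hno : ¬ ∃ p ∈ G.admissiblePairs, ¬ PosetShellable (p.1.EvenPoset p.2) :=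
    fun ⟨p, hp, h'⟩ => h' (h p hp)
  constructor
  · intro e f a b c d he hf hab hcd hac
    obtain ⟨e', ne, hab'⟩ := he.exists_ne hab
    obtain ⟨f', ne', hcd'⟩ := hf.exists_ne hcd
    have hshare : ∀ {u v b}, G.IsLink e u v → G.IsLink f u b → v = b := by
      intro u v b h1 h2
      obtain ⟨e', ne, h1'⟩ := he.exists_ne h1
      obtain ⟨f', ne', h2'⟩ := hf.exists_ne h2
      by_contra hvb
      exact hno (exists_not_posetShellable_of_shared hE h1 h1' h2 h2' ne ne' hvb)
    by_cases h1 : a = c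
    · subst h1
      rwa [hshare hab hcd]
    by_cases h2 : a = d
    · subst h2
      rw [hshare hab hcd.symm]
      exact hcd.symm
    by_cases h3 : b = c
    · subst h3
      rw [hshare hab.symm hcd]
      exact hcd.symm
    by_cases h4 : b = d
    · subst h4
      rwa [hshare hab.symm hcd.symm]
    refine absurd (exists_not_posetShellable_of_disjoint hE hab hab' hcd hcd' ne ne' ?_ hac) hno
    rintro z (rfl | rfl) <;> simp [h1, h2, h3, h4]
  · intro e u v he huv W hW hu hv hev r r' c c' hr hr' hc hc' hcu hcv hcu' hcv' hl hl'
    obtain ⟨e', ne, huv'⟩ := he.exists_ne huv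
    by_contra hcc
    exact hno (exists_not_posetShellable_of_linkedOver hE huv huv' ne hW hu hv hev hr hr' hc hc' hcu
      hcv hcu' hcv' hl hl' hcc)

end Graph

/-! ### The six families -/

section EvenSets

variable {X : Type*} [DecidableEq X] {adj : X → X → Prop}

lemma LinkedOver.mem_of_closed {S : Set X} (hcl : ∀ x ∈ S, ∀ y, adj x y → y ∈ S) {W : Finset X}
    {r c : X} (hr : r ∈ S) (hl : LinkedOver adj W r c) : c ∈ S := by
  classical
  obtain ⟨z, hz, hzc⟩ := hl
  have : z ∈ (insert r W).filter (· ∈ S) := by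
    refine compIn_subset_of_closedIn ⟨Finset.filter_subset _ _, fun x hx y hy hxy => ?_⟩
      (by simpa using hr) hz
    simp only [Finset.mem_filter] at hx ⊢
    exact ⟨hy, hcl x hx.2 y hxy⟩
  exact hcl z (Finset.mem_filter.1 this).2 c hzc

/-- In a vertex numbering where edges jump over no number `k ≥ 2` except `n - 2`, with `n` odd,
there is at most one vertex linked to the vertices `0` and `1`. -/
lemma eq_of_linkedOver {S : Set X} {pos : X → ℕ} {n : ℕ} (hinj : Set.InjOn pos S)
    (hn : ∀ x ∈ S, pos x < n) (hcl : ∀ x ∈ S, ∀ y, adj x y → y ∈ S)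
    (hjump : ∀ x ∈ S, ∀ y, adj x y → ∀ k, 2 ≤ k → pos x < k → k < pos y → k + 2 = n ∧ Odd n)
    {W : Finset X} (hW : ∀ w ∈ W, w ∈ S → 2 ≤ pos w) (hev : ∀ C, ClosedIn adj W C → Even C.card)
    {r r' c c' : X} (hr : r ∈ S) (hr' : r' ∈ S) (hpr : pos r < 2) (hpr' : pos r' < 2)
    (hc : c ∉ W) (hc' : c' ∉ W) (hpc : 2 ≤ pos c) (hpc' : 2 ≤ pos c')
    (hl : LinkedOver adj W r c) (hl' : LinkedOver adj W r' c') : c = c' := by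
  classical
  have hcS := hl.mem_of_closed hcl hr
  have hcS' := hl'.mem_of_closed hcl hr'
  wlog hlt : pos c ≤ pos c' generalizing r r' c c'
  · exact (this hr' hr hpr' hpr hc' hc hpc' hpc hl' hl hcS' hcS (le_of_not_ge hlt)).symm
  by_contra hne
  replace hlt : pos c < pos c' := lt_of_le_of_ne hlt fun h => hne (hinj hcS hcS' h)
  -- A link from the bundle to `c'` must pass every number in between. It can do so only through a
  -- vertex of `W`, or by jumping, which is possible only at `n - 2`.
  have hcut : ∀ k, 2 ≤ k → k < pos c' → (k + 2 = n ∧ Odd n) ∨ ∃ w ∈ W, w ∈ S ∧ pos w = k := by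
    intro k hk hkc
    by_contra hcon
    rw [not_or] at hcon
    obtain ⟨z, hz, hzc⟩ := hl'
    have : z ∈ (insert r' W).filter fun x => x ∈ S ∧ pos x < k := by
      refine compIn_subset_of_closedIn ⟨Finset.filter_subset _ _, fun x hx y hy hxy => ?_⟩
        (by simpa using ⟨hr', hpr'.trans_le hk⟩) hz
      simp only [Finset.mem_filter] at hx ⊢
      have hyS := hcl x hx.2.1 y hxy
      refine ⟨hy, hyS, ?_⟩
      by_contra hky
      rcases (not_lt.1 hky).eq_or_lt with h | h
      · rcases Finset.mem_insert.1 hy with rfl | hyW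
        · omega
        · exact hcon.2 ⟨y, hyW, hyS, h.symm⟩
      · exact hcon.1 (hjump x hx.2.1 y hxy k hk hx.2.2 h)
    obtain ⟨-, hzS, hzk⟩ := Finset.mem_filter.1 this
    exact hcon.1 (hjump z hzS c' hzc k hk hzk hkc)
  -- Since `c` is not in `W`, it has number `n - 2`, and so `c'` has number `n - 1`.
  have hcn := (hcut (pos c) hpc hlt).resolve_right fun ⟨w, hw, hwS, h⟩ => by
    rw [hinj hwS hcS h] at hw
    exact hc hw
  have hcn' := hn c' hcS'
  -- Hence `W` occupies exactly the numbers from `2` to `n - 3`. There are `n - 4` of them, an odd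
  -- number, although this part of `W` is a union of components of even size.
  have himg : (W.filter (· ∈ S)).image pos = Finset.Ico 2 (n - 2) := by
    ext k
    simp only [Finset.mem_image, Finset.mem_filter, Finset.mem_Ico]
    constructor
    · rintro ⟨w, ⟨hw, hwS⟩, rfl⟩
      have h1 := hW w hw hwS
      have h2 := hn w hwS
      have h3 : pos w ≠ pos c := fun h => hc (hinj hwS hcS h ▸ hw)
      have h4 : pos w ≠ pos c' := fun h => hc' (hinj hwS hcS' h ▸ hw)
      omega
    · rintro ⟨h1, h2⟩
      obtain ⟨w, hw, hwS, h⟩ := (hcut k h1 (by omega)).resolve_left (by omega)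
      exact ⟨w, ⟨hw, hwS⟩, h⟩
  have hcard := congrArg Finset.card himg
  rw [Finset.card_image_of_injOn fun x hx y hy h => hinj (by simpa using (Finset.mem_filter.1 hx).2)
    (by simpa using (Finset.mem_filter.1 hy).2) h, Nat.card_Ico] at hcard
  have hev' := hev (W.filter (· ∈ S)) ⟨Finset.filter_subset _ _, fun x hx y hy hxy => by
    simp only [Finset.mem_filter] at hx ⊢
    exact ⟨hy, hcl x hx.2 y hxy⟩⟩
  rw [hcard] at hev'
  obtain ⟨-, k, hk⟩ := hcn
  obtain ⟨l, hl⟩ := hev'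
  omega

end EvenSets

/-! ### The listed graphs have unique links -/

namespace Graph

open Relation

variable {α β : Type*} {C G : Graph α β}

lemma oneBundle_isLink_multiple {n m : ℕ} {R : ℕ → ℕ → Prop} {d d' : ℕ × ℕ × ℕ} {i j : ℕ}
    (h : (oneBundle n m R).IsLink d i j) (h' : (oneBundle n m R).IsLink d' i j) (hne : d ≠ d') :
    i < 2 ∧ j < 2 := by
  obtain ⟨a, b, t⟩ := d
  obtain ⟨a', b', t'⟩ := d'
  obtain ⟨⟨h1, h2, -, h3⟩, h4⟩ := h
  obtain ⟨⟨h1', h2', -, h3'⟩, h4'⟩ := h'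
  simp only [ne_eq, Prod.mk.injEq] at *
  omega

/-- The common feature of the six families: the chord jumps only over `1`, and the edge between `n -
3` and `n - 1` in the fork and triangle families jumps only over `n - 2`, with `n` odd. -/
lemma IsListed.exists_oneBundle (h : C.IsListed) : ∃ (n m : ℕ) (R : ℕ → ℕ → Prop),
    (∀ i j k, R i j → 2 ≤ k → i < k → k < j → k + 2 = n ∧ Odd n) ∧
      C.IsIsomorphic (oneBundle n m R) := by
  obtain ⟨n, m, -, ⟨-, h⟩ | ⟨-, h⟩ | ⟨-, hn, h | h | h | h⟩⟩ := h
  all_goals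
    refine ⟨n, m, _, fun i j k hR h1 h2 h3 => ?_, h⟩
    simp only [pathRel, forkRel, triangleRel, chordRel] at hR
  · omega
  · omega
  all_goals exact ⟨by omega, hn⟩

lemma IsIsomorphic.exists_numbering {n m : ℕ} {R : ℕ → ℕ → Prop}
    (h : C.IsIsomorphic (oneBundle n m R)) : ∃ pos : α → ℕ, Set.InjOn pos V(C) ∧
      (∀ x ∈ V(C), pos x < n) ∧ (∀ x y, C.Adj x y → pos x < pos y → R (pos x) (pos y)) ∧
      ∀ e x y, C.IsMultipleEdge e → C.IsLink e x y → pos x < 2 ∧ pos y < 2 := by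
  classical
  obtain ⟨f, g, hfg⟩ := h
  set pos : α → ℕ := fun x => if hx : x ∈ V(C) then (f ⟨x, hx⟩ : ℕ) else 0 with hpos
  have hp : ∀ x (hx : x ∈ V(C)), pos x = f ⟨x, hx⟩ := fun x hx => by simp [hpos, hx]
  have hlink : ∀ e x y (h : C.IsLink e x y),
      (oneBundle n m R).IsLink (g ⟨e, h.edge_mem⟩ : ℕ × ℕ × ℕ) (pos x) (pos y) := by
    intro e x y h
    rw [hp x h.left_mem, hp y h.right_mem]
    exact (hfg ⟨e, h.edge_mem⟩ ⟨x, h.left_mem⟩ ⟨y, h.right_mem⟩).1 h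
  refine ⟨pos, fun x hx y hy hxy => ?_, fun x hx => ?_, ?_, ?_⟩
  · rw [hp x hx, hp y hy] at hxy
    simpa using f.injective (Subtype.ext hxy)
  · rw [hp x hx]
    exact (f ⟨x, hx⟩).2
  · rintro x y ⟨e, he⟩ hxy
    obtain ⟨⟨h1, -, h2, -⟩, ⟨h3, h4⟩ | ⟨h3, h4⟩⟩ := hlink e x y he
    · rwa [h3, h4]
    · omega
  · rintro e x y hm he
    obtain ⟨e', hne, he'⟩ := hm.exists_ne he
    refine oneBundle_isLink_multiple (hlink e x y he) (hlink e' x y he') fun h => hne ?_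
    simpa using g.injective (Subtype.ext h)

/-- A component with a multiple edge is not simple, hence is numbered as in one of the families. Its
multiple edges then all join the numbers `0` and `1`, and uniqueness is the parity argument of
`eq_of_linkedOver`. -/
theorem hasUniqueLinks_of_isListed [DecidableEq α] [G.Loopless]
    (h : ∀ C : Graph α β, C.IsComponent G → C.Simple ∨ C.IsListed) : G.HasUniqueLinks := by
  have key : ∀ e a b, G.IsMultipleEdge e → G.IsLink e a b → ∃ (C : Graph α β) (n : ℕ) (pos : α → ℕ),
      C.IsComponent G ∧ a ∈ V(C) ∧ Set.InjOn pos V(C) ∧ (∀ x ∈ V(C), pos x < n) ∧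
      (∀ x ∈ V(C), ∀ y, G.Adj x y → ∀ k, 2 ≤ k → pos x < k → k < pos y → k + 2 = n ∧ Odd n) ∧
      ∀ f x y, x ∈ V(C) → G.IsMultipleEdge f → G.IsLink f x y →
        pos x < 2 ∧ pos y < 2 ∧ pos x ≠ pos y := by
    intro e a b hm he
    have hC := isComponent_induce he.left_mem
    set C := G.induce {b | ReflTransGen G.Adj a b}
    have haC : a ∈ V(C) := ReflTransGen.refl
    have hlist : C.IsListed := by
      refine (h C hC).resolve_left fun hs => ?_
      obtain ⟨e', hne, he'⟩ := hm.exists_ne he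
      exact hne (hs.eq_of_isLink ((hC.1.isLink_congr haC).2 he) ((hC.1.isLink_congr haC).2 he'))
    obtain ⟨n, m, R, hR, hiso⟩ := hlist.exists_oneBundle
    obtain ⟨pos, h1, h2, h3, h4⟩ := hiso.exists_numbering
    refine ⟨C, n, pos, hC, haC, h1, h2, ?_, ?_⟩
    · intro x hx y hxy k hk hxk hky
      obtain ⟨f, hf⟩ := hxy
      exact hR _ _ k (h3 x y ⟨f, (hC.1.isLink_congr hx).2 hf⟩ (hxk.trans hky)) hk hxk hky
    · intro f x y hx hm hf
      have hf' := (hC.1.isLink_congr hx).2 hf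
      obtain ⟨i1, i2⟩ := h4 f x y (hm.of_isClosedSubgraph hC.1 hf'.edge_mem) hf'
      exact ⟨i1, i2, fun h => hf.adj.ne (h1 hx hf'.right_mem h)⟩
  constructor
  · intro e f a b c d he hf hab hcd hac
    obtain ⟨C, n, pos, hC, haC, hinj, hn, -, hm⟩ := key e a b he hab
    have hcC := hC.mem_of_reflTransGen haC hac
    have hbC : b ∈ V(C) := (hC.1.mem_iff_of_adj hab.adj).1 haC
    have hdC : d ∈ V(C) := (hC.1.mem_iff_of_adj hcd.adj).1 hcC
    have h1 := hm e a b haC he hab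
    have h2 := hm f c d hcC hf hcd
    have h3 : pos a = pos c ∧ pos b = pos d ∨ pos a = pos d ∧ pos b = pos c := by omega
    rcases h3 with ⟨h3, h4⟩ | ⟨h3, h4⟩
    · rwa [hinj haC hcC h3, hinj hbC hdC h4]
    · rw [hinj haC hdC h3, hinj hbC hcC h4]
      exact hcd.symm
  · intro e u v he huv W hW hu hv hev r r' c c' hr hr' hc hc' hcu hcv hcu' hcv' hl hl'
    obtain ⟨C, n, pos, hC, huC, hinj, hn, hj, hm⟩ := key e u v he huv
    have hcl : ∀ x ∈ V(C), ∀ y, G.Adj x y → y ∈ V(C) := fun x hx y hxy =>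
      (hC.1.mem_iff_of_adj hxy).1 hx
    have hvC : v ∈ V(C) := hcl u huC v huv.adj
    obtain ⟨h1, h2, h3⟩ := hm e u v huC he huv
    have hge : ∀ x ∈ V(C), x ≠ u → x ≠ v → 2 ≤ pos x := by
      intro x hx hxu hxv
      have h4 : pos x ≠ pos u := fun h => hxu (hinj hx huC h)
      have h5 : pos x ≠ pos v := fun h => hxv (hinj hx hvC h)
      omega
    have hrr : ∀ {r}, (r = u ∨ r = v) → r ∈ V(C) ∧ pos r < 2 := by
      rintro r (rfl | rfl)
      · exact ⟨huC, h1⟩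
      · exact ⟨hvC, h2⟩
    exact eq_of_linkedOver hinj hn hcl hj
      (fun w hw hwC => hge w hwC (fun h => hu (h ▸ hw)) fun h => hv (h ▸ hw)) hev (hrr hr).1
      (hrr hr').1 (hrr hr).2 (hrr hr').2 hc hc' (hge c (hl.mem_of_closed hcl (hrr hr).1) hcu hcv)
      (hge c' (hl'.mem_of_closed hcl (hrr hr').1) hcu' hcv') hl hl'

end Graph

/-! ### From a numbering to an isomorphism -/

namespace Graph

open Relation

variable {α β : Type*} {C G : Graph α β} {p : ℕ → α} {n : ℕ}

/-- The vertices `p 0, …, p (n-1)` of `C`, with adjacency given by `R`, such that all multiple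
edges are between `p 0` and `p 1`. -/
structure IsNumbering (C : Graph α β) (n : ℕ) (R : ℕ → ℕ → Prop) (p : ℕ → α) : Prop where
  two_le : 2 ≤ n
  mem : ∀ i < n, p i ∈ V(C)
  surj : ∀ x ∈ V(C), ∃ i < n, p i = x
  inj : ∀ i < n, ∀ j < n, p i = p j → i = j
  adj : ∀ i j, i < j → j < n → (C.Adj (p i) (p j) ↔ R i j)
  mult : ∀ e f i j, i < j → j < n → C.IsLink e (p i) (p j) → C.IsLink f (p i) (p j) → e ≠ f →
    i = 0 ∧ j = 1
  bundle : ∃ e f, e ≠ f ∧ C.IsLink e (p 0) (p 1) ∧ C.IsLink f (p 0) (p 1)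

lemma exists_enumeration {B : Set β} (hB : B.Finite) (hne : B.Nonempty) : ∃ bun : ℕ → β,
    (∀ t < B.ncard, bun t ∈ B) ∧ (∀ s < B.ncard, ∀ t < B.ncard, bun s = bun t → s = t) ∧
      ∀ e ∈ B, ∃ t < B.ncard, bun t = e := by
  have hcard : hB.toFinset.card = B.ncard := (Set.ncard_eq_toFinset_card B hB).symm
  obtain ⟨b, hb⟩ := hne
  set φ := hB.toFinset.equivFinOfCardEq hcard
  refine ⟨fun t => if ht : t < B.ncard then φ.symm ⟨t, ht⟩ else b, fun t ht => ?_,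
    fun s hs t ht h => ?_, fun e he => ?_⟩
  · have := hB.mem_toFinset.1 (φ.symm ⟨t, ht⟩).2
    simpa only [ht, dif_pos] using this
  · simpa [hs, ht] using h
  · refine ⟨φ ⟨e, by simpa using he⟩, (φ _).2, by simp⟩

lemma IsNumbering.isIsomorphic [C.Loopless] {R : ℕ → ℕ → Prop} (h : C.IsNumbering n R p)
    (hE : E(C).Finite) :
    C.IsIsomorphic (oneBundle n {e | C.IsLink e (p 0) (p 1)}.ncard R) := by
  classical
  have hB : {e | C.IsLink e (p 0) (p 1)}.Finite := hE.subset fun e he => IsLink.edge_mem he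
  set m := {e | C.IsLink e (p 0) (p 1)}.ncard with hm
  obtain ⟨bun, hb1, hb2, hb3⟩ := exists_enumeration hB (h.bundle.imp fun e ⟨_, _, he, _⟩ => he)
  rw [← hm] at hb1 hb2 hb3
  have h2 := h.two_le
  -- The `t`-th edge of the bundle for `(0, 1, t)`, and the unique edge between adjacent `p i` and
  -- `p j` otherwise; the last value is a default outside the edge set.
  set φ : ℕ × ℕ × ℕ → β := fun d => if d.1 = 0 ∧ d.2.1 = 1 then bun d.2.2 else
    if hd : C.Adj (p d.1) (p d.2.1) then hd.choose else bun 0 with hφ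
  have hm0 : 0 < m := by
    obtain ⟨e, -, -, he, -⟩ := h.bundle
    exact (Set.ncard_pos hB).2 ⟨e, he⟩
  have hlink : ∀ d i j, (oneBundle n m R).IsLink d i j → C.IsLink (φ d) (p i) (p j) := by
    rintro ⟨i', j', t⟩ i j ⟨⟨h3, h4, h5, h6⟩, h7⟩
    simp only at h3 h4 h5 h6 h7
    have key : C.IsLink (φ (i', j', t)) (p i') (p j') := by
      by_cases h01 : i' = 0 ∧ j' = 1
      · obtain ⟨rfl, rfl⟩ := h01
        simpa [hφ] using hb1 t (by omega)
      · have hadj := (h.adj i' j' h3 h4).2 h5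
        simp only [hφ, h01, if_false, hadj, dif_pos]
        exact hadj.choose_spec
    rcases h7 with ⟨rfl, rfl⟩ | ⟨rfl, rfl⟩
    · exact key
    · exact key.symm
  have hmemE : ∀ d ∈ E(oneBundle n m R), (oneBundle n m R).IsLink d d.1 d.2.1 := by
    intro d hd
    obtain ⟨i, j, h3, h4⟩ := exists_isLink_of_mem_edgeSet hd
    exact ⟨h3, Or.inl ⟨rfl, rfl⟩⟩
  have hback : ∀ d ∈ E(oneBundle n m R), ∀ i < n, ∀ j < n, C.IsLink (φ d) (p i) (p j) →
      i = d.1 ∧ j = d.2.1 ∨ i = d.2.1 ∧ j = d.1 := by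
    intro d hd i hi j hj hl
    have h3 := hmemE d hd
    have h4 := h3.1
    rcases hl.eq_and_eq_or_eq_and_eq (hlink d _ _ h3) with ⟨h5, h6⟩ | ⟨h5, h6⟩
    · exact Or.inl ⟨h.inj _ hi _ (by omega) h5, h.inj _ hj _ (by omega) h6⟩
    · exact Or.inr ⟨h.inj _ hi _ (by omega) h5, h.inj _ hj _ (by omega) h6⟩
  let fV : V(oneBundle n m R) → V(C) := fun i => ⟨p i, h.mem i i.2⟩
  let fE : E(oneBundle n m R) → E(C) := fun d => ⟨φ d, (hlink d _ _ (hmemE d d.2)).edge_mem⟩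
  have hV : Function.Bijective fV := by
    constructor
    · intro i j hij
      exact Subtype.ext (h.inj i i.2 j j.2 (congrArg Subtype.val hij))
    · rintro ⟨x, hx⟩
      obtain ⟨i, hi, rfl⟩ := h.surj x hx
      exact ⟨⟨i, hi⟩, rfl⟩
  have hEb : Function.Bijective fE := by
    constructor
    · rintro ⟨d, hd⟩ ⟨d', hd'⟩ hdd
      replace hdd : φ d = φ d' := congrArg Subtype.val hdd
      have h3 := hmemE d hd
      have h3' := hmemE d' hd'
      have h4 := hback d' hd' d.1 (by have := h3.1; omega) d.2.1 (by have := h3.1; omega)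
        (hdd ▸ hlink d _ _ h3)
      have h5 := h3.1
      have h5' := h3'.1
      have h6 : d.1 = d'.1 ∧ d.2.1 = d'.2.1 := by omega
      have h7 : d.2.2 = d'.2.2 := by
        by_cases h01 : d.1 = 0 ∧ d.2.1 = 1
        · have h01' : d'.1 = 0 ∧ d'.2.1 = 1 := by omega
          simp only [hφ, h01, h01', and_self, if_true] at hdd
          exact hb2 _ (by omega) _ (by omega) hdd
        · omega
      exact Subtype.ext (Prod.ext h6.1 (Prod.ext h6.2 h7))
    · rintro ⟨e, he⟩
      obtain ⟨x, y, hxy⟩ := exists_isLink_of_mem_edgeSet he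
      obtain ⟨i, hi, rfl⟩ := h.surj x hxy.left_mem
      obtain ⟨j, hj, rfl⟩ := h.surj y hxy.right_mem
      have hij : i ≠ j := fun hij => hxy.adj.ne (by rw [hij])
      wlog hlt : i < j generalizing i j
      · exact this j hj i hi hxy.symm hij.symm (by omega)
      by_cases h01 : i = 0 ∧ j = 1
      · obtain ⟨rfl, rfl⟩ := h01
        obtain ⟨t, ht, rfl⟩ := hb3 e hxy
        have hd : (oneBundle n m R).IsLink (0, 1, t) 0 1 :=
          ⟨⟨by simp, hj, (h.adj 0 1 hlt hj).1 hxy.adj, Or.inr ⟨rfl, rfl, ht⟩⟩, Or.inl ⟨rfl, rfl⟩⟩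
        exact ⟨⟨_, hd.edge_mem⟩, Subtype.ext (by simp [fE, hφ])⟩
      · have hd : (oneBundle n m R).IsLink (i, j, 0) i j :=
          ⟨⟨hlt, hj, (h.adj i j hlt hj).1 hxy.adj, Or.inl rfl⟩, Or.inl ⟨rfl, rfl⟩⟩
        refine ⟨⟨_, hd.edge_mem⟩, Subtype.ext ?_⟩
        by_contra hne
        exact h01 (h.mult _ _ i j hlt hj (hlink _ _ _ hd) hxy hne)
  refine ⟨(Equiv.ofBijective fV hV).symm, (Equiv.ofBijective fE hEb).symm, fun e x y => ?_⟩
  obtain ⟨d, rfl⟩ := (Equiv.ofBijective fE hEb).surjective e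
  obtain ⟨i, rfl⟩ := (Equiv.ofBijective fV hV).surjective x
  obtain ⟨j, rfl⟩ := (Equiv.ofBijective fV hV).surjective y
  simp only [Equiv.symm_apply_apply]
  refine ⟨fun hl => ?_, fun hl => hlink d i j hl⟩
  exact ⟨(hmemE d d.2).1, hback d d.2 i i.2 j j.2 hl⟩

lemma IsNumbering.two_le_ncard {R : ℕ → ℕ → Prop} (h : C.IsNumbering n R p) (hE : E(C).Finite) :
    2 ≤ {e | C.IsLink e (p 0) (p 1)}.ncard := by
  obtain ⟨e, f, hne, he, hf⟩ := h.bundle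
  have hB : {e | C.IsLink e (p 0) (p 1)}.Finite := hE.subset fun e he => IsLink.edge_mem he
  exact (Set.one_lt_ncard hB).2 ⟨e, he, f, hf, hne⟩

end Graph

/-! ### Growing a path from the bundle -/

namespace Graph

open Relation

variable {α β : Type*} {C G : Graph α β} {p p' : ℕ → α} {n k : ℕ} {e : β} {u v : α}

lemma linkedOver_of_connectedIn [DecidableEq α] {adj : α → α → Prop} {W : Finset α}
    (hW : ConnectedIn adj W) {r w w' c : α} (hw : w ∈ W) (hrw : adj r w) (hw' : w' ∈ W)
    (hwc : adj w' c) : LinkedOver adj W r c := by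
  have hsub := Finset.subset_insert r W
  refine ⟨w', ?_, hwc⟩
  have h1 : w ∈ compIn adj (insert r W) r :=
    closedIn_compIn.mem (mem_compIn_self (Finset.mem_insert_self _ _)) (hsub hw) hrw
  exact (hW.reachIn hw hw').mono hsub hw _ closedIn_compIn h1

/-- Over a connected set of vertices of even size attached to a bundle there is at most one further
vertex. -/
lemma HasUniqueLinks.eq_of_connectedIn [DecidableEq α] (h : C.HasUniqueLinks)
    (he : C.IsMultipleEdge e) (huv : C.IsLink e u v) {W : Finset α} (hW : ∀ w ∈ W, w ∈ V(C))
    (hu : u ∉ W) (hv : v ∉ W) (hc : ConnectedIn C.Adj W) (hev : Even W.card) {w : α} (hw : w ∈ W)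
    (hvw : C.Adj v w) {c c' : α} (hcW : c ∉ W) (hcW' : c' ∉ W) (hcu : c ≠ u) (hcv : c ≠ v)
    (hcu' : c' ≠ u) (hcv' : c' ≠ v) (hl : C.Adj u c ∨ C.Adj v c ∨ ∃ w ∈ W, C.Adj w c)
    (hl' : C.Adj u c' ∨ C.Adj v c' ∨ ∃ w ∈ W, C.Adj w c') : c = c' := by
  have key : ∀ {c}, (C.Adj u c ∨ C.Adj v c ∨ ∃ w ∈ W, C.Adj w c) →
      ∃ r, (r = u ∨ r = v) ∧ LinkedOver C.Adj W r c := by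
    rintro c (h1 | h1 | ⟨w', hw', h1⟩)
    · exact ⟨u, Or.inl rfl, linkedOver_of_adj h1⟩
    · exact ⟨v, Or.inr rfl, linkedOver_of_adj h1⟩
    · exact ⟨v, Or.inr rfl, linkedOver_of_connectedIn hc hw hvw hw' h1⟩
  obtain ⟨r, hr, h1⟩ := key hl
  obtain ⟨r', hr', h1'⟩ := key hl'
  refine h.unique e u v he huv W hW hu hv (fun D hD => ?_) r r' c c' hr hr' hcW hcW' hcu hcv hcu'
    hcv' h1 h1'
  rcases hc D hD with rfl | rfl
  · simp
  · exact hev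

/-- Connectedness makes a set of vertices closed under adjacency the whole vertex set, and by the
first clause of `HasUniqueLinks` parallel edges can only join `p 0` and `p 1`. -/
lemma isNumbering_of_closed [DecidableEq α] (hC : C.HasUniqueLinks) (hconn : C.IsConnected)
    (he : C.IsMultipleEdge e) (h01 : C.IsLink e (p 0) (p 1)) (hn : 2 ≤ n)
    (hmem : ∀ i < n, p i ∈ V(C)) (hinj : ∀ i < n, ∀ j < n, p i = p j → i = j)
    (hcl : ∀ i < n, ∀ y, C.Adj (p i) y → ∃ j < n, p j = y) {R : ℕ → ℕ → Prop}
    (hR : ∀ i j, i < j → j < n → (C.Adj (p i) (p j) ↔ R i j)) : C.IsNumbering n R p := by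
  refine ⟨hn, hmem, fun x hx => ?_, hinj, hR, ?_, ?_⟩
  · have h := hconn.2 (p 0) (hmem 0 (by omega)) x hx
    clear hx
    induction h with
    | refl => exact ⟨0, by omega, rfl⟩
    | tail _ h ih =>
      obtain ⟨i, hi, rfl⟩ := ih
      exact hcl i hi _ h
  · intro f f' i j hij hj hf hf' hne
    have h1 := hC.isLink e f (p 0) (p 1) (p i) (p j) he ⟨f', hne.symm, _, _, hf, hf'⟩ h01 hf
      (hconn.2 _ (hmem 0 (by omega)) _ (hmem i (by omega)))
    rcases h1.eq_and_eq_or_eq_and_eq hf with ⟨h2, h3⟩ | ⟨h2, h3⟩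
    · exact ⟨(hinj _ (by omega) _ (by omega) h2).symm, (hinj _ (by omega) _ (by omega) h3).symm⟩
    · have h4 := hinj _ (by omega) _ (by omega) h2
      have h5 := hinj _ (by omega) _ (by omega) h3
      omega
  · obtain ⟨f, hne, hf⟩ := he.exists_ne h01
    exact ⟨e, f, hne, h01, hf⟩

/-- The vertices `p 0, …, p (k-1)` form a path, except that `p 0` and `p 2` may be adjacent, starting
at a bundle, and only the last of them has neighbours elsewhere. -/
structure IsInitialPath (C : Graph α β) (e : β) (p : ℕ → α) (k : ℕ) : Prop where
  three_le : 3 ≤ k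
  mult : C.IsMultipleEdge e
  link : C.IsLink e (p 0) (p 1)
  mem : ∀ i < k, p i ∈ V(C)
  inj : ∀ i < k, ∀ j < k, p i = p j → i = j
  adj : ∀ i j, i < j → j < k →
    (C.Adj (p i) (p j) ↔ j = i + 1 ∨ (i = 0 ∧ j = 2 ∧ C.Adj (p 0) (p 2)))
  out : ∀ x, (∀ i < k, p i ≠ x) → ∀ i < k, C.Adj (p i) x → i + 1 = k

namespace IsInitialPath

lemma congr (h : C.IsInitialPath e p k) (hp : ∀ i < k, p' i = p i) : C.IsInitialPath e p' k := by
  have h3 := h.three_le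
  have h0 := hp 0 (by omega)
  have h1 := hp 1 (by omega)
  have h2 := hp 2 (by omega)
  refine ⟨h3, h.mult, by rw [h0, h1]; exact h.link, fun i hi => hp i hi ▸ h.mem i hi, ?_, ?_, ?_⟩
  · intro i hi j hj hij
    rw [hp i hi, hp j hj] at hij
    exact h.inj i hi j hj hij
  · intro i j hij hj
    rw [hp i (by omega), hp j hj, h0, h2]
    exact h.adj i j hij hj
  · intro x hx i hi hadj
    rw [hp i hi] at hadj
    exact h.out x (fun j hj => hp j hj ▸ hx j hj) i hi hadj

lemma le_ncard (h : C.IsInitialPath e p k) (hV : V(C).Finite) : k ≤ V(C).ncard := by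
  have h1 : (p '' Set.Iio k).ncard = k := by
    have hinj : Set.InjOn p (Set.Iio k) := fun i hi j hj hij => h.inj i hi j hj hij
    rw [hinj.ncard_image, Set.ncard_eq_toFinset_card']
    simp
  rw [← h1]
  refine Set.ncard_le_ncard ?_ hV
  rintro _ ⟨i, hi, rfl⟩
  exact h.mem i hi

/-- Only the last vertex had neighbours outside and its only one is the new vertex, so the property
is inherited. -/
lemma succ (h : C.IsInitialPath e p k) (hk : ∀ i < k, p i ≠ p k) (hadj : C.Adj (p (k - 1)) (p k))
    (huniq : ∀ x, (∀ i < k, p i ≠ x) → C.Adj (p (k - 1)) x → x = p k) :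
    C.IsInitialPath e p (k + 1) := by
  have h3 := h.three_le
  refine ⟨by omega, h.mult, h.link, fun i hi => ?_, fun i hi j hj hij => ?_, fun i j hij hj => ?_,
    fun x hx i hi hix => ?_⟩
  · rcases Nat.lt_succ_iff_lt_or_eq.1 hi with hi | rfl
    · exact h.mem i hi
    · exact hadj.right_mem
  · rcases Nat.lt_succ_iff_lt_or_eq.1 hi with hi | rfl <;>
      rcases Nat.lt_succ_iff_lt_or_eq.1 hj with hj | rfl
    · exact h.inj i hi j hj hij
    · exact absurd hij (hk i hi)
    · exact absurd hij.symm (hk j hj)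
    · rfl
  · rcases Nat.lt_succ_iff_lt_or_eq.1 hj with hj | rfl
    · exact h.adj i j hij hj
    · constructor
      · intro h'
        exact Or.inl (h.out (p j) hk i hij h').symm
      · rintro (rfl | ⟨-, h', -⟩)
        · exact hadj
        · omega
  · rcases Nat.lt_succ_iff_lt_or_eq.1 hi with hi | rfl
    · have h1 := h.out x (fun j hj => hx j (by omega)) i hi hix
      have h2 : k - 1 = i := by omega
      exact absurd (huniq x (fun j hj => hx j (by omega)) (h2 ▸ hix)).symm (hx k (by omega))
    · rfl

lemma connectedIn [DecidableEq α] (h : C.IsInitialPath e p k) :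
    ConnectedIn C.Adj ((Finset.Ico 2 k).image p) := by
  have key : ∀ l, 3 ≤ l → l ≤ k → ConnectedIn C.Adj ((Finset.Ico 2 l).image p) := by
    intro l hl
    induction l, hl using Nat.le_induction with
    | base =>
      intro _
      have : Finset.Ico 2 3 = {2} := rfl
      rw [this, Finset.image_singleton]
      exact connectedIn_singleton _
    | succ l hl ih =>
      intro hlk
      rw [← Finset.insert_Ico_right_eq_Ico_add_one (by omega), Finset.image_insert]
      refine (ih (by omega)).insert (fun _ _ h => h.symm) (y := p (l - 1)) ?_ ?_
      · exact Finset.mem_image_of_mem p (Finset.mem_Ico.2 (by omega))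
      · exact (h.adj (l - 1) l (by omega) (by omega)).2 (Or.inl (by omega))
  exact key k h.three_le le_rfl

lemma card_image [DecidableEq α] (h : C.IsInitialPath e p k) :
    ((Finset.Ico 2 k).image p).card = k - 2 := by
  rw [Finset.card_image_of_injOn, Nat.card_Ico]
  intro i hi j hj hij
  simp only [Finset.coe_Ico, Set.mem_Ico] at hi hj
  exact h.inj i hi.2 j hj.2 hij

/-- If the last vertex of an initial path with an odd number of vertices has two neighbours elsewhere,
then nothing else is adjacent to the path or to one of these neighbours. -/
lemma eq_of_adj [DecidableEq α] (h : C.IsInitialPath e p k) (hC : C.HasUniqueLinks) (hk : Odd k)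
    {q q' x : α} (hq : ∀ i < k, p i ≠ q) (hq' : ∀ i < k, p i ≠ q') (hqq : q ≠ q')
    (hadj : C.Adj (p (k - 1)) q) (hadj' : C.Adj (p (k - 1)) q') (hx : ∀ i < k, p i ≠ x)
    (hxq : x ≠ q) (hl : C.Adj q x ∨ ∃ i < k, C.Adj (p i) x) : x = q' := by
  have h3 := h.three_le
  have hmem : ∀ z, z ∈ (Finset.Ico 2 k).image p ↔ ∃ i, 2 ≤ i ∧ i < k ∧ p i = z := by
    intro z
    simp [and_assoc]
  have hlast : p (k - 1) ∈ (Finset.Ico 2 k).image p := (hmem _).2 ⟨k - 1, by omega, by omega, rfl⟩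
  have hqW : q ∉ (Finset.Ico 2 k).image p := fun h => by
    obtain ⟨i, -, hi, h⟩ := (hmem q).1 h
    exact hq i hi h
  have hlow : ∀ j < 2, p j ∉ insert q ((Finset.Ico 2 k).image p) := by
    intro j hj h'
    rcases Finset.mem_insert.1 h' with h' | h'
    · exact hq j (by omega) h'
    · obtain ⟨i, hi2, hi, h'⟩ := (hmem _).1 h'
      have := h.inj i hi j (by omega) h'
      omega
  have hout : ∀ y, (∀ i < k, p i ≠ y) → y ≠ q → y ∉ insert q ((Finset.Ico 2 k).image p) := by
    intro y hy hyq h'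
    rcases Finset.mem_insert.1 h' with h' | h'
    · exact hyq h'
    · obtain ⟨i, -, hi, h'⟩ := (hmem _).1 h'
      exact hy i hi h'
  -- The path beyond the bundle has the odd number `k - 2` of vertices; together with `q` it is a
  -- connected set of even size over which both `x` and `q'` are linked to the bundle.
  refine hC.eq_of_connectedIn h.mult h.link (W := insert q ((Finset.Ico 2 k).image p)) ?_
    (hlow 0 (by omega)) (hlow 1 (by omega)) (h.connectedIn.insert (fun _ _ h => h.symm) hlast hadj)
    ?_ (w := p 2) ?_ ((h.adj 1 2 (by omega) (by omega)).2 (Or.inl rfl)) (hout x hx hxq)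
    (hout q' hq' hqq.symm) (hx 0 (by omega)).symm (hx 1 (by omega)).symm (hq' 0 (by omega)).symm
    (hq' 1 (by omega)).symm ?_ ?_
  · intro w hw
    rcases Finset.mem_insert.1 hw with rfl | hw
    · exact hadj.right_mem
    · obtain ⟨i, -, hi, rfl⟩ := (hmem w).1 hw
      exact h.mem i hi
  · rw [Finset.card_insert_of_notMem hqW, h.card_image]
    obtain ⟨l, hl⟩ := hk
    exact ⟨l, by omega⟩
  · exact Finset.mem_insert_of_mem ((hmem _).2 ⟨2, le_rfl, by omega, rfl⟩)
  · rcases hl with hl | ⟨i, hi, hl⟩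
    · exact Or.inr (Or.inr ⟨q, Finset.mem_insert_self _ _, hl⟩)
    · have h1 := h.out x hx i hi hl
      exact Or.inr (Or.inr ⟨p i, Finset.mem_insert_of_mem ((hmem _).2 ⟨i, by omega, hi, rfl⟩), hl⟩)
  · exact Or.inr (Or.inr ⟨_, Finset.mem_insert_of_mem hlast, hadj'⟩)

/-- For even `k` the path beyond the bundle is connected of even size `k - 2`, and both `q` and `q'`
would be linked over it. -/
lemma odd_of_two_neighbors [DecidableEq α] (h : C.IsInitialPath e p k) (hC : C.HasUniqueLinks)
    {q q' : α} (hq : ∀ i < k, p i ≠ q) (hq' : ∀ i < k, p i ≠ q') (hqq : q ≠ q')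
    (hadj : C.Adj (p (k - 1)) q) (hadj' : C.Adj (p (k - 1)) q') : Odd k := by
  by_contra hk
  rw [Nat.not_odd_iff_even] at hk
  have h3 := h.three_le
  have hmem : ∀ z, z ∈ (Finset.Ico 2 k).image p ↔ ∃ i, 2 ≤ i ∧ i < k ∧ p i = z := by
    intro z
    simp [and_assoc]
  have hlast : p (k - 1) ∈ (Finset.Ico 2 k).image p := (hmem _).2 ⟨k - 1, by omega, by omega, rfl⟩
  have hlow : ∀ j < 2, p j ∉ (Finset.Ico 2 k).image p := by
    intro j hj h'
    obtain ⟨i, hi2, hi, h'⟩ := (hmem _).1 h'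
    have := h.inj i hi j (by omega) h'
    omega
  have hout : ∀ y, (∀ i < k, p i ≠ y) → y ∉ (Finset.Ico 2 k).image p := by
    intro y hy h'
    obtain ⟨i, -, hi, h'⟩ := (hmem _).1 h'
    exact hy i hi h'
  refine hqq (hC.eq_of_connectedIn h.mult h.link (W := (Finset.Ico 2 k).image p) ?_
    (hlow 0 (by omega)) (hlow 1 (by omega)) h.connectedIn ?_ (w := p 2)
    ((hmem _).2 ⟨2, le_rfl, by omega, rfl⟩) ((h.adj 1 2 (by omega) (by omega)).2 (Or.inl rfl))
    (hout q hq) (hout q' hq') (hq 0 (by omega)).symm (hq 1 (by omega)).symm (hq' 0 (by omega)).symm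
    (hq' 1 (by omega)).symm (Or.inr (Or.inr ⟨_, hlast, hadj⟩)) (Or.inr (Or.inr ⟨_, hlast, hadj'⟩)))
  · intro w hw
    obtain ⟨i, -, hi, rfl⟩ := (hmem w).1 hw
    exact h.mem i hi
  · rw [h.card_image]
    obtain ⟨l, hl⟩ := hk
    exact ⟨l - 1, by omega⟩

/-- The path ends here; whether `p 0` and `p 2` are adjacent decides between the plain and the
primed path. -/
lemma isListed_of_closed [DecidableEq α] [C.Loopless] (h : C.IsInitialPath e p k)
    (hC : C.HasUniqueLinks) (hconn : C.IsConnected) (hE : E(C).Finite)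
    (hcl : ∀ i < k, ∀ y, C.Adj (p i) y → ∃ j < k, p j = y) : C.IsListed := by
  have h3 := h.three_le
  by_cases h02 : C.Adj (p 0) (p 2)
  · have hN : C.IsNumbering k (fun i j => pathRel i j ∨ chordRel i j) p :=
      isNumbering_of_closed hC hconn h.mult h.link (by omega) h.mem h.inj hcl fun i j hij hj => by
        rw [h.adj i j hij hj]
        simp [pathRel, chordRel, h02]
    exact ⟨k, _, hN.two_le_ncard hE, Or.inr (Or.inl ⟨h3, hN.isIsomorphic hE⟩)⟩
  · have hN : C.IsNumbering k pathRel p :=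
      isNumbering_of_closed hC hconn h.mult h.link (by omega) h.mem h.inj hcl fun i j hij hj => by
        rw [h.adj i j hij hj]
        simp [pathRel, h02]
    exact ⟨k, _, hN.two_le_ncard hE, Or.inl ⟨by omega, hN.isIsomorphic hE⟩⟩

/-- By `eq_of_adj` the component has no vertices besides the path and these two. The possible edges
`p k`–`p (k + 1)` and `p 0`–`p 2` distinguish the four families with `n = k + 2` odd. -/
lemma isListed_of_two_neighbors [DecidableEq α] [C.Loopless] (h : C.IsInitialPath e p k)
    (hC : C.HasUniqueLinks) (hconn : C.IsConnected) (hE : E(C).Finite)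
    (hq : ∀ i < k, p i ≠ p k) (hq' : ∀ i < k, p i ≠ p (k + 1)) (hqq : p k ≠ p (k + 1))
    (hadj : C.Adj (p (k - 1)) (p k)) (hadj' : C.Adj (p (k - 1)) (p (k + 1))) : C.IsListed := by
  have h3 := h.three_le
  have hodd := h.odd_of_two_neighbors hC hq hq' hqq hadj hadj'
  have hlt : ∀ {i}, i < k + 2 → i < k ∨ i = k ∨ i = k + 1 := by omega
  have hmem : ∀ i < k + 2, p i ∈ V(C) := by
    intro i hi
    rcases hlt hi with hi | rfl | rfl
    · exact h.mem i hi
    · exact hadj.right_mem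
    · exact hadj'.right_mem
  have hinj : ∀ i < k + 2, ∀ j < k + 2, p i = p j → i = j := by
    intro i hi j hj hij
    rcases hlt hi with hi | rfl | rfl <;> rcases hlt hj with hj | rfl | rfl
    · exact h.inj i hi j hj hij
    · exact absurd hij (hq i hi)
    · exact absurd hij (hq' i hi)
    · exact absurd hij.symm (hq j hj)
    · rfl
    · exact absurd hij hqq
    · exact absurd hij.symm (hq' j hj)
    · exact absurd hij.symm hqq
    · rfl
  have hcl : ∀ i < k + 2, ∀ y, C.Adj (p i) y → ∃ j < k + 2, p j = y := by
    intro i hi y hiy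
    by_contra hcon
    push Not at hcon
    have hy : ∀ i < k, p i ≠ y := fun i hi => hcon i (by omega)
    have hyq := hcon k (by omega)
    have hyq' := hcon (k + 1) (by omega)
    rcases hlt hi with hi | rfl | rfl
    · exact hyq' (h.eq_of_adj hC hodd hq hq' hqq hadj hadj' hy hyq.symm (Or.inr ⟨i, hi, hiy⟩)).symm
    · exact hyq' (h.eq_of_adj hC hodd hq hq' hqq hadj hadj' hy hyq.symm (Or.inl hiy)).symm
    · exact hyq (h.eq_of_adj hC hodd hq' hq hqq.symm hadj' hadj hy hyq'.symm (Or.inl hiy)).symm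
  have hR : ∀ i j, i < j → j < k + 2 → (C.Adj (p i) (p j) ↔
      (j = i + 1 ∧ j ≤ k) ∨ (i + 1 = k ∧ j = k + 1) ∨ (i = k ∧ j = k + 1 ∧ C.Adj (p k) (p (k + 1)))
        ∨ (i = 0 ∧ j = 2 ∧ C.Adj (p 0) (p 2))) := by
    intro i j hij hj
    rcases hlt hj with hj | rfl | rfl
    · rw [h.adj i j hij hj]
      constructor
      · rintro (h' | h')
        · exact Or.inl ⟨h', by omega⟩
        · exact Or.inr (Or.inr (Or.inr h'))
      · rintro (h' | h' | h' | h')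
        · exact Or.inl h'.1
        · omega
        · omega
        · exact Or.inr h'
    · constructor
      · intro h'
        have := h.out _ hq i hij h'
        exact Or.inl ⟨this.symm, le_rfl⟩
      · rintro (h' | h' | h' | h')
        · obtain rfl : i = j - 1 := by omega
          exact hadj
        · omega
        · omega
        · omega
    · constructor
      · intro h'
        rcases Nat.lt_succ_iff_lt_or_eq.1 hij with hi | rfl
        · exact Or.inr (Or.inl ⟨h.out _ hq' i hi h', rfl⟩)
        · exact Or.inr (Or.inr (Or.inl ⟨rfl, rfl, h'⟩))
      · rintro (h' | h' | h' | h')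
        · omega
        · obtain rfl : i = k - 1 := by omega
          exact hadj'
        · rw [h'.1]
          exact h'.2.2
        · omega
  have hodd' : Odd (k + 2) := hodd.add_even even_two
  have hnum : ∀ {R : ℕ → ℕ → Prop}, (∀ i j, i < j → j < k + 2 → (C.Adj (p i) (p j) ↔ R i j)) →
      C.IsNumbering (k + 2) R p := fun {R} hR =>
    isNumbering_of_closed hC hconn h.mult h.link (by omega) hmem hinj hcl hR
  by_cases h02 : C.Adj (p 0) (p 2) <;> by_cases hkk : C.Adj (p k) (p (k + 1)) <;>
    simp only [h02, hkk, and_true, and_false, or_false, false_or] at hR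
  · have hN := hnum (R := fun i j => triangleRel (k + 2) i j ∨ chordRel i j) fun i j hij hj => by
      rw [hR i j hij hj]
      simp only [triangleRel, chordRel]
      omega
    exact ⟨k + 2, _, hN.two_le_ncard hE, Or.inr (Or.inr ⟨by omega, hodd',
      Or.inr (Or.inr (Or.inr (hN.isIsomorphic hE)))⟩)⟩
  · have hN := hnum (R := fun i j => forkRel (k + 2) i j ∨ chordRel i j) fun i j hij hj => by
      rw [hR i j hij hj]
      simp only [forkRel, chordRel]
      omega
    exact ⟨k + 2, _, hN.two_le_ncard hE, Or.inr (Or.inr ⟨by omega, hodd',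
      Or.inr (Or.inr (Or.inl (hN.isIsomorphic hE)))⟩)⟩
  · have hN := hnum (R := triangleRel (k + 2)) fun i j hij hj => by
      rw [hR i j hij hj]
      simp only [triangleRel]
      omega
    exact ⟨k + 2, _, hN.two_le_ncard hE, Or.inr (Or.inr ⟨by omega, hodd',
      Or.inr (Or.inl (hN.isIsomorphic hE))⟩)⟩
  · have hN := hnum (R := forkRel (k + 2)) fun i j hij hj => by
      rw [hR i j hij hj]
      simp only [forkRel]
      omega
    exact ⟨k + 2, _, hN.two_le_ncard hE, Or.inr (Or.inr ⟨by omega, hodd',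
      Or.inl (hN.isIsomorphic hE)⟩)⟩

/-- The cases are whether the last vertex has none, one, or at least two neighbours outside the
path. -/
lemma isListed_or_exists_succ [DecidableEq α] [C.Loopless] (h : C.IsInitialPath e p k)
    (hC : C.HasUniqueLinks) (hconn : C.IsConnected) (hE : E(C).Finite) :
    C.IsListed ∨ ∃ p', C.IsInitialPath e p' (k + 1) := by
  have h3 := h.three_le
  by_cases h0 : ∃ q, (∀ i < k, p i ≠ q) ∧ C.Adj (p (k - 1)) q
  · obtain ⟨q, hq, hadj⟩ := h0
    by_cases h1 : ∃ q', q' ≠ q ∧ (∀ i < k, p i ≠ q') ∧ C.Adj (p (k - 1)) q'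
    · obtain ⟨q', hqq, hq', hadj'⟩ := h1
      set p' : ℕ → α := fun i => if i < k then p i else if i = k then q else q' with hp'
      have e1 : ∀ i < k, p' i = p i := fun i hi => by simp [hp', hi]
      have e2 : p' k = q := by simp [hp']
      have e3 : p' (k + 1) = q' := by simp [hp']
      have e4 := e1 (k - 1) (by omega)
      refine Or.inl ((h.congr e1).isListed_of_two_neighbors hC hconn hE ?_ ?_ ?_ ?_ ?_)
      · intro i hi
        rw [e1 i hi, e2]
        exact hq i hi
      · intro i hi
        rw [e1 i hi, e3]
        exact hq' i hi
      · rw [e2, e3]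
        exact hqq.symm
      · rwa [e4, e2]
      · rwa [e4, e3]
    · right
      push Not at h1
      set p' : ℕ → α := fun i => if i < k then p i else q with hp'
      have e1 : ∀ i < k, p' i = p i := fun i hi => by simp [hp', hi]
      have e2 : p' k = q := by simp [hp']
      have e4 := e1 (k - 1) (by omega)
      refine ⟨p', (h.congr e1).succ (fun i hi => ?_) (by rwa [e4, e2]) fun x hx hadj => ?_⟩
      · rw [e1 i hi, e2]
        exact hq i hi
      · rw [e2]
        by_contra hxq
        exact h1 x hxq (fun i hi => e1 i hi ▸ hx i hi) (e4 ▸ hadj)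
  · left
    push Not at h0
    refine h.isListed_of_closed hC hconn hE fun i hi y hy => ?_
    by_contra hcon
    push Not at hcon
    have := h.out y hcon i hi hy
    obtain rfl : i = k - 1 := by omega
    exact h0 y hcon hy

/-- A path cannot have more vertices than `C`, so the extension stops. -/
lemma isListed [DecidableEq α] [C.Loopless] (hC : C.HasUniqueLinks) (hconn : C.IsConnected)
    (hV : V(C).Finite) (hE : E(C).Finite) (h : C.IsInitialPath e p k) : C.IsListed := by
  induction hd : V(C).ncard - k generalizing p k with
  | zero =>
    refine (h.isListed_or_exists_succ hC hconn hE).resolve_right fun ⟨p', h'⟩ => ?_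
    have := h'.le_ncard hV
    omega
  | succ d ih =>
    rcases h.isListed_or_exists_succ hC hconn hE with h' | ⟨p', h'⟩
    · exact h'
    · exact ih h' (by omega)

end IsInitialPath

/-- The clause on links for `W = ∅` says that the two ends of the bundle have, between them, at most
one further neighbour. Without one the component is the bundle; with one there is an initial path of
three vertices. -/
theorem HasUniqueLinks.isListed [DecidableEq α] [C.Loopless] (hC : C.HasUniqueLinks)
    (hconn : C.IsConnected) (hV : V(C).Finite) (hE : E(C).Finite) (he : C.IsMultipleEdge e)
    (huv : C.IsLink e u v) : C.IsListed := by
  have hne : u ≠ v := huv.adj.ne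
  have huniq : ∀ {r r' c c'}, (r = u ∨ r = v) → (r' = u ∨ r' = v) → c ≠ u → c ≠ v → c' ≠ u →
      c' ≠ v → C.Adj r c → C.Adj r' c' → c = c' := fun {r r' c c'} hr hr' h1 h2 h3 h4 h5 h6 =>
    hC.unique e u v he huv ∅ (by simp) (by simp) (by simp)
      (fun D hD => by simp [Finset.subset_empty.1 hD.1]) r r' c c' hr hr' (by simp) (by simp) h1 h2
      h3 h4 (linkedOver_of_adj h5) (linkedOver_of_adj h6)
  by_cases h0 : ∃ r c, (r = u ∨ r = v) ∧ c ≠ u ∧ c ≠ v ∧ C.Adj r c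
  · obtain ⟨r, c, hr, hcu, hcv, hadj⟩ := h0
    -- The end adjacent to the third vertex is called `p 1`; the other end may be adjacent to it as
    -- well, which is the chord.
    wlog hrv : r = v generalizing u v
    · exact this huv.symm hne.symm (fun h1 h2 h3 h4 h5 h6 => huniq h1.symm h2.symm h4 h3 h6 h5)
        hr.symm hcv hcu (hr.resolve_right hrv)
    subst hrv
    set p : ℕ → α := fun i => if i = 0 then u else if i = 1 then r else c with hp
    have e0 : p 0 = u := by simp [hp]
    have e1 : p 1 = r := by simp [hp]
    have e2 : p 2 = c := by simp [hp]
    have hlt : ∀ {i : ℕ}, i < 3 → i = 0 ∨ i = 1 ∨ i = 2 := by omega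
    refine IsInitialPath.isListed (e := e) (p := p) (k := 3) hC hconn hV hE
      ⟨le_rfl, he, by rwa [e0, e1], ?_, ?_, ?_, ?_⟩
    · intro i hi
      rcases hlt hi with rfl | rfl | rfl
      · exact e0 ▸ huv.left_mem
      · exact e1 ▸ huv.right_mem
      · exact e2 ▸ hadj.right_mem
    · intro i hi j hj hij
      rcases hlt hi with rfl | rfl | rfl <;> rcases hlt hj with rfl | rfl | rfl <;>
        simp only [e0, e1, e2] at hij <;> first | rfl | (exfalso; simp_all)
    · intro i j hij hj
      have h' : (i = 0 ∧ j = 1) ∨ (i = 1 ∧ j = 2) ∨ (i = 0 ∧ j = 2) := by omega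
      rcases h' with ⟨rfl, rfl⟩ | ⟨rfl, rfl⟩ | ⟨rfl, rfl⟩
      · simp [e0, e1, huv.adj]
      · simp [e1, e2, hadj]
      · simp
    · intro x hx i hi hix
      have x0 := hx 0 (by omega)
      have x1 := hx 1 (by omega)
      have x2 := hx 2 (by omega)
      rw [e0] at x0
      rw [e1] at x1
      rw [e2] at x2
      rcases hlt hi with rfl | rfl | rfl
      · rw [e0] at hix
        exact absurd (huniq (Or.inr rfl) (Or.inl rfl) hcu hcv x0.symm x1.symm hadj hix) x2
      · rw [e1] at hix
        exact absurd (huniq (Or.inr rfl) (Or.inr rfl) hcu hcv x0.symm x1.symm hadj hix) x2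
      · rfl
  · push Not at h0
    set p : ℕ → α := fun i => if i = 0 then u else v with hp
    have e0 : p 0 = u := by simp [hp]
    have e1 : p 1 = v := by simp [hp]
    have hlt : ∀ {i : ℕ}, i < 2 → i = 0 ∨ i = 1 := by omega
    have hN : C.IsNumbering 2 pathRel p := by
      refine isNumbering_of_closed hC hconn he (by rwa [e0, e1]) le_rfl ?_ ?_ ?_ ?_
      · intro i hi
        rcases hlt hi with rfl | rfl
        · exact e0 ▸ huv.left_mem
        · exact e1 ▸ huv.right_mem
      · intro i hi j hj hij
        rcases hlt hi with rfl | rfl <;> rcases hlt hj with rfl | rfl <;>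
          simp only [e0, e1] at hij <;> first | rfl | (exfalso; simp_all)
      · intro i hi y hy
        by_contra hcon
        push Not at hcon
        refine h0 (p i) y ?_ (e0 ▸ (hcon 0 (by omega)).symm) (e1 ▸ (hcon 1 (by omega)).symm) hy
        rcases hlt hi with rfl | rfl
        · exact Or.inl e0
        · exact Or.inr e1
      · intro i j hij hj
        obtain ⟨rfl, rfl⟩ : i = 0 ∧ j = 1 := by omega
        simp [e0, e1, huv.adj, pathRel]
    exact ⟨2, _, hN.two_le_ncard hE, Or.inl ⟨le_rfl, hN.isIsomorphic hE⟩⟩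

/-- A component is an induced subgraph, hence a PI-graph, and so inherits unique links. -/
theorem HasUniqueLinks.simple_or_isListed [DecidableEq α] [G.Loopless] (hG : G.HasUniqueLinks)
    (hV : V(G).Finite) (hE : E(G).Finite) (hC : C.IsComponent G) : C.Simple ∨ C.IsListed := by
  have hle := hC.1.le
  have hL : C.Loopless := Loopless.anti hle
  have hPI : C.IsPIGraph G := by
    refine ⟨G, ⟨⟨le_refl G, rfl⟩, fun x y _ => Or.inl fun e he => he⟩, hle, fun e x y h hx hy => ?_⟩
    exact (hC.1.isLink_congr hx).2 h
  by_cases hs : ∃ e f x y, C.IsLink e x y ∧ C.IsLink f x y ∧ e ≠ f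
  · obtain ⟨e, f, x, y, he, hf, hne⟩ := hs
    exact Or.inr ((hG.of_isPIGraph hPI).isListed hC.2 (hV.subset hle.vertexSet_mono)
      (hE.subset hle.edgeSet_mono) ⟨f, hne.symm, x, y, he, hf⟩ he)
  · push Not at hs
    exact Or.inl ⟨fun e f x y he hf => hs e f x y he hf⟩

end Graph

theorem theorem1p1 {α β : Type*} (G : Graph α β) [G.Loopless]
    (hV : G.vertexSet.Finite) (hE : G.edgeSet.Finite) :
    (∀ p ∈ G.admissiblePairs, PosetShellable (p.1.EvenPoset p.2)) ↔
      ∀ C : Graph α β, C.IsComponent G → C.Simple ∨ C.IsListed := by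
  classical
  refine ⟨fun h C hC => ?_, fun h p hp => ?_⟩
  · exact (Graph.hasUniqueLinks_of_posetShellable hE h).simple_or_isListed hV hE hC
  · exact (Graph.hasUniqueLinks_of_isListed h).posetShellable hV hE hp.1 hp.2
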